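/- **Setting.** Let $\Omega\subset\{(r,z):r>0\}$ be a bounded Lipschitz domain (the meridian section of an axisymmetric domain), $\Gamma_{\rm rot}=\partial\Omega\cap\{r=0\}$ and $\Gamma=\partial\Omega\setminus\Gamma_{\rm rot}$. For $k\in\{-1,1\}$ let $L^2_k$ be the $L^2$ space on $\Omega$ with weight $r^k\,dr\,dz$. Let $H^1_1,H^2_1$ be the Sobolev spaces of functions whose weak derivatives up to order 1, respectively 2, lie in $L^2_1$. For $0<s<1$ let $H^s_1=[L^2_1,H^1_1]_s$ and $H^{1+s}_1=[H^1_1,H^2_1]_s$ (Hilbertian interpolation). An unindexed $(\cdot,\cdot)_{L^2}$ is unweighted. Let $V$ be the space of fields $v=(v_r,v_z)\in H^1_1(\Omega)^2$ with $v_r\in L^2_{-1}$ and $v=0$ on $\Gamma$, let $Q=\{q\in L^2_1:\int_\Omega rq=0\}$, and $$a(u,v)=(\nabla u,\nabla v)_{L^2_1}+(u_r,v_r)_{L^2_{-1}},\quad b(q,v)=(\operatorname{div}_{(r,z)}(rv),q)_{L^2},\quad \|v\|_V=a(v,v)^{1/2}.$$ For $\nu>0$ and $f\in L^2_1(\Omega)^2$,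 a pair $(u,p)\in V\times Q$ solves the axisymmetric Stokes problem if $$\nu a(u,v)+b(p,v)=(f,rv)_{L^2}\ \ \forall v\in V,\qquad b(q,u)=0\ \ \forall q\in Q .$$ The problem has $H^{1+s}_1\times H^s_1$ elliptic regularity with constant $C_{\rm reg}$ if for all $\nu>0$ and $f\in L^2_1(\Omega)^2$ it has a solution with $\nu\|u\|_{H^{1+s}_1}+\|p\|_{H^s_1}\le C_{\rm reg}\|f\|_{L^2_1}$. Let $\alpha_f\in H^1_1(\Omega)/\mathbb R$ satisfy $(\nabla\alpha_f,\nabla\beta)_{L^2_1}=(f,\nabla\beta)_{L^2_1}$ for all $\beta\in H^1_1(\Omega)$, and let $\mathbb Pf=f-\nabla\alpha_f$. The functional $v_0\mapsto -a(u,v_0)$ on $\{v_0\in V:b(q,v_0)=0\ \forall q\in Q\}$ is denoted $\mathbb P(\Delta_{\rm axi}u)$ and is identified with its representation $-\nu^{-1}\mathbb Pf\in L^2_1$. For a conforming triangulation $\mathcal T$ of $\Omega$ with maximal triangle diameter $h$, let $V_h\subset V$ be the Bernardi–Raugel space: the fields in $V$ that are sums of a continuous piecewise affine field and edge bubbles $c_E\,\lambda_i\lambda_j\,n_E$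 over the edges $E=\operatorname{conv}\{N_i,N_j\}$, where $\lambda_i,\lambda_j$ are the nodal hat functions and $n_E$ is a unit normal of $E$. Let $Q_h\subset Q$ be the piecewise constants in $Q$, and $V_{h,0}=\{v_h\in V_h:b(q_h,v_h)=0\ \forall q_h\in Q_h\}$. Let $\Pi$ be a linear reconstruction operator for which there is a constant $C_\Pi$ with $$\|\Pi(rv_h)\|_{L^2_{-1}}\le C_\Pi\|v_h\|_V\qquad\forall v_h\in V_h .$$ A pair $(u_h,p_h)\in V_h\times Q_h$ solves the modified scheme if $$\nu a(u_h,v_h)+b(p_h,v_h)=(f,\Pi(rv_h))_{L^2}\ \ \forall v_h\in V_h,\qquad b(q_h,u_h)=0\ \ \forall q_h\in Q_h .$$ **Theorem 3.2 (A priori error estimate).** Let $0<s\le1$ and assume the problem on $\Omega$ has $H^{1+s}_1\times H^s_1$ elliptic regularity with constant $C_{\rm reg}$. Then there is a constant $C>0$ depending only on $\Omega$, $s$ and $C_{\rm reg}$ such that for all $\mathcal T$, $\Pi$, $\nu>0$ and $f\in L^2_1(\Omega)^2$ as above, for every solution $(u,p)$ of the Stokes problem and every solution $(u_h,p_h)$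 of the modified scheme, $$\|u-u_h\|_V\le C\Big(\inf_{v_h\in V_{h,0}}\|u-v_h\|_V+h^s\|\mathbb P(\Delta_{\rm axi}u)\|_{L^2_1}+\mathcal R_\Pi\Big),$$ where $$\mathcal R_\Pi=\sup_{w_h\in V_{h,0}}\frac{(\mathbb P(\Delta_{\rm axi}u),\,rw_h-\Pi(rw_h))_{L^2}}{\|w_h\|_V}+\nu^{-1}\sup_{w_h\in V_{h,0}}\frac{(\nabla\alpha_f,\Pi(rw_h))_{L^2}}{\|w_h\|_V}$$ (with $0/0=0$), and both suprema are finite. -/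

import Mathlib

open MeasureTheory Set
open scoped ENNReal ContDiff

noncomputable section

namespace AxiStokes

/-- Points of the meridian plane with the Euclidean norm: `x 0` is the radius `r`, `x 1` is `z`.
Axisymmetric velocity fields without swirl are maps `v : Pt → Pt`, `v x 0 = v_r`, `v x 1 = v_z`. -/
abbrev Pt : Type := EuclideanSpace ℝ (Fin 2)

/-! ### Geometry -/

/-- The boundary of `Ω` is locally, after a rigid motion, the graph of a Lipschitz function with
`Ω` lying on one side of it. -/
def HasLipschitzBoundary (Ω : Set Pt) : Prop :=
  ∀ x ∈ frontier Ω, ∃ (e : Pt ≃ᵃⁱ[ℝ] Pt) (γ : ℝ → ℝ) (L : NNReal) (δ : ℝ),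
    LipschitzWith L γ ∧ 0 < δ ∧ ∀ y ∈ Metric.ball x δ, (y ∈ Ω ↔ γ (e y 0) < e y 1)

/-- A meridian domain: a bounded Lipschitz domain in the half plane of positive radius.  (The
points of the rotation axis form a null set; they are boundary points here.) -/
structure IsMeridianDomain (Ω : Set Pt) : Prop where
  isOpen : IsOpen Ω
  isConnected : IsConnected Ω
  isBounded : Bornology.IsBounded Ω
  radius_pos : ∀ x ∈ Ω, 0 < x 0
  lipschitz : HasLipschitzBoundary Ω

/-- The part of the boundary on the rotation axis. -/
def axisPart (Ω : Set Pt) : Set Pt := {x ∈ frontier Ω | x 0 = 0}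

/-- The part `Γ` of the boundary off the rotation axis. -/
def outerBoundary (Ω : Set Pt) : Set Pt := frontier Ω \ axisPart Ω

/-! ### Weighted Lebesgue and Sobolev spaces -/

/-- The measure `r ^ k dr dz` on `Ω`; thus `L²_k(Ω)` is `MemLp · 2 (wMeas Ω k)`. -/
def wMeas (Ω : Set Pt) (k : ℤ) : Measure Pt :=
  (volume.restrict Ω).withDensity fun x => ENNReal.ofReal (x 0 ^ k)

/-- The norm of `L²_k(Ω)`, for scalar or vector-valued functions. -/
def normL2 {E : Type*} [NormedAddCommGroup E] (Ω : Set Pt) (k : ℤ) (q : Pt → E) : ℝ :=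
  (eLpNorm q 2 (wMeas Ω k)).toReal

/-- The unweighted pairing `(f, g)_{L²} = ∫_Ω f · g dr dz` of vector fields. -/
def pairL2 (Ω : Set Pt) (f g : Pt → Pt) : ℝ := ∫ x in Ω, inner ℝ (f x) (g x)

/-- `g` is the distributional gradient of `p` on `Ω`. -/
def IsWeakGrad (Ω : Set Pt) (p : Pt → ℝ) (g : Pt → Pt) : Prop :=
  LocallyIntegrableOn p Ω ∧ LocallyIntegrableOn g Ω ∧
    ∀ φ : Pt → ℝ, ContDiff ℝ ∞ φ → HasCompactSupport φ → tsupport φ ⊆ Ω → ∀ i : Fin 2,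
      ∫ x in Ω, p x * fderiv ℝ φ x (EuclideanSpace.single i 1) = -∫ x in Ω, g x i * φ x

open Classical in
/-- The weak gradient, unique up to null sets; `0` if there is none. -/
def weakGrad (Ω : Set Pt) (p : Pt → ℝ) : Pt → Pt :=
  if h : ∃ g, IsWeakGrad Ω p g then h.choose else 0

/-- The weak divergence `∂_r w_r + ∂_z w_z` in the coordinates `(r, z)`. -/
def weakDiv (Ω : Set Pt) (w : Pt → Pt) (x : Pt) : ℝ :=
  ∑ i, weakGrad Ω (fun y => w y i) x i

/-- Membership in `H¹_1(Ω)`. -/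
def MemH1 (Ω : Set Pt) (q : Pt → ℝ) : Prop :=
  MemLp q 2 (wMeas Ω 1) ∧ (∃ g, IsWeakGrad Ω q g) ∧ MemLp (weakGrad Ω q) 2 (wMeas Ω 1)

/-- Membership in `H²_1(Ω)`. -/
def MemH2 (Ω : Set Pt) (q : Pt → ℝ) : Prop :=
  MemH1 Ω q ∧ ∀ i, MemH1 Ω fun x => weakGrad Ω q x i

open Classical in
/-- The squared norm of `L²_1(Ω)`, infinite off the space. -/
def sqL2 (Ω : Set Pt) (q : Pt → ℝ) : ℝ≥0∞ :=
  if MemLp q 2 (wMeas Ω 1) then eLpNorm q 2 (wMeas Ω 1) ^ 2 else ∞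

open Classical in
/-- The squared norm of `H¹_1(Ω)`, infinite off the space. -/
def sqH1 (Ω : Set Pt) (q : Pt → ℝ) : ℝ≥0∞ :=
  if MemH1 Ω q then
    eLpNorm q 2 (wMeas Ω 1) ^ 2 + eLpNorm (weakGrad Ω q) 2 (wMeas Ω 1) ^ 2
  else ∞

open Classical in
/-- The squared norm of `H²_1(Ω)`, infinite off the space. -/
def sqH2 (Ω : Set Pt) (q : Pt → ℝ) : ℝ≥0∞ :=
  if MemH2 Ω q then
    sqH1 Ω q + ∑ i, eLpNorm (weakGrad Ω fun x => weakGrad Ω q x i) 2 (wMeas Ω 1) ^ 2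
  else ∞

/-- The squared norm of the Hilbertian interpolation space `[X₀, X₁]_s`, `0 < s < 1`, by the
quadratic `K`-method, where `X₀ ⊇ X₁` are given by their squared norms `N₀`, `N₁`:
`∫_0^∞ t^(-2s-1) inf_{q₁} (N₀ (q - q₁) + t² N₁ q₁) dt`. -/
def interpSq (N₀ N₁ : (Pt → ℝ) → ℝ≥0∞) (s : ℝ) (q : Pt → ℝ) : ℝ≥0∞ :=
  ∫⁻ t in Ioi (0 : ℝ), ENNReal.ofReal (t ^ (-2 * s - 1)) *
    ⨅ q₁ : Pt → ℝ, (N₀ (q - q₁) + ENNReal.ofReal (t ^ 2) * N₁ q₁)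

/-- The norm of `H^s_1(Ω)`, `0 < s ≤ 1` (infinite off the space): for `s < 1` the interpolation
space between `L²_1(Ω)` and `H¹_1(Ω)`. -/
def sobolevNorm (Ω : Set Pt) (s : ℝ) (q : Pt → ℝ) : ℝ≥0∞ :=
  (if s = 1 then sqH1 Ω q else interpSq (sqL2 Ω) (sqH1 Ω) s q) ^ (1 / 2 : ℝ)

/-- The norm of the vector-valued space `H^{1+s}_1(Ω)`, `0 < s ≤ 1` (infinite off the space): for
`s < 1` the interpolation space between `H¹_1(Ω)` and `H²_1(Ω)`, componentwise. -/
def sobolevNormSucc (Ω : Set Pt) (s : ℝ) (u : Pt → Pt) : ℝ≥0∞ :=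
  (∑ i, if s = 1 then sqH2 Ω (fun x => u x i)
    else interpSq (sqH1 Ω) (sqH2 Ω) s fun x => u x i) ^ (1 / 2 : ℝ)

/-! ### The continuous Stokes problem -/

/-- The full norm on `{v ∈ H¹_1(Ω)² : v_r ∈ L²_{-1}(Ω)}` (up to equivalence). -/
def graphNorm (Ω : Set Pt) (v : Pt → Pt) : ℝ≥0∞ :=
  (∑ i, (eLpNorm (fun x => v x i) 2 (wMeas Ω 1) +
    eLpNorm (weakGrad Ω fun x => v x i) 2 (wMeas Ω 1))) +
  eLpNorm (fun x => v x 0) 2 (wMeas Ω (-1))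

/-- The velocity space `V`: fields in `H¹_1(Ω)²` with `v_r ∈ L²_{-1}(Ω)` that vanish on `Γ`, in the
sense that they are limits of smooth fields vanishing near `Γ`.  Nothing is imposed on the rotation
axis besides `v_r ∈ L²_{-1}(Ω)`. -/
def velSpace (Ω : Set Pt) : Set (Pt → Pt) :=
  {v | (∀ i, MemH1 Ω fun x => v x i) ∧ MemLp (fun x => v x 0) 2 (wMeas Ω (-1)) ∧
    ∀ ε : ℝ≥0∞, 0 < ε → ∃ φ : Pt → Pt, ContDiff ℝ ∞ φ ∧
      Disjoint (tsupport φ) (closure (outerBoundary Ω)) ∧ graphNorm Ω (v - φ) < ε}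

/-- The pressure space `Q`: functions in `L²_1(Ω)` with `∫_Ω r q = 0`. -/
def presSpace (Ω : Set Pt) : Set (Pt → ℝ) :=
  {q | MemLp q 2 (wMeas Ω 1) ∧ ∫ x, q x ∂(wMeas Ω 1) = 0}

/-- `a(u, v) = (∇u, ∇v)_{L²_1} + (u_r, v_r)_{L²_{-1}}`. -/
def formA (Ω : Set Pt) (u v : Pt → Pt) : ℝ :=
  (∑ i, ∫ x, inner ℝ (weakGrad Ω (fun y => u y i) x) (weakGrad Ω (fun y => v y i) x)
    ∂(wMeas Ω 1)) + ∫ x, u x 0 * v x 0 ∂(wMeas Ω (-1))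

/-- `b(q, v) = (div_{(r,z)} (r v), q)_{L²}`. -/
def formB (Ω : Set Pt) (q : Pt → ℝ) (v : Pt → Pt) : ℝ :=
  ∫ x in Ω, weakDiv Ω (fun y => y 0 • v y) x * q x

/-- The energy norm `‖v‖_V = a(v, v)^{1/2}`. -/
def normV (Ω : Set Pt) (v : Pt → Pt) : ℝ := √(formA Ω v v)

/-- `(u, p)` is the weak solution of the axisymmetric Stokes problem. -/
def IsStokesSolution (Ω : Set Pt) (ν : ℝ) (f : Pt → Pt) (u : Pt → Pt) (p : Pt → ℝ) : Prop :=
  u ∈ velSpace Ω ∧ p ∈ presSpace Ω ∧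
    (∀ v ∈ velSpace Ω, ν * formA Ω u v + formB Ω p v = pairL2 Ω f fun x => x 0 • v x) ∧
    ∀ q ∈ presSpace Ω, formB Ω q u = 0

/-- `H^{1+s}_1 × H^s_1` elliptic regularity with constant `C`: every right-hand side in `L²_1(Ω)`
has a weak solution in this space, with `ν ‖u‖_{H^{1+s}_1} + ‖p‖_{H^s_1} ≤ C ‖f‖_{L²_1}`. -/
def HasEllipticRegularity (Ω : Set Pt) (s C : ℝ) : Prop :=
  ∀ (ν : ℝ) (f : Pt → Pt), 0 < ν → MemLp f 2 (wMeas Ω 1) →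
    ∃ (u : Pt → Pt) (p : Pt → ℝ), IsStokesSolution Ω ν f u p ∧
      ENNReal.ofReal ν * sobolevNormSucc Ω s u + sobolevNorm Ω s p ≤
        ENNReal.ofReal C * eLpNorm f 2 (wMeas Ω 1)

/-- `α` is the potential `α_f` of the Helmholtz decomposition of `f`, determined up to an additive
constant by `(∇α, ∇β)_{L²_1} = (f, ∇β)_{L²_1}` for all `β ∈ H¹_1(Ω)`. -/
def IsHelmholtzPotential (Ω : Set Pt) (f : Pt → Pt) (α : Pt → ℝ) : Prop :=
  MemH1 Ω α ∧ ∀ β : Pt → ℝ, MemH1 Ω β →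
    ∫ x, inner ℝ (weakGrad Ω α x) (weakGrad Ω β x) ∂(wMeas Ω 1) =
      ∫ x, inner ℝ (f x) (weakGrad Ω β x) ∂(wMeas Ω 1)

/-- The Helmholtz projection `ℙ f = f - ∇α_f`. -/
def helmholtz (Ω : Set Pt) (f : Pt → Pt) (α : Pt → ℝ) (x : Pt) : Pt := f x - weakGrad Ω α x

/-- `ℙ(Δ_axi u)` for the Stokes velocity `u` with data `f`.  The functional
`v₀ ↦ ⟨Δ_axi u, v₀⟩ = -a(u, v₀)` on the divergence-free fields is identified with its
representation `-ν⁻¹ ℙ f ∈ L²_1(Ω)`. -/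
def projLaplacian (Ω : Set Pt) (ν : ℝ) (f : Pt → Pt) (α : Pt → ℝ) (x : Pt) : Pt :=
  -(ν⁻¹ • helmholtz Ω f α x)

/-! ### The discretization -/

/-- `K` is a regular (conforming) triangulation of `Ω` into finitely many triangles; its triangles
and edges are its faces with three and two vertices. -/
structure IsTriangulation (Ω : Set Pt) (K : Geometry.SimplicialComplex ℝ Pt) : Prop where
  finite : K.faces.Finite
  pure : ∀ E ∈ K.faces, ∃ T ∈ K.faces, E ⊆ T ∧ T.card = 3
  space_eq : K.space = closure Ω

/-- The triangles of the mesh, given by their vertex sets. -/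
def triangles (K : Geometry.SimplicialComplex ℝ Pt) : Set (Finset Pt) :=
  {T ∈ K.faces | T.card = 3}

/-- The edges of the mesh, given by their vertex sets. -/
def edges (K : Geometry.SimplicialComplex ℝ Pt) : Set (Finset Pt) :=
  {E ∈ K.faces | E.card = 2}

/-- The mesh size `h`: the maximal diameter of a triangle. -/
def meshSize (K : Geometry.SimplicialComplex ℝ Pt) : ℝ :=
  sSup ((fun T : Finset Pt => Metric.diam (convexHull ℝ (T : Set Pt))) '' triangles K)

/-- The space `P₁(𝒯)² ⊕ {λ_i λ_j n_E : E = conv {N_i, N_j}}` of continuous fields on the closure of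
`Ω` (extended by `0`).  In barycentric coordinates `lam` on a triangle `T`, such a field is the
linear interpolant of its vertex values plus the edge bubbles `λ_i λ_j β_E`, where the coefficient
vector `β_E` is a multiple of the normal of `E`, the same on both sides of `E`. -/
def IsBernardiRaugel (Ω : Set Pt) (K : Geometry.SimplicialComplex ℝ Pt) (v : Pt → Pt) : Prop :=
  (∀ x ∉ closure Ω, v x = 0) ∧
  ∃ β : Finset Pt → Pt,
    (∀ E ∈ edges K, ∀ M ∈ E, ∀ N ∈ E, inner ℝ (β E) (M - N) = 0) ∧
    ∀ T ∈ triangles K, ∀ lam : Pt → ℝ, (∀ N ∈ T, 0 ≤ lam N) → ∑ N ∈ T, lam N = 1 →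
      v (∑ N ∈ T, lam N • N) =
        ∑ N ∈ T, lam N • v N + ∑ E ∈ T.powersetCard 2, (∏ N ∈ E, lam N) • β E

/-- The Bernardi--Raugel velocity space `V_h`, conforming in `V`, i.e. with the boundary conditions
`v = 0` on `Γ` and `v_r = 0` on the rotation axis. -/
def velSpaceH (Ω : Set Pt) (K : Geometry.SimplicialComplex ℝ Pt) : Set (Pt → Pt) :=
  {v ∈ velSpace Ω | IsBernardiRaugel Ω K v}

/-- The pressure space `Q_h = P₀(𝒯) ∩ Q`. -/
def presSpaceH (Ω : Set Pt) (K : Geometry.SimplicialComplex ℝ Pt) : Set (Pt → ℝ) :=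
  {q ∈ presSpace Ω | ∀ T ∈ triangles K, ∃ c : ℝ,
    ∀ x ∈ interior (convexHull ℝ (T : Set Pt)), q x = c}

/-- The discretely divergence-free functions `V_{h,0}`. -/
def velSpaceH0 (Ω : Set Pt) (K : Geometry.SimplicialComplex ℝ Pt) : Set (Pt → Pt) :=
  {v ∈ velSpaceH Ω K | ∀ q ∈ presSpaceH Ω K, formB Ω q v = 0}

/-- The reconstruction `R` (only its values on the fields `r v_h`, `v_h ∈ V_h`, matter) satisfies
`‖R (r v_h)‖_{L²_{-1}} ≤ C ‖v_h‖_V` for all `v_h ∈ V_h`. -/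
def IsContinuousReconstruction (Ω : Set Pt) (K : Geometry.SimplicialComplex ℝ Pt)
    (R : (Pt → Pt) →ₗ[ℝ] (Pt → Pt)) (C : ℝ) : Prop :=
  ∀ v ∈ velSpaceH Ω K, MemLp (R fun x => x 0 • v x) 2 (wMeas Ω (-1)) ∧
    normL2 Ω (-1) (R fun x => x 0 • v x) ≤ C * normV Ω v

/-- `(u_h, p_h)` solves the modified discrete problem with right-hand side `(f, R (r v_h))`. -/
def IsDiscreteSolution (Ω : Set Pt) (K : Geometry.SimplicialComplex ℝ Pt)
    (R : (Pt → Pt) →ₗ[ℝ] (Pt → Pt)) (ν : ℝ) (f : Pt → Pt) (uh : Pt → Pt) (ph : Pt → ℝ) : Prop :=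
  uh ∈ velSpaceH Ω K ∧ ph ∈ presSpaceH Ω K ∧
    (∀ v ∈ velSpaceH Ω K,
      ν * formA Ω uh v + formB Ω ph v = pairL2 Ω f (R fun x => x 0 • v x)) ∧
    ∀ q ∈ presSpaceH Ω K, formB Ω q uh = 0

/-- The quotients `ℓ(w_h) / ‖w_h‖_V`, `w_h ∈ V_{h,0}`, whose supremum is `‖ℓ‖_{V_{h,0}^*}`
(with `0 / 0 = 0`). -/
def dualQuotients (Ω : Set Pt) (K : Geometry.SimplicialComplex ℝ Pt) (ℓ : (Pt → Pt) → ℝ) : Set ℝ :=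
  (fun w => ℓ w / normV Ω w) '' velSpaceH0 Ω K

/-- The functional `ℙ(Δ_axi u) ∘ (I - R)`, `w_h ↦ (g, r w_h - R (r w_h))_{L²}`, `g = ℙ(Δ_axi u)`. -/
def laplacianDefect (Ω : Set Pt) (R : (Pt → Pt) →ₗ[ℝ] (Pt → Pt)) (g : Pt → Pt)
    (w : Pt → Pt) : ℝ :=
  pairL2 Ω g fun x => x 0 • w x - R (fun y => y 0 • w y) x

/-- The functional `∇α ∘ R`, `w_h ↦ (∇α, R (r w_h))_{L²}`. -/
def gradientDefect (Ω : Set Pt) (R : (Pt → Pt) →ₗ[ℝ] (Pt → Pt)) (α : Pt → ℝ)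
    (w : Pt → Pt) : ℝ :=
  pairL2 Ω (weakGrad Ω α) (R fun x => x 0 • w x)

/-- The consistency error
`‖ℙ(Δ_axi u) ∘ (I - R)‖_{V_{h,0}^*} + ν⁻¹ ‖∇α_f ∘ R‖_{V_{h,0}^*}`. -/
def consistencyError (Ω : Set Pt) (K : Geometry.SimplicialComplex ℝ Pt)
    (R : (Pt → Pt) →ₗ[ℝ] (Pt → Pt)) (ν : ℝ) (f : Pt → Pt) (α : Pt → ℝ) : ℝ :=
  sSup (dualQuotients Ω K (laplacianDefect Ω R (projLaplacian Ω ν f α))) +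
    ν⁻¹ * sSup (dualQuotients Ω K (gradientDefect Ω R α))

end AxiStokes

end

open MeasureTheory Set
open scoped ENNReal ContDiff

noncomputable section

namespace AxiStokes

/-! ### Weighted Lebesgue spaces -/

section Weighted

variable {Ω : Set Pt} {k : ℤ} {E : Type*} [NormedAddCommGroup E]

/-! Write `g` for `projLaplacian`, so that `f = ∇α - ν g`. The gradient part of the data never moves
the exact velocity: integration by parts gives `b(α, w) = -(∇α, w)` in `L²_1`, so `α` can be
absorbed into the pressure. Hence `u` is, up to a field of zero energy, also the velocity for unit
viscosity and data `-g`. Elliptic regularity applied to that problem, not to the original one,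
yields a pressure `q` with `‖q‖_{H^s_1} ≤ Creg ‖g‖` and `a(u, w) + b(q, w) = -(g, w)` on all of `V`.
This bound contains neither `ν` nor `∇α`, and that makes the estimate pressure robust
(`exists_regular_pressure`).

For `w` in `V_{h,0}` the discrete pressure drops out of the scheme. Inserting `f = ∇α - ν g`
expresses `a(u_h, w)` through `-(g, w)` and the two defects (`formA_discrete_eq`). Subtracting
leaves `a(u_h - u, w) = b(q, w) + defects`. Since `w` is discretely divergence free, `q` may be
replaced by `q - q_h`, with `q_h` the piecewise weighted mean, which gives a term of size `h^s ‖g‖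
‖w‖_V`. The choice `w = u_h - v_h` and the triangle inequality conclude as in Strang's lemma.

The analytic core is `‖q - q_h‖ ≤ 16 h^s ‖q‖_{H^s_1}` with a constant blind to the shape of the
triangles. It rests on a Poincaré inequality with weight `r` on convex sets. A double integral of
`|q(x) - q(y)|²` is bounded by integrating the gradient along the segment from `x` to `y`. As `r` is
affine and nonnegative, the weight at the nearer endpoint is at most twice the weight at the point
of the segment, and the change of variables has a bounded Jacobian (`lintegral_pair_le`).
Mollification carries this to weak gradients, and integrating the `K`-functional over `t > h`
carries it to fractional `s`.

The axis enters in the integration by parts, where nothing but `v_r ∈ L²_{-1}` is known: a cutoff in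
`r` is removed by dominated convergence. A Friedrichs inequality serves only to bound the functional
`w ↦ (g, w)`, so that the first supremum is finite. -/

theorem measurable_weight (k : ℤ) : Measurable fun x : Pt => ENNReal.ofReal (x 0 ^ k) := by
  have h : Measurable fun x : Pt => x 0 := by fun_prop
  exact (h.pow_const k).ennreal_ofReal

theorem wMeas_ac (Ω : Set Pt) (k : ℤ) : wMeas Ω k ≪ volume.restrict Ω :=
  withDensity_absolutelyContinuous _ _

theorem IsMeridianDomain.measurableSet (hΩ : IsMeridianDomain Ω) : MeasurableSet Ω :=
  hΩ.isOpen.measurableSet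

/-- The radius is positive on `Ω`, so weighted and unweighted null sets agree and measurability
passes freely between all the weights. -/
theorem IsMeridianDomain.ac_wMeas (hΩ : IsMeridianDomain Ω) (k : ℤ) :
    volume.restrict Ω ≪ wMeas Ω k := by
  refine withDensity_absolutelyContinuous' (measurable_weight k).aemeasurable ?_
  filter_upwards [ae_restrict_mem hΩ.measurableSet] with x hx
  simpa using zpow_pos (hΩ.radius_pos x hx) k

theorem lintegral_wMeas (Ω : Set Pt) (k : ℤ) (g : Pt → ℝ≥0∞) :
    ∫⁻ x, g x ∂wMeas Ω k = ∫⁻ x in Ω, ENNReal.ofReal (x 0 ^ k) * g x := by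
  rw [wMeas, lintegral_withDensity_eq_lintegral_mul_non_measurable _ (measurable_weight k)]
  · rfl
  · exact Filter.Eventually.of_forall fun x => ENNReal.ofReal_lt_top

variable [NormedSpace ℝ E]

theorem IsMeridianDomain.integral_wMeas (hΩ : IsMeridianDomain Ω) (k : ℤ) (g : Pt → E) :
    ∫ x, g x ∂wMeas Ω k = ∫ x in Ω, x 0 ^ k • g x := by
  rw [wMeas, integral_withDensity_eq_integral_toReal_smul (measurable_weight k)]
  · refine setIntegral_congr_fun hΩ.measurableSet fun x hx => ?_
    simp only
    rw [ENNReal.toReal_ofReal (zpow_pos (hΩ.radius_pos x hx) k).le]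
  · exact Filter.Eventually.of_forall fun x => ENNReal.ofReal_lt_top

theorem IsMeridianDomain.integrable_wMeas (hΩ : IsMeridianDomain Ω) (k : ℤ) {g : Pt → E} :
    Integrable g (wMeas Ω k) ↔ IntegrableOn (fun x => x 0 ^ k • g x) Ω := by
  rw [wMeas, integrable_withDensity_iff_integrable_smul' (measurable_weight k)]
  · refine integrable_congr ?_
    filter_upwards [ae_restrict_mem hΩ.measurableSet] with x hx
    rw [ENNReal.toReal_ofReal (zpow_pos (hΩ.radius_pos x hx) k).le]
  · exact Filter.Eventually.of_forall fun x => ENNReal.ofReal_lt_top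

theorem eLpNorm_two_sq {α : Type*} [MeasurableSpace α] {E : Type*} [NormedAddCommGroup E]
    (μ : Measure α) (f : α → E) :
    eLpNorm f 2 μ ^ 2 = ∫⁻ x, ‖f x‖ₑ ^ 2 ∂μ := by
  rw [eLpNorm_eq_lintegral_rpow_enorm_toReal (by norm_num) (by norm_num)]
  rw [← ENNReal.rpow_natCast, ← ENNReal.rpow_mul]
  norm_num

/-- Since `r⁻¹ · r² = r`, multiplication by `r` is an isometry from `L²_1` to `L²_{-1}`. This is why
`r v` and its reconstruction are measured in `L²_{-1}`. -/
theorem eLpNorm_radius_smul (hΩ : IsMeridianDomain Ω) (v : Pt → E) :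
    eLpNorm (fun x => x 0 • v x) 2 (wMeas Ω (-1)) = eLpNorm v 2 (wMeas Ω 1) := by
  have h : eLpNorm (fun x => x 0 • v x) 2 (wMeas Ω (-1)) ^ 2 = eLpNorm v 2 (wMeas Ω 1) ^ 2 := by
    rw [eLpNorm_two_sq, eLpNorm_two_sq, lintegral_wMeas, lintegral_wMeas]
    refine setLIntegral_congr_fun hΩ.measurableSet fun x hx => ?_
    have hr := hΩ.radius_pos x hx
    have : ENNReal.ofReal (x 0 ^ (1 : ℤ)) = ENNReal.ofReal (x 0 ^ (-1 : ℤ)) * ‖x 0‖ₑ ^ 2 := by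
      rw [Real.enorm_eq_ofReal hr.le, ← ENNReal.ofReal_pow hr.le, ← ENNReal.ofReal_mul (by positivity)]
      congr 1
      simp only [zpow_one, zpow_neg]
      field_simp
    simp only [enorm_smul, mul_pow, this]
    ring
  exact (ENNReal.pow_right_strictMono (by norm_num : (2 : ℕ) ≠ 0)).injective h

theorem memLp_radius_smul (hΩ : IsMeridianDomain Ω) {v : Pt → E} (hv : MemLp v 2 (wMeas Ω 1)) :
    MemLp (fun x => x 0 • v x) 2 (wMeas Ω (-1)) := by
  refine ⟨?_, by rw [eLpNorm_radius_smul hΩ]; exact hv.2⟩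
  have h0 : AEStronglyMeasurable v (volume.restrict Ω) := hv.1.mono_ac (hΩ.ac_wMeas 1)
  have h1 : Measurable fun x : Pt => x 0 := by fun_prop
  exact (h1.aestronglyMeasurable.smul h0).mono_ac (wMeas_ac Ω (-1))

theorem eLpNorm_radius_inv_smul (hΩ : IsMeridianDomain Ω) (v : Pt → E) :
    eLpNorm (fun x => (x 0)⁻¹ • v x) 2 (wMeas Ω 1) = eLpNorm v 2 (wMeas Ω (-1)) := by
  rw [← eLpNorm_radius_smul hΩ]
  refine eLpNorm_congr_ae (wMeas_ac Ω (-1) ?_)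
  filter_upwards [ae_restrict_mem hΩ.measurableSet] with x hx
  rw [smul_inv_smul₀ (hΩ.radius_pos x hx).ne']

theorem memLp_radius_inv_smul (hΩ : IsMeridianDomain Ω) {v : Pt → E}
    (hv : MemLp v 2 (wMeas Ω (-1))) :
    MemLp (fun x => (x 0)⁻¹ • v x) 2 (wMeas Ω 1) := by
  refine ⟨?_, by rw [eLpNorm_radius_inv_smul hΩ]; exact hv.2⟩
  have h0 : AEStronglyMeasurable v (volume.restrict Ω) := hv.1.mono_ac (hΩ.ac_wMeas _)
  have h1 : Measurable fun x : Pt => (x 0)⁻¹ := by fun_prop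
  exact (h1.aestronglyMeasurable.smul h0).mono_ac (wMeas_ac Ω 1)

end Weighted

/-! ### Pairings -/

section Pairing

variable {α : Type*} [MeasurableSpace α] {μ : Measure α}
  {E : Type*} [NormedAddCommGroup E] [InnerProductSpace ℝ E]

theorem integrable_inner_of_memLp {f g : α → E} (hf : MemLp f 2 μ) (hg : MemLp g 2 μ) :
    Integrable (fun x => inner ℝ (f x) (g x)) μ := by
  refine (hf.norm.integrable_mul hg.norm).mono (hf.1.inner hg.1) ?_
  refine Filter.Eventually.of_forall fun x => ?_
  simp only [Pi.mul_apply, norm_mul, norm_norm]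
  exact norm_inner_le_norm _ _

theorem abs_integral_inner_le {f g : α → E} (hf : MemLp f 2 μ) (hg : MemLp g 2 μ) :
    |∫ x, inner ℝ (f x) (g x) ∂μ| ≤ (eLpNorm f 2 μ).toReal * (eLpNorm g 2 μ).toReal := by
  have h := abs_real_inner_le_norm (hf.toLp f) (hg.toLp g)
  rw [Lp.norm_toLp, Lp.norm_toLp, L2.inner_def] at h
  convert h using 2
  refine integral_congr_ae ?_
  filter_upwards [hf.coeFn_toLp, hg.coeFn_toLp] with x h1 h2
  rw [h1, h2]

theorem integral_inner_self {f : α → E} (hf : MemLp f 2 μ) :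
    ∫ x, inner ℝ (f x) (f x) ∂μ = (eLpNorm f 2 μ).toReal ^ 2 := by
  have h : inner ℝ (hf.toLp f) (hf.toLp f) = ‖hf.toLp f‖ ^ 2 := real_inner_self_eq_norm_sq _
  rw [Lp.norm_toLp, L2.inner_def] at h
  rw [← h]
  refine integral_congr_ae ?_
  filter_upwards [hf.coeFn_toLp] with x h1
  rw [h1]

variable {Ω : Set Pt}

theorem inner_radius_inv_smul {f g : E} {r : ℝ} (hr : 0 < r) :
    r ^ (1 : ℤ) • inner ℝ f (r⁻¹ • g) = inner ℝ f g := by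
  rw [real_inner_smul_right, zpow_one, smul_eq_mul, mul_inv_cancel_left₀ hr.ne']

theorem integrableOn_inner_of_memLp (hΩ : IsMeridianDomain Ω) {f g : Pt → E}
    (hf : MemLp f 2 (wMeas Ω 1)) (hg : MemLp g 2 (wMeas Ω (-1))) :
    IntegrableOn (fun x => inner ℝ (f x) (g x)) Ω := by
  have h := (hΩ.integrable_wMeas 1).1 (integrable_inner_of_memLp hf (memLp_radius_inv_smul hΩ hg))
  refine (integrableOn_congr_fun (fun x hx => ?_) hΩ.measurableSet).1 h
  exact inner_radius_inv_smul (hΩ.radius_pos x hx)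

/-- The unweighted pairing is the duality between `L²_1` and `L²_{-1}`. Moving a factor `r` into the
measure reduces it to Cauchy--Schwarz in `L²_1`. -/
theorem setIntegral_inner_eq (hΩ : IsMeridianDomain Ω) (f g : Pt → E) :
    ∫ x in Ω, inner ℝ (f x) (g x) = ∫ x, inner ℝ (f x) ((x 0)⁻¹ • g x) ∂wMeas Ω 1 := by
  rw [hΩ.integral_wMeas]
  refine setIntegral_congr_fun hΩ.measurableSet fun x hx => ?_
  exact (inner_radius_inv_smul (hΩ.radius_pos x hx)).symm

theorem abs_setIntegral_inner_le (hΩ : IsMeridianDomain Ω) {f g : Pt → E}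
    (hf : MemLp f 2 (wMeas Ω 1)) (hg : MemLp g 2 (wMeas Ω (-1))) :
    |∫ x in Ω, inner ℝ (f x) (g x)| ≤ normL2 Ω 1 f * normL2 Ω (-1) g := by
  rw [setIntegral_inner_eq hΩ]
  refine (abs_integral_inner_le hf (memLp_radius_inv_smul hΩ hg)).trans_eq ?_
  rw [eLpNorm_radius_inv_smul hΩ]
  rfl

end Pairing

/-! ### Weak gradients -/

section WeakGradient

variable {Ω : Set Pt} {p q : Pt → ℝ} {g g' : Pt → Pt}

theorem integrableOn_mul_of_tsupport_subset (hp : LocallyIntegrableOn p Ω) {φ : Pt → ℝ}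
    (hφ : Continuous φ) (hc : HasCompactSupport φ) (hs : tsupport φ ⊆ Ω) :
    IntegrableOn (fun x => p x * φ x) Ω := by
  have h1 : IntegrableOn p (tsupport φ) := hp.integrableOn_compact_subset hs hc
  have h2 : IntegrableOn (fun x => p x * φ x) (tsupport φ) :=
    h1.mul_continuousOn hφ.continuousOn hc
  refine Integrable.integrableOn ((integrableOn_iff_integrable_of_support_subset ?_).1 h2)
  intro x hx
  exact subset_tsupport φ (right_ne_zero_of_mul hx)

theorem _root_.MeasureTheory.LocallyIntegrableOn.component (hg : LocallyIntegrableOn g Ω) (i : Fin 2) :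
    LocallyIntegrableOn (fun x => g x i) Ω := by
  intro x hx
  obtain ⟨t, ht, h⟩ := hg x hx
  exact ⟨t, ht, (EuclideanSpace.proj (𝕜 := ℝ) i).integrable_comp h⟩

theorem continuous_fderiv_test {φ : Pt → ℝ} (hφ : ContDiff ℝ ∞ φ) (w : Pt) :
    Continuous fun x => fderiv ℝ φ x w :=
  (hφ.continuous_fderiv (by simp)).clm_apply continuous_const

theorem tsupport_fderiv_apply_subset_self (φ : Pt → ℝ) (w : Pt) :
    tsupport (fun x => fderiv ℝ φ x w) ⊆ tsupport φ :=
  tsupport_fderiv_apply_subset ℝ w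

theorem integrableOn_mul_fderiv (hp : LocallyIntegrableOn p Ω) {φ : Pt → ℝ}
    (hφ : ContDiff ℝ ∞ φ) (hc : HasCompactSupport φ) (hs : tsupport φ ⊆ Ω) (w : Pt) :
    IntegrableOn (fun x => p x * fderiv ℝ φ x w) Ω :=
  integrableOn_mul_of_tsupport_subset hp (continuous_fderiv_test hφ w)
    (hc.fderiv_apply ℝ w) ((tsupport_fderiv_apply_subset_self φ w).trans hs)

/-- `weakGrad` is picked by choice, so each of its calculus rules holds only almost everywhere and
goes through this uniqueness. It is the fundamental lemma of the calculus of variations in each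
component. -/
theorem IsWeakGrad.ae_eq (hΩ : IsOpen Ω) (h : IsWeakGrad Ω p g) (h' : IsWeakGrad Ω p g') :
    g =ᵐ[volume.restrict Ω] g' := by
  have key : ∀ i : Fin 2, ∀ᵐ x, x ∈ Ω → g x i - g' x i = 0 := by
    intro i
    refine hΩ.ae_eq_zero_of_integral_contDiff_smul_eq_zero
      ((h.2.1.component i).sub (h'.2.1.component i)) fun φ hφ hc hs => ?_
    have e1 := h.2.2 φ hφ hc hs i
    have e2 := h'.2.2 φ hφ hc hs i
    have e3 : ∫ x in Ω, (g x i * φ x - g' x i * φ x) = 0 := by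
      rw [integral_sub
        (integrableOn_mul_of_tsupport_subset (h.2.1.component i) hφ.continuous hc hs)
        (integrableOn_mul_of_tsupport_subset (h'.2.1.component i) hφ.continuous hc hs)]
      linarith
    rw [← e3, ← setIntegral_eq_integral_of_forall_compl_eq_zero (s := Ω)]
    · refine integral_congr_ae (Filter.Eventually.of_forall fun x => ?_)
      simp only [smul_eq_mul]
      ring
    · intro x hx
      have : φ x = 0 := image_eq_zero_of_notMem_tsupport fun h => hx (hs h)
      simp [this]
  rw [Filter.EventuallyEq, ae_restrict_iff' hΩ.measurableSet]
  filter_upwards [key 0, key 1] with x h0 h1 hx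
  ext i
  fin_cases i
  · exact sub_eq_zero.1 (h0 hx)
  · exact sub_eq_zero.1 (h1 hx)

theorem isWeakGrad_weakGrad (h : ∃ g, IsWeakGrad Ω p g) : IsWeakGrad Ω p (weakGrad Ω p) := by
  rw [weakGrad, dif_pos h]
  exact h.choose_spec

theorem IsWeakGrad.weakGrad_ae (hΩ : IsOpen Ω) (h : IsWeakGrad Ω p g) :
    weakGrad Ω p =ᵐ[volume.restrict Ω] g :=
  (isWeakGrad_weakGrad ⟨g, h⟩).ae_eq hΩ h

theorem IsWeakGrad.add (h : IsWeakGrad Ω p g) (h' : IsWeakGrad Ω q g') :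
    IsWeakGrad Ω (p + q) (g + g') := by
  refine ⟨h.1.add h'.1, h.2.1.add h'.2.1, fun φ hφ hc hs i => ?_⟩
  simp only [Pi.add_apply, PiLp.add_apply, add_mul]
  rw [integral_add (integrableOn_mul_fderiv h.1 hφ hc hs _)
      (integrableOn_mul_fderiv h'.1 hφ hc hs _),
    integral_add (integrableOn_mul_of_tsupport_subset (h.2.1.component i) hφ.continuous hc hs)
      (integrableOn_mul_of_tsupport_subset (h'.2.1.component i) hφ.continuous hc hs),
    h.2.2 φ hφ hc hs i, h'.2.2 φ hφ hc hs i]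
  ring

theorem IsWeakGrad.const_smul (h : IsWeakGrad Ω p g) (c : ℝ) :
    IsWeakGrad Ω (c • p) (c • g) := by
  refine ⟨h.1.smul c, h.2.1.smul c, fun φ hφ hc hs i => ?_⟩
  simp only [Pi.smul_apply, PiLp.smul_apply, smul_eq_mul, mul_assoc]
  rw [integral_const_mul, integral_const_mul, h.2.2 φ hφ hc hs i]
  ring

theorem IsWeakGrad.sub (h : IsWeakGrad Ω p g) (h' : IsWeakGrad Ω q g') :
    IsWeakGrad Ω (p - q) (g - g') := by
  have := h.add (h'.const_smul (-1))
  simpa [sub_eq_add_neg] using this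

/-- The classical gradient. -/
def grad (ψ : Pt → ℝ) (x : Pt) : Pt :=
  WithLp.toLp 2 fun i => fderiv ℝ ψ x (EuclideanSpace.single i 1)

@[simp] theorem grad_apply (ψ : Pt → ℝ) (x : Pt) (i : Fin 2) :
    grad ψ x i = fderiv ℝ ψ x (EuclideanSpace.single i 1) := rfl

theorem continuous_grad {ψ : Pt → ℝ} (hψ : ContDiff ℝ ∞ ψ) : Continuous (grad ψ) := by
  refine (PiLp.continuous_toLp 2 _).comp (continuous_pi fun i => ?_)
  exact continuous_fderiv_test hψ _

theorem IsWeakGrad.mul_smooth (hΩ : IsOpen Ω) (h : IsWeakGrad Ω p g) {ψ : Pt → ℝ}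
    (hψ : ContDiff ℝ ∞ ψ) :
    IsWeakGrad Ω (fun x => ψ x * p x) (fun x => p x • grad ψ x + ψ x • g x) := by
  have hl : IsLocallyClosed Ω := hΩ.isLocallyClosed
  refine ⟨h.1.continuousOn_mul hψ.continuous.continuousOn hl,
    (h.1.smul_continuousOn hl (continuous_grad hψ).continuousOn).add
      (h.2.1.continuousOn_smul hl hψ.continuous.continuousOn), fun φ hφ hc hs i => ?_⟩
  -- The product rule comes from testing the gradient of `p` with `ψ φ` and expanding its
  -- derivative.
  have e := h.2.2 (fun x => ψ x * φ x) (hψ.mul hφ) hc.mul_left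
    ((tsupport_mul_subset_right).trans hs) i
  have hd : ∀ x, fderiv ℝ (fun x => ψ x * φ x) x (EuclideanSpace.single i 1) =
      ψ x * fderiv ℝ φ x (EuclideanSpace.single i 1) + grad ψ x i * φ x := by
    intro x
    rw [fderiv_fun_mul (hψ.differentiable (by simp) x) (hφ.differentiable (by simp) x)]
    simp [mul_comm]
  simp only [hd, mul_add] at e
  have i1 : IntegrableOn (fun x => p x * (ψ x * fderiv ℝ φ x (EuclideanSpace.single i 1))) Ω := by
    have := integrableOn_mul_fderiv (h.1.continuousOn_mul hψ.continuous.continuousOn hl)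
      hφ hc hs (EuclideanSpace.single i 1)
    refine this.congr (Filter.Eventually.of_forall fun x => ?_)
    simp only
    ring
  have i2 : IntegrableOn (fun x => p x * (grad ψ x i * φ x)) Ω := by
    refine integrableOn_mul_of_tsupport_subset h.1
      ((continuous_fderiv_test hψ _).mul hφ.continuous) hc.mul_left
      ((tsupport_mul_subset_right).trans hs)
  have i3 : IntegrableOn (fun x => g x i * (ψ x * φ x)) Ω :=
    integrableOn_mul_of_tsupport_subset (h.2.1.component i)
      (hψ.continuous.mul hφ.continuous) hc.mul_left ((tsupport_mul_subset_right).trans hs)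
  rw [integral_add i1 i2] at e
  have e2 : ∫ x in Ω, (p x • grad ψ x + ψ x • g x) i * φ x =
      ∫ x in Ω, (p x * (grad ψ x i * φ x) + g x i * (ψ x * φ x)) := by
    refine integral_congr_ae (Filter.Eventually.of_forall fun x => ?_)
    simp only [PiLp.add_apply, PiLp.smul_apply, smul_eq_mul]
    ring
  rw [e2, integral_add i2 i3]
  have e3 : ∫ x in Ω, ψ x * p x * fderiv ℝ φ x (EuclideanSpace.single i 1) =
      ∫ x in Ω, p x * (ψ x * fderiv ℝ φ x (EuclideanSpace.single i 1)) := by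
    refine integral_congr_ae (Filter.Eventually.of_forall fun x => ?_)
    simp only
    ring
  rw [e3]
  linarith

/-- The test function vanishes off `Ω`, so both integrals extend to the whole plane and the boundary
of `Ω` plays no role. -/
theorem isWeakGrad_of_contDiff {ψ : Pt → ℝ} (hψ : ContDiff ℝ ∞ ψ) :
    IsWeakGrad Ω ψ (grad ψ) := by
  refine ⟨hψ.continuous.locallyIntegrable.locallyIntegrableOn _,
    (continuous_grad hψ).locallyIntegrable.locallyIntegrableOn _, fun φ hφ hc hs i => ?_⟩
  have z : ∀ x ∉ Ω, φ x = 0 := fun x hx => image_eq_zero_of_notMem_tsupport fun h => hx (hs h)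
  have z' : ∀ x ∉ Ω, fderiv ℝ φ x (EuclideanSpace.single i 1) = 0 := fun x hx =>
    image_eq_zero_of_notMem_tsupport (f := fun x => fderiv ℝ φ x (EuclideanSpace.single i 1))
      fun h => hx (hs (tsupport_fderiv_apply_subset_self φ _ h))
  rw [setIntegral_eq_integral_of_forall_compl_eq_zero (fun x hx => by simp [z' x hx]),
    setIntegral_eq_integral_of_forall_compl_eq_zero (fun x hx => by simp [z x hx])]
  simp only [grad_apply]
  have hcd := hc.fderiv_apply ℝ (EuclideanSpace.single i 1)
  refine integral_mul_fderiv_eq_neg_fderiv_mul_of_integrable ?_ ?_ ?_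
    (fun x _ => hψ.differentiable (by simp) x) (fun x _ => hφ.differentiable (by simp) x)
  · exact ((continuous_fderiv_test hψ _).mul hφ.continuous).integrable_of_hasCompactSupport
      hc.mul_left
  · exact (hψ.continuous.mul (continuous_fderiv_test hφ _)).integrable_of_hasCompactSupport
      hcd.mul_left
  · exact (hψ.continuous.mul hφ.continuous).integrable_of_hasCompactSupport hc.mul_left

theorem contDiff_radius : ContDiff ℝ ∞ fun x : Pt => x 0 :=
  (EuclideanSpace.proj (𝕜 := ℝ) (0 : Fin 2)).contDiff

theorem grad_radius (x : Pt) : grad (fun x : Pt => x 0) x = EuclideanSpace.single 0 1 := by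
  ext i
  have h : HasFDerivAt (fun x : Pt => x 0) (EuclideanSpace.proj (𝕜 := ℝ) (0 : Fin 2)) x :=
    (EuclideanSpace.proj (𝕜 := ℝ) (0 : Fin 2)).hasFDerivAt
  rw [grad_apply, h.fderiv]
  fin_cases i <;> simp

/-- The product rule for the weak gradient of `r p`. -/
theorem weakGrad_radius_mul (hΩ : IsOpen Ω) (h : ∃ g, IsWeakGrad Ω p g) :
    weakGrad Ω (fun x => x 0 * p x) =ᵐ[volume.restrict Ω]
      fun x => p x • EuclideanSpace.single 0 1 + x 0 • weakGrad Ω p x := by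
  have := ((isWeakGrad_weakGrad h).mul_smooth hΩ contDiff_radius).weakGrad_ae hΩ
  simpa only [grad_radius] using this

theorem weakGrad_sub (hΩ : IsOpen Ω) (h : ∃ g, IsWeakGrad Ω p g) (h' : ∃ g, IsWeakGrad Ω q g) :
    weakGrad Ω (p - q) =ᵐ[volume.restrict Ω] weakGrad Ω p - weakGrad Ω q :=
  ((isWeakGrad_weakGrad h).sub (isWeakGrad_weakGrad h')).weakGrad_ae hΩ

theorem weakGrad_smooth (hΩ : IsOpen Ω) {ψ : Pt → ℝ} (hψ : ContDiff ℝ ∞ ψ) :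
    weakGrad Ω ψ =ᵐ[volume.restrict Ω] grad ψ :=
  (isWeakGrad_of_contDiff hψ).weakGrad_ae hΩ

theorem aestronglyMeasurable_weakGrad (h : ∃ g, IsWeakGrad Ω p g) :
    AEStronglyMeasurable (weakGrad Ω p) (volume.restrict Ω) :=
  (isWeakGrad_weakGrad h).2.1.aestronglyMeasurable

theorem weakGrad_sub_wMeas (k : ℤ) (hΩ : IsOpen Ω) (h : ∃ g, IsWeakGrad Ω p g)
    (h' : ∃ g, IsWeakGrad Ω q g) :
    weakGrad Ω (p - q) =ᵐ[wMeas Ω k] weakGrad Ω p - weakGrad Ω q :=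
  wMeas_ac Ω k (weakGrad_sub hΩ h h')

theorem MemH1.sub (hΩ : IsOpen Ω) (hp : MemH1 Ω p) (hq : MemH1 Ω q) : MemH1 Ω (p - q) := by
  refine ⟨hp.1.sub hq.1, ?_, ?_⟩
  · exact ⟨_, (isWeakGrad_weakGrad hp.2.1).sub (isWeakGrad_weakGrad hq.2.1)⟩
  · exact (hp.2.2.sub hq.2.2).ae_eq (weakGrad_sub_wMeas 1 hΩ hp.2.1 hq.2.1).symm

end WeakGradient

/-! ### The energy space and its forms -/

section Energy

variable {Ω : Set Pt} {u v w : Pt → Pt} {q : Pt → ℝ}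

/-- Fields in `H¹_1(Ω)²` with radial component in `L²_{-1}(Ω)`. -/
structure EnergyField (Ω : Set Pt) (v : Pt → Pt) : Prop where
  memH1 : ∀ i, MemH1 Ω fun x => v x i
  radial : MemLp (fun x => v x 0) 2 (wMeas Ω (-1))

theorem energyField_of_mem (hv : v ∈ velSpace Ω) : EnergyField Ω v := ⟨hv.1, hv.2.1⟩

theorem EnergyField.sub (hΩ : IsMeridianDomain Ω) (hu : EnergyField Ω u) (hv : EnergyField Ω v) :
    EnergyField Ω (u - v) :=
  ⟨fun i => (hu.memH1 i).sub hΩ.isOpen (hv.memH1 i), hu.radial.sub hv.radial⟩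

theorem formA_comm (u v : Pt → Pt) : formA Ω u v = formA Ω v u := by
  simp only [formA, real_inner_comm, mul_comm]

theorem formA_sub_left (hΩ : IsMeridianDomain Ω) (hu : EnergyField Ω u) (hv : EnergyField Ω v)
    (hw : EnergyField Ω w) : formA Ω (u - v) w = formA Ω u w - formA Ω v w := by
  have h1 : ∀ i, ∫ x, inner ℝ (weakGrad Ω (fun y => (u - v) y i) x)
        (weakGrad Ω (fun y => w y i) x) ∂(wMeas Ω 1) =
      ∫ x, inner ℝ (weakGrad Ω (fun y => u y i) x) (weakGrad Ω (fun y => w y i) x) ∂(wMeas Ω 1) -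
      ∫ x, inner ℝ (weakGrad Ω (fun y => v y i) x)
        (weakGrad Ω (fun y => w y i) x) ∂(wMeas Ω 1) := by
    intro i
    rw [← integral_sub (integrable_inner_of_memLp (hu.memH1 i).2.2 (hw.memH1 i).2.2)
      (integrable_inner_of_memLp (hv.memH1 i).2.2 (hw.memH1 i).2.2)]
    refine integral_congr_ae ?_
    have := weakGrad_sub_wMeas 1 hΩ.isOpen (hu.memH1 i).2.1 (hv.memH1 i).2.1
    filter_upwards [this] with x hx
    rw [← inner_sub_left]
    exact congrArg (fun z => inner ℝ z _) hx
  have h2 : ∫ x, (u - v) x 0 * w x 0 ∂(wMeas Ω (-1)) =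
      ∫ x, u x 0 * w x 0 ∂(wMeas Ω (-1)) - ∫ x, v x 0 * w x 0 ∂(wMeas Ω (-1)) := by
    rw [← integral_sub (f := fun x => u x 0 * w x 0) (g := fun x => v x 0 * w x 0)
      (hu.radial.integrable_mul hw.radial) (hv.radial.integrable_mul hw.radial)]
    simp only [Pi.sub_apply, PiLp.sub_apply, sub_mul]
  simp only [formA, h1, h2, Finset.sum_sub_distrib]
  ring

theorem formA_sub_right (hΩ : IsMeridianDomain Ω) (hu : EnergyField Ω u) (hv : EnergyField Ω v)
    (hw : EnergyField Ω w) : formA Ω u (v - w) = formA Ω u v - formA Ω u w := by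
  rw [formA_comm, formA_sub_left hΩ hv hw hu, formA_comm v, formA_comm w]

theorem formA_self (hv : EnergyField Ω v) :
    formA Ω v v = normL2 Ω 1 (weakGrad Ω fun y => v y 0) ^ 2 +
      normL2 Ω 1 (weakGrad Ω fun y => v y 1) ^ 2 + normL2 Ω (-1) (fun x => v x 0) ^ 2 := by
  simp only [formA, Fin.sum_univ_two]
  rw [integral_inner_self (hv.memH1 0).2.2, integral_inner_self (hv.memH1 1).2.2]
  have := integral_inner_self hv.radial
  simp only [RCLike.inner_apply, conj_trivial] at this
  rw [this]
  rfl

theorem normV_nonneg (v : Pt → Pt) : 0 ≤ normV Ω v := Real.sqrt_nonneg _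

theorem normV_sq (hv : EnergyField Ω v) : normV Ω v ^ 2 = formA Ω v v := by
  rw [normV, Real.sq_sqrt]
  rw [formA_self hv]
  positivity

theorem normL2_nonneg {E : Type*} [NormedAddCommGroup E] (k : ℤ) (q : Pt → E) :
    0 ≤ normL2 Ω k q := ENNReal.toReal_nonneg

theorem normL2_grad_le_normV (hv : EnergyField Ω v) (i : Fin 2) :
    normL2 Ω 1 (weakGrad Ω fun y => v y i) ≤ normV Ω v := by
  refine abs_le_of_sq_le_sq' ?_ (normV_nonneg v) |>.2
  rw [normV_sq hv, formA_self hv]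
  fin_cases i
  · simp only [Fin.zero_eta]
    nlinarith [sq_nonneg (normL2 Ω 1 (weakGrad Ω fun y => v y 1)),
      sq_nonneg (normL2 Ω (-1) (fun x => v x 0))]
  · simp only [Fin.mk_one]
    nlinarith [sq_nonneg (normL2 Ω 1 (weakGrad Ω fun y => v y 0)),
      sq_nonneg (normL2 Ω (-1) (fun x => v x 0))]

theorem normL2_radial_le_normV (hv : EnergyField Ω v) :
    normL2 Ω (-1) (fun x => v x 0) ≤ normV Ω v := by
  refine abs_le_of_sq_le_sq' ?_ (normV_nonneg v) |>.2
  rw [normV_sq hv, formA_self hv]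
  nlinarith [sq_nonneg (normL2 Ω 1 (weakGrad Ω fun y => v y 1)),
    sq_nonneg (normL2 Ω 1 (weakGrad Ω fun y => v y 0))]

/-- The Cauchy--Schwarz inequality for `a`. -/
theorem abs_formA_le (hu : EnergyField Ω u) (hv : EnergyField Ω v) :
    |formA Ω u v| ≤ normV Ω u * normV Ω v := by
  have h0 := abs_integral_inner_le (hu.memH1 0).2.2 (hv.memH1 0).2.2
  have h1 := abs_integral_inner_le (hu.memH1 1).2.2 (hv.memH1 1).2.2
  have h2 := abs_integral_inner_le hu.radial hv.radial
  have e : ∫ x, inner ℝ (u x 0) (v x 0) ∂(wMeas Ω (-1)) =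
      ∫ x, u x 0 * v x 0 ∂(wMeas Ω (-1)) := by
    simp only [RCLike.inner_apply, conj_trivial, mul_comm]
  rw [e] at h2
  have su := (normV_sq hu).trans (formA_self hu)
  have sv := (normV_sq hv).trans (formA_self hv)
  have h3 : |formA Ω u v| ≤
      normL2 Ω 1 (weakGrad Ω fun y => u y 0) * normL2 Ω 1 (weakGrad Ω fun y => v y 0) +
      normL2 Ω 1 (weakGrad Ω fun y => u y 1) * normL2 Ω 1 (weakGrad Ω fun y => v y 1) +
      normL2 Ω (-1) (fun x => u x 0) * normL2 Ω (-1) (fun x => v x 0) := by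
    simp only [formA, Fin.sum_univ_two]
    exact (abs_add_three _ _ _).trans (add_le_add_three h0 h1 h2)
  refine h3.trans (abs_le_of_sq_le_sq' ?_ (mul_nonneg (normV_nonneg u) (normV_nonneg v))).2
  rw [mul_pow, su, sv]
  generalize normL2 Ω 1 (weakGrad Ω fun y => u y 0) = a
  generalize normL2 Ω 1 (weakGrad Ω fun y => u y 1) = b
  generalize normL2 Ω (-1) (fun x => u x 0) = c
  generalize normL2 Ω 1 (weakGrad Ω fun y => v y 0) = a'
  generalize normL2 Ω 1 (weakGrad Ω fun y => v y 1) = b'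
  generalize normL2 Ω (-1) (fun x => v x 0) = c'
  -- Cauchy--Schwarz in `ℝ³` by Lagrange's identity.
  nlinarith [sq_nonneg (a * b' - b * a'), sq_nonneg (a * c' - c * a'), sq_nonneg (b * c' - c * b')]

/-- The triangle inequality for the energy norm. -/
theorem normV_sub_le (hΩ : IsMeridianDomain Ω) (hu : EnergyField Ω u) (hv : EnergyField Ω v) :
    normV Ω (u - v) ≤ normV Ω u + normV Ω v := by
  refine (abs_le_of_sq_le_sq' ?_ (add_nonneg (normV_nonneg u) (normV_nonneg v))).2
  rw [normV_sq (hu.sub hΩ hv), formA_sub_left hΩ hu hv (hu.sub hΩ hv), formA_sub_right hΩ hu hu hv,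
    formA_sub_right hΩ hv hu hv, formA_comm v u, ← normV_sq hu, ← normV_sq hv]
  have := (abs_le.1 (abs_formA_le hu hv)).1
  nlinarith

/-! ### The divergence form -/

/-- The cylindrical divergence `∂_r v_r + ∂_z v_z + v_r / r`. -/
def cylDiv (Ω : Set Pt) (v : Pt → Pt) (x : Pt) : ℝ :=
  weakGrad Ω (fun y => v y 0) x 0 + weakGrad Ω (fun y => v y 1) x 1 + (x 0)⁻¹ * v x 0

theorem memLp_component {μ : Measure Pt} {g : Pt → Pt} (hg : MemLp g 2 μ) (i : Fin 2) :
    MemLp (fun x => g x i) 2 μ :=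
  (EuclideanSpace.proj (𝕜 := ℝ) i).comp_memLp' hg

theorem eLpNorm_component_le (μ : Measure Pt) (g : Pt → Pt) (i : Fin 2) :
    eLpNorm (fun x => g x i) 2 μ ≤ eLpNorm g 2 μ :=
  eLpNorm_mono fun x => PiLp.norm_apply_le (g x) i

theorem memLp_cylDiv (hΩ : IsMeridianDomain Ω) (hv : EnergyField Ω v) :
    MemLp (cylDiv Ω v) 2 (wMeas Ω 1) :=
  ((memLp_component (hv.memH1 0).2.2 0).add (memLp_component (hv.memH1 1).2.2 1)).add
    (memLp_radius_inv_smul hΩ hv.radial)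

theorem eLpNorm_cylDiv_le (hΩ : IsMeridianDomain Ω) (hv : EnergyField Ω v) :
    eLpNorm (cylDiv Ω v) 2 (wMeas Ω 1) ≤
      eLpNorm (weakGrad Ω fun y => v y 0) 2 (wMeas Ω 1) +
      eLpNorm (weakGrad Ω fun y => v y 1) 2 (wMeas Ω 1) +
      eLpNorm (fun x => v x 0) 2 (wMeas Ω (-1)) := by
  have m0 := memLp_component (hv.memH1 0).2.2 0
  have m1 := memLp_component (hv.memH1 1).2.2 1
  have m2 := memLp_radius_inv_smul hΩ hv.radial
  refine (eLpNorm_add_le (m0.add m1).1 m2.1 (by norm_num)).trans ?_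
  refine add_le_add ((eLpNorm_add_le m0.1 m1.1 (by norm_num)).trans
    (add_le_add (eLpNorm_component_le _ _ 0) (eLpNorm_component_le _ _ 1))) ?_
  exact (eLpNorm_radius_inv_smul hΩ _).le

/-- The three summands of the divergence are each controlled by one part of the energy, hence the
factor 3. -/
theorem normL2_cylDiv_le (hΩ : IsMeridianDomain Ω) (hv : EnergyField Ω v) :
    normL2 Ω 1 (cylDiv Ω v) ≤ 3 * normV Ω v := by
  have h := ENNReal.toReal_mono (by
    simpa only [ne_eq, ENNReal.add_eq_top, not_or] using
      ⟨⟨(hv.memH1 0).2.2.2.ne, (hv.memH1 1).2.2.2.ne⟩, hv.radial.2.ne⟩) (eLpNorm_cylDiv_le hΩ hv)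
  rw [ENNReal.toReal_add (ENNReal.add_ne_top.2 ⟨(hv.memH1 0).2.2.2.ne, (hv.memH1 1).2.2.2.ne⟩)
    hv.radial.2.ne, ENNReal.toReal_add (hv.memH1 0).2.2.2.ne (hv.memH1 1).2.2.2.ne] at h
  have h0 := normL2_grad_le_normV hv 0
  have h1 := normL2_grad_le_normV hv 1
  have h2 := normL2_radial_le_normV hv
  simp only [normL2] at *
  linarith

theorem weakDiv_radius_smul (hΩ : IsMeridianDomain Ω) (hv : EnergyField Ω v) :
    weakDiv Ω (fun y => y 0 • v y) =ᵐ[volume.restrict Ω] fun x => x 0 * cylDiv Ω v x := by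
  filter_upwards [weakGrad_radius_mul hΩ.isOpen (hv.memH1 0).2.1,
    weakGrad_radius_mul hΩ.isOpen (hv.memH1 1).2.1, ae_restrict_mem hΩ.measurableSet] with x h0 h1 hx
  have hr := (hΩ.radius_pos x hx).ne'
  simp only [weakDiv, Fin.sum_univ_two, PiLp.smul_apply, smul_eq_mul, h0, h1, PiLp.add_apply,
    cylDiv]
  simp
  field_simp
  ring

theorem formB_eq (hΩ : IsMeridianDomain Ω) (hv : EnergyField Ω v) (q : Pt → ℝ) :
    formB Ω q v = ∫ x, inner ℝ (q x) (cylDiv Ω v x) ∂wMeas Ω 1 := by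
  rw [hΩ.integral_wMeas, formB]
  refine integral_congr_ae ?_
  filter_upwards [weakDiv_radius_smul hΩ hv] with x hx
  rw [hx]
  simp
  ring

theorem formB_sub_left (hΩ : IsMeridianDomain Ω) (hv : EnergyField Ω v) {q q' : Pt → ℝ}
    (hq : MemLp q 2 (wMeas Ω 1)) (hq' : MemLp q' 2 (wMeas Ω 1)) :
    formB Ω (q - q') v = formB Ω q v - formB Ω q' v := by
  simp only [formB_eq hΩ hv]
  rw [← integral_sub (integrable_inner_of_memLp hq (memLp_cylDiv hΩ hv))
    (integrable_inner_of_memLp hq' (memLp_cylDiv hΩ hv))]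
  simp only [Pi.sub_apply, inner_sub_left]

theorem cylDiv_sub (hΩ : IsMeridianDomain Ω) (hu : EnergyField Ω u) (hv : EnergyField Ω v) :
    cylDiv Ω (u - v) =ᵐ[wMeas Ω 1] cylDiv Ω u - cylDiv Ω v := by
  have h0 := weakGrad_sub_wMeas 1 hΩ.isOpen (hu.memH1 0).2.1 (hv.memH1 0).2.1
  have h1 := weakGrad_sub_wMeas 1 hΩ.isOpen (hu.memH1 1).2.1 (hv.memH1 1).2.1
  filter_upwards [h0, h1] with x h0 h1
  have h0' : weakGrad Ω (fun y => (u - v) y 0) x = _ := h0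
  have h1' : weakGrad Ω (fun y => (u - v) y 1) x = _ := h1
  simp only [cylDiv]
  rw [h0', h1']
  simp only [Pi.sub_apply, PiLp.sub_apply]
  simp only [cylDiv]
  ring

theorem formB_sub_right (hΩ : IsMeridianDomain Ω) (hu : EnergyField Ω u) (hv : EnergyField Ω v)
    (hq : MemLp q 2 (wMeas Ω 1)) : formB Ω q (u - v) = formB Ω q u - formB Ω q v := by
  rw [formB_eq hΩ hu, formB_eq hΩ hv, formB_eq hΩ (hu.sub hΩ hv)]
  rw [← integral_sub (integrable_inner_of_memLp hq (memLp_cylDiv hΩ hu))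
    (integrable_inner_of_memLp hq (memLp_cylDiv hΩ hv))]
  refine integral_congr_ae ?_
  filter_upwards [cylDiv_sub hΩ hu hv] with x hx
  rw [hx, Pi.sub_apply, inner_sub_right]

theorem abs_formB_le (hΩ : IsMeridianDomain Ω) (hv : EnergyField Ω v)
    (hq : MemLp q 2 (wMeas Ω 1)) : |formB Ω q v| ≤ 3 * normL2 Ω 1 q * normV Ω v := by
  rw [formB_eq hΩ hv]
  refine (abs_integral_inner_le hq (memLp_cylDiv hΩ hv)).trans ?_
  have := mul_le_mul_of_nonneg_left (normL2_cylDiv_le hΩ hv) (normL2_nonneg (Ω := Ω) 1 q)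
  simp only [normL2] at *
  linarith

/-! ### The velocity space is a vector space -/

theorem graphNorm_sub_le (hΩ : IsMeridianDomain Ω)
    (hu : ∀ i, ∃ g, IsWeakGrad Ω (fun x => u x i) g)
    (hv : ∀ i, ∃ g, IsWeakGrad Ω (fun x => v x i) g) :
    graphNorm Ω (u - v) ≤ graphNorm Ω u + graphNorm Ω v := by
  have mu : ∀ i k, AEStronglyMeasurable (fun x => u x i) (wMeas Ω k) := fun i k => by
    obtain ⟨g, hg⟩ := hu i
    exact hg.1.aestronglyMeasurable.mono_ac (wMeas_ac Ω k)
  have mv : ∀ i k, AEStronglyMeasurable (fun x => v x i) (wMeas Ω k) := fun i k => by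
    obtain ⟨g, hg⟩ := hv i
    exact hg.1.aestronglyMeasurable.mono_ac (wMeas_ac Ω k)
  have h1 : ∀ i k, eLpNorm (fun x => (u - v) x i) 2 (wMeas Ω k) ≤
      eLpNorm (fun x => u x i) 2 (wMeas Ω k) + eLpNorm (fun x => v x i) 2 (wMeas Ω k) :=
    fun i k => eLpNorm_sub_le (mu i k) (mv i k) (by norm_num)
  have h2 : ∀ i, eLpNorm (weakGrad Ω fun x => (u - v) x i) 2 (wMeas Ω 1) ≤
      eLpNorm (weakGrad Ω fun x => u x i) 2 (wMeas Ω 1) +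
      eLpNorm (weakGrad Ω fun x => v x i) 2 (wMeas Ω 1) := fun i => by
    refine (eLpNorm_congr_ae (weakGrad_sub_wMeas 1 hΩ.isOpen (hu i) (hv i))).trans_le ?_
    exact eLpNorm_sub_le ((aestronglyMeasurable_weakGrad (hu i)).mono_ac (wMeas_ac Ω 1))
      ((aestronglyMeasurable_weakGrad (hv i)).mono_ac (wMeas_ac Ω 1)) (by norm_num)
  simp only [graphNorm, Fin.sum_univ_two]
  refine (add_le_add (add_le_add (add_le_add (h1 0 1) (h2 0)) (add_le_add (h1 1 1) (h2 1)))
    (h1 0 (-1))).trans_eq ?_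
  ring

theorem contDiff_component {φ : Pt → Pt} (hφ : ContDiff ℝ ∞ φ) (i : Fin 2) :
    ContDiff ℝ ∞ fun x => φ x i :=
  (EuclideanSpace.proj (𝕜 := ℝ) i).contDiff.comp hφ

theorem exists_isWeakGrad_sub_smooth (hv : EnergyField Ω v) {φ : Pt → Pt} (hφ : ContDiff ℝ ∞ φ)
    (i : Fin 2) : ∃ g, IsWeakGrad Ω (fun x => (v - φ) x i) g :=
  ⟨_, (isWeakGrad_weakGrad (hv.memH1 i).2.1).sub (isWeakGrad_of_contDiff (contDiff_component hφ i))⟩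

theorem velSpace_sub (hΩ : IsMeridianDomain Ω) (hu : u ∈ velSpace Ω) (hv : v ∈ velSpace Ω) :
    u - v ∈ velSpace Ω := by
  have hu' := energyField_of_mem hu
  have hv' := energyField_of_mem hv
  refine ⟨(hu'.sub hΩ hv').memH1, (hu'.sub hΩ hv').radial, fun ε hε => ?_⟩
  have hε2 : 0 < ε / 2 := ENNReal.half_pos hε.ne'
  obtain ⟨φ, hφ, hφs, hφn⟩ := hu.2.2 (ε / 2) hε2
  obtain ⟨ψ, hψ, hψs, hψn⟩ := hv.2.2 (ε / 2) hε2
  refine ⟨φ - ψ, hφ.sub hψ, ?_, ?_⟩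
  · refine (hφs.union_left hψs).mono_left ?_
    exact tsupport_sub φ ψ
  · have e : u - v - (φ - ψ) = (u - φ) - (v - ψ) := by abel
    rw [e]
    refine (graphNorm_sub_le hΩ (exists_isWeakGrad_sub_smooth hu' hφ)
      (exists_isWeakGrad_sub_smooth hv' hψ)).trans_lt ?_
    calc _ < ε / 2 + ε / 2 := ENNReal.add_lt_add hφn hψn
      _ = ε := ENNReal.add_halves ε

end Energy

/-! ### Integration by parts and the Friedrichs inequality in the velocity space -/

/-- Cauchy--Schwarz against the constant 1. It recurs below as Jensen's inequality for averages. -/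
theorem sq_lintegral_le {α : Type*} [MeasurableSpace α] {μ : Measure α} {f : α → ℝ≥0∞}
    (hf : AEMeasurable f μ) : (∫⁻ x, f x ∂μ) ^ 2 ≤ μ univ * ∫⁻ x, f x ^ 2 ∂μ := by
  have h := ENNReal.lintegral_mul_le_Lp_mul_Lq μ (Real.HolderConjugate.two_two) hf
    (aemeasurable_const (b := (1 : ℝ≥0∞)))
  simp only [Pi.mul_apply, mul_one, ENNReal.one_rpow, lintegral_const, one_mul] at h
  calc (∫⁻ x, f x ∂μ) ^ 2 ≤ _ := pow_le_pow_left' h 2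
    _ = μ univ * ∫⁻ x, f x ^ 2 ∂μ := by
      rw [mul_pow, ← ENNReal.rpow_natCast, ← ENNReal.rpow_natCast, ← ENNReal.rpow_mul,
        ← ENNReal.rpow_mul]
      norm_num
      ring

section Trace

variable {Ω : Set Pt} {v : Pt → Pt} {α : Pt → ℝ}

/-- A boundary point of `Ω` with `r > 0` belongs to `Γ`, near which `φ` vanishes. So the extension
by zero has no jump in the open half plane, and only the axis remains singular. -/
theorem hasFDerivAt_indicator (hΩ : IsMeridianDomain Ω) {φ : Pt → ℝ} (hφ : ContDiff ℝ ∞ φ)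
    (hd : Disjoint (tsupport φ) (closure (outerBoundary Ω))) {y : Pt} (hy : 0 < y 0) :
    HasFDerivAt (Ω.indicator φ) (Ω.indicator (fderiv ℝ φ) y) y := by
  by_cases h : y ∈ Ω
  · rw [indicator_of_mem h]
    refine (hφ.differentiable (by simp) y).hasFDerivAt.congr_of_eventuallyEq ?_
    filter_upwards [hΩ.isOpen.mem_nhds h] with x hx using indicator_of_mem hx φ
  · rw [indicator_of_notMem h]
    refine (hasFDerivAt_const (0 : ℝ) y).congr_of_eventuallyEq ?_
    by_cases hc : y ∈ closure Ω
    · have hf : y ∈ outerBoundary Ω :=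
        ⟨⟨hc, fun h' => h (interior_subset h')⟩, fun h' => hy.ne' h'.2⟩
      have hn : y ∉ tsupport φ := fun h' => hd.le_bot ⟨h', subset_closure hf⟩
      filter_upwards [(isClosed_tsupport φ).isOpen_compl.mem_nhds hn] with x hx
      simp [image_eq_zero_of_notMem_tsupport hx]
    · filter_upwards [isClosed_closure.isOpen_compl.mem_nhds hc] with x hx
      exact indicator_of_notMem (fun h' => hx (subset_closure h')) φ

/-- A field that vanishes near the outer boundary, cut off near the axis and extended by zero,
is a test function. -/
theorem isTest_indicator (hΩ : IsMeridianDomain Ω) {φ ξ : Pt → ℝ} (hξ : ContDiff ℝ ∞ ξ)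
    (hd : Disjoint (tsupport φ) (closure (outerBoundary Ω))) {δ : ℝ} (hδ : 0 < δ)
    (h : ∀ x, ξ x ≠ 0 → φ x ≠ 0 ∧ δ ≤ x 0) :
    ContDiff ℝ ∞ (Ω.indicator ξ) ∧ HasCompactSupport (Ω.indicator ξ) ∧
      tsupport (Ω.indicator ξ) ⊆ Ω := by
  set S : Set Pt := closure Ω ∩ (tsupport φ ∩ {x | δ ≤ x 0}) with hS
  have hclosed : IsClosed S := isClosed_closure.inter ((isClosed_tsupport φ).inter
    (isClosed_le continuous_const (by fun_prop)))
  have hcomp : IsCompact S := (hΩ.isBounded.isCompact_closure).of_isClosed_subset hclosed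
    inter_subset_left
  have hsub : S ⊆ Ω := by
    rintro x ⟨hx, hx1, hx2⟩
    by_contra hn
    have hf : x ∈ outerBoundary Ω :=
      ⟨⟨hx, fun h' => hn (interior_subset h')⟩, fun h' => (hδ.trans_le hx2).ne' h'.2⟩
    exact hd.le_bot ⟨hx1, subset_closure hf⟩
  have hts : tsupport (Ω.indicator ξ) ⊆ S := by
    refine closure_minimal (fun x hx => ?_) hclosed
    have hxΩ : x ∈ Ω := mem_of_indicator_ne_zero hx
    have hx0 : ξ x ≠ 0 := by
      intro h0
      exact hx (by rw [indicator_of_mem hxΩ, h0])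
    exact ⟨subset_closure hxΩ, subset_tsupport φ (h x hx0).1, (h x hx0).2⟩
  refine ⟨contDiff_iff_contDiffAt.2 fun x => ?_, hcomp.of_isClosed_subset (isClosed_tsupport _) hts,
    hts.trans hsub⟩
  by_cases hx : x ∉ tsupport (Ω.indicator ξ)
  · refine contDiffAt_const (c := (0 : ℝ)).congr_of_eventuallyEq ?_
    filter_upwards [(isClosed_tsupport _).isOpen_compl.mem_nhds hx] with y hy
      using image_eq_zero_of_notMem_tsupport hy
  rw [not_not] at hx
  refine hξ.contDiffAt.congr_of_eventuallyEq ?_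
  filter_upwards [hΩ.isOpen.mem_nhds (hsub (hts hx))] with y hy using indicator_of_mem hy ξ

theorem energyField_of_graphNorm (h : ∀ i, ∃ g, IsWeakGrad Ω (fun x => v x i) g)
    (hf : graphNorm Ω v < ⊤) : EnergyField Ω v := by
  have m : ∀ i k, AEStronglyMeasurable (fun x => v x i) (wMeas Ω k) := fun i k => by
    obtain ⟨g, hg⟩ := h i
    exact hg.1.aestronglyMeasurable.mono_ac (wMeas_ac Ω k)
  simp only [graphNorm, ENNReal.add_lt_top, ENNReal.sum_lt_top, Finset.mem_univ, true_imp_iff] at hf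
  exact ⟨fun i => ⟨⟨m i 1, (hf.1 i).1⟩, h i,
    ⟨(aestronglyMeasurable_weakGrad (h i)).mono_ac (wMeas_ac Ω 1), (hf.1 i).2⟩⟩, m 0 (-1), hf.2⟩

/-- The smooth approximants in `velSpace` are not assumed to have finite energy. They inherit it
from `v` and the small difference `v - φ`. -/
theorem energyField_of_approx (hΩ : IsMeridianDomain Ω) (hv : EnergyField Ω v) {φ : Pt → Pt}
    (hφ : ContDiff ℝ ∞ φ) (hf : graphNorm Ω (v - φ) < ⊤) :
    EnergyField Ω (v - φ) ∧ EnergyField Ω φ := by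
  have h := energyField_of_graphNorm (exists_isWeakGrad_sub_smooth hv hφ) hf
  refine ⟨h, ?_⟩
  simpa using hv.sub hΩ h

theorem memLp_of_components {μ : Measure Pt} {g : Pt → Pt} (h : ∀ i, MemLp (fun x => g x i) 2 μ) :
    MemLp g 2 μ :=
  MemLp.of_eval_piLp h

theorem EnergyField.memLp (hv : EnergyField Ω v) : MemLp v 2 (wMeas Ω 1) :=
  memLp_of_components fun i => (hv.memH1 i).1

theorem pairL2_radius_smul (hΩ : IsMeridianDomain Ω) (g v : Pt → Pt) :
    pairL2 Ω g (fun x => x 0 • v x) = ∫ x, inner ℝ (g x) (v x) ∂wMeas Ω 1 := by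
  rw [hΩ.integral_wMeas, pairL2]
  simp [inner_smul_right]

/-- The cutoff `η_n(r) = η(n r)` away from the axis. -/
def axisCutoff (n : ℕ) (x : Pt) : ℝ := Real.smoothTransition (n * x 0 - 1)

theorem contDiff_axisCutoff (n : ℕ) : ContDiff ℝ ∞ (axisCutoff n) :=
  Real.smoothTransition.contDiff.comp ((contDiff_const.mul contDiff_radius).sub contDiff_const)

/-- The derivative is continuous and vanishes off `[0, 1]`, so compactness bounds it. -/
theorem exists_bound_deriv_smoothTransition :
    ∃ M : ℝ, ∀ t, |deriv Real.smoothTransition t| ≤ M := by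
  have hc : Continuous (deriv Real.smoothTransition) :=
    (Real.smoothTransition.contDiff (n := 1)).continuous_deriv le_rfl
  obtain ⟨M, hM⟩ := (isCompact_Icc (a := (0 : ℝ)) (b := 1)).exists_bound_of_continuousOn
    hc.continuousOn
  refine ⟨M, fun t => ?_⟩
  have hM0 : 0 ≤ M := (norm_nonneg _).trans (hM 0 (by simp))
  by_cases h : t ∈ Icc (0 : ℝ) 1
  · exact hM t h
  · have hz : deriv Real.smoothTransition t = 0 := by
      rw [mem_Icc, not_and_or, not_le, not_le] at h
      rcases h with h | h
      · have : Real.smoothTransition =ᶠ[nhds t] fun _ => 0 := by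
          filter_upwards [Iio_mem_nhds h] with s hs
          exact Real.smoothTransition.zero_of_nonpos (le_of_lt hs)
        rw [this.deriv_eq, deriv_const]
      · have : Real.smoothTransition =ᶠ[nhds t] fun _ => 1 := by
          filter_upwards [Ioi_mem_nhds h] with s hs
          exact Real.smoothTransition.one_of_one_le (le_of_lt hs)
        rw [this.deriv_eq, deriv_const]
    simpa [hz] using hM0

theorem grad_axisCutoff (n : ℕ) (x : Pt) : grad (axisCutoff n) x =
    (n * deriv Real.smoothTransition (n * x 0 - 1)) • EuclideanSpace.single 0 1 := by
  have h0 : HasFDerivAt (fun x : Pt => x 0) (EuclideanSpace.proj (𝕜 := ℝ) (0 : Fin 2)) x :=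
    (EuclideanSpace.proj (𝕜 := ℝ) (0 : Fin 2)).hasFDerivAt
  have h1 := (h0.const_mul (n : ℝ)).sub_const 1
  have h2 : HasDerivAt Real.smoothTransition (deriv Real.smoothTransition (n * x 0 - 1))
      (n * x 0 - 1) :=
    ((Real.smoothTransition.contDiff (n := 1)).differentiable one_ne_zero _).hasDerivAt
  have h3 : HasFDerivAt (axisCutoff n) _ x := h2.comp_hasFDerivAt x h1
  ext i
  rw [grad_apply, h3.fderiv]
  fin_cases i <;> simp [mul_comm]

/-- Integration by parts for smooth fields vanishing near the outer boundary, cut off near the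
axis. -/
theorem integral_cutoff (hΩ : IsMeridianDomain Ω) (hα : ∃ g, IsWeakGrad Ω α g)
    {φ : Pt → Pt} (hφ : ContDiff ℝ ∞ φ)
    (hd : Disjoint (tsupport φ) (closure (outerBoundary Ω))) {n : ℕ} (hn : 0 < n) (i : Fin 2) :
    IntegrableOn (fun x => α x * grad (fun y => axisCutoff n y * (y 0 * φ y i)) x i +
      weakGrad Ω α x i * (axisCutoff n x * (x 0 * φ x i))) Ω ∧
    ∫ x in Ω, (α x * grad (fun y => axisCutoff n y * (y 0 * φ y i)) x i +
      weakGrad Ω α x i * (axisCutoff n x * (x 0 * φ x i))) = 0 := by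
  set ξ : Pt → ℝ := fun y => axisCutoff n y * (y 0 * φ y i) with hξd
  have hξ : ContDiff ℝ ∞ ξ :=
    (contDiff_axisCutoff n).mul (contDiff_radius.mul (contDiff_component hφ i))
  have hn' : (0 : ℝ) < n := by exact_mod_cast hn
  obtain ⟨t1, t2, t3⟩ := isTest_indicator (φ := fun x => φ x i) hΩ hξ
    (hd.mono_left (closure_mono fun x hx => fun (h : φ x = 0) => hx (by simp [h]))) (δ := 1 / n) (by positivity)
    (fun x hx => by
      refine ⟨right_ne_zero_of_mul (right_ne_zero_of_mul hx), ?_⟩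
      have h1 : axisCutoff n x ≠ 0 := left_ne_zero_of_mul hx
      by_contra hlt
      rw [not_le, lt_div_iff₀ hn'] at hlt
      refine h1 (Real.smoothTransition.zero_of_nonpos ?_)
      linarith)
  have hw := isWeakGrad_weakGrad hα
  have e := hw.2.2 _ t1 t2 t3 i
  have e1 : IntegrableOn (fun x => α x * grad ξ x i) Ω := by
    refine (integrableOn_mul_fderiv hw.1 t1 t2 t3 (EuclideanSpace.single i 1)).congr_fun
      (fun x hx => ?_) hΩ.measurableSet
    have : Ω.indicator ξ =ᶠ[nhds x] ξ := by
      filter_upwards [hΩ.isOpen.mem_nhds hx] with y hy using indicator_of_mem hy ξ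
    simp only [grad_apply, this.fderiv_eq]
  have e2 : IntegrableOn (fun x => weakGrad Ω α x i * ξ x) Ω := by
    refine (integrableOn_mul_of_tsupport_subset (hw.2.1.component i) t1.continuous t2 t3).congr_fun
      (fun x hx => ?_) hΩ.measurableSet
    simp only [indicator_of_mem hx]
  refine ⟨e1.add e2, ?_⟩
  rw [integral_add e1 e2]
  have f1 : ∫ x in Ω, α x * grad ξ x i =
      ∫ x in Ω, α x * fderiv ℝ (Ω.indicator ξ) x (EuclideanSpace.single i 1) := by
    refine setIntegral_congr_fun hΩ.measurableSet fun x hx => ?_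
    have : Ω.indicator ξ =ᶠ[nhds x] ξ := by
      filter_upwards [hΩ.isOpen.mem_nhds hx] with y hy using indicator_of_mem hy ξ
    simp only [grad_apply, this.fderiv_eq]
  have f2 : ∫ x in Ω, weakGrad Ω α x i * ξ x =
      ∫ x in Ω, weakGrad Ω α x i * Ω.indicator ξ x := by
    refine setIntegral_congr_fun hΩ.measurableSet fun x hx => ?_
    simp only [indicator_of_mem hx]
  rw [f1, f2, e]
  ring

theorem grad_mul {ψ χ : Pt → ℝ} (hψ : ContDiff ℝ ∞ ψ) (hχ : ContDiff ℝ ∞ χ) (x : Pt) :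
    grad (fun y => ψ y * χ y) x = ψ x • grad χ x + χ x • grad ψ x := by
  ext i
  simp only [grad_apply, PiLp.add_apply, PiLp.smul_apply]
  rw [fderiv_fun_mul (hψ.differentiable (by simp) x) (hχ.differentiable (by simp) x)]
  simp

theorem cylDiv_smooth (hΩ : IsMeridianDomain Ω) {φ : Pt → Pt} (hφ : ContDiff ℝ ∞ φ) :
    cylDiv Ω φ =ᵐ[volume.restrict Ω] fun x => grad (fun y => φ y 0) x 0 +
      grad (fun y => φ y 1) x 1 + (x 0)⁻¹ * φ x 0 := by
  filter_upwards [weakGrad_smooth hΩ.isOpen (contDiff_component hφ 0),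
    weakGrad_smooth hΩ.isOpen (contDiff_component hφ 1)] with x h0 h1
  simp only [cylDiv, h0, h1]

/-- `φ` need not vanish near the axis, so `r φ` is not a test field until it is cut off there. The
derivative falling on the cutoff produces an error that must be shown to disappear. -/
theorem formB_add_integral_eq_zero_of_smooth (hΩ : IsMeridianDomain Ω) (hα : MemH1 Ω α)
    {φ : Pt → Pt} (hφ : ContDiff ℝ ∞ φ) (hφe : EnergyField Ω φ)
    (hd : Disjoint (tsupport φ) (closure (outerBoundary Ω))) :
    formB Ω α φ + ∫ x, inner ℝ (weakGrad Ω α x) (φ x) ∂wMeas Ω 1 = 0 := by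
  obtain ⟨M, hM⟩ := exists_bound_deriv_smoothTransition
  set F : Pt → ℝ := fun x => x 0 * (α x * cylDiv Ω φ x + inner ℝ (weakGrad Ω α x) (φ x)) with hF
  have i1 := integrable_inner_of_memLp hα.1 (memLp_cylDiv hΩ hφe)
  have i2 := integrable_inner_of_memLp hα.2.2 hφe.memLp
  have e0 : formB Ω α φ + ∫ x, inner ℝ (weakGrad Ω α x) (φ x) ∂wMeas Ω 1 = ∫ x in Ω, F x := by
    rw [formB_eq hΩ hφe, ← integral_add i1 i2, hΩ.integral_wMeas]
    simp [hF, mul_comm]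
  have iF : IntegrableOn F Ω := by
    have := (hΩ.integrable_wMeas 1).1 (i1.add i2)
    refine this.congr (Filter.Eventually.of_forall fun x => ?_)
    simp [hF, mul_comm]
  -- Here `φ_r ∈ L²_{-1}` is indispensable: `α φ_r` has to be integrable without a weight.
  have iαφ : IntegrableOn (fun x => α x * φ x 0) Ω := by
    have := integrableOn_inner_of_memLp hΩ hα.1 hφe.radial
    simpa [mul_comm] using this
  -- The factor `r` compensates the slope `n` of the cutoff. The product is bounded by `2 M`,
  -- because the derivative vanishes once `n r > 2`, and it tends to zero pointwise.
  let c : ℕ → Pt → ℝ := fun n x => n * x 0 * deriv Real.smoothTransition (n * x 0 - 1)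
  have hz : ∀ n : ℕ, 0 < n → ∫ x in Ω, (axisCutoff n x * F x + c n x * (α x * φ x 0)) = 0 := by
    intro n hn
    have hsum : ∀ᵐ x ∂volume.restrict Ω, axisCutoff n x * F x + c n x * (α x * φ x 0) =
        ∑ i, (α x * grad (fun y => axisCutoff n y * (y 0 * φ y i)) x i +
          weakGrad Ω α x i * (axisCutoff n x * (x 0 * φ x i))) := by
      filter_upwards [cylDiv_smooth hΩ hφ, ae_restrict_mem hΩ.measurableSet] with x hx hxΩ
      have hr := (hΩ.radius_pos x hxΩ).ne'
      simp only [Fin.sum_univ_two, hF, hx, c]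
      simp only [grad_mul (contDiff_axisCutoff n) (contDiff_radius.mul (contDiff_component hφ _)),
        grad_mul contDiff_radius (contDiff_component hφ _), grad_radius, grad_axisCutoff,
        PiLp.add_apply, PiLp.smul_apply, PiLp.inner_apply, Fin.sum_univ_two]
      simp
      field_simp
      ring
    rw [integral_congr_ae hsum, integral_finsetSum]
    · exact Finset.sum_eq_zero fun i _ => (integral_cutoff hΩ hα.2.1 hφ hd hn i).2
    · intro i _
      exact (integral_cutoff hΩ hα.2.1 hφ hd hn i).1
  have hlim : Filter.Tendsto
      (fun n : ℕ => ∫ x in Ω, (axisCutoff n x * F x + c n x * (α x * φ x 0))) Filter.atTop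
      (nhds (∫ x in Ω, F x)) := by
    refine tendsto_integral_of_dominated_convergence
      (fun x => ‖F x‖ + 2 * M * ‖α x * φ x 0‖) (fun n => ?_)
      (iF.norm.add (iαφ.norm.const_mul _)) (fun n => ?_) ?_
    · refine ((contDiff_axisCutoff n).continuous.aestronglyMeasurable.mul iF.1).add
        (AEStronglyMeasurable.mul ?_ iαφ.1)
      have hc : Continuous (deriv Real.smoothTransition) :=
        (Real.smoothTransition.contDiff (n := 1)).continuous_deriv le_rfl
      have : Continuous (c n) := by
        have h0 : Continuous fun x : Pt => x 0 := by fun_prop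
        exact (continuous_const.mul h0).mul (hc.comp ((continuous_const.mul h0).sub
          continuous_const))
      exact this.aestronglyMeasurable
    · filter_upwards [ae_restrict_mem hΩ.measurableSet] with x hx
      refine (norm_add_le _ _).trans (add_le_add ?_ ?_)
      · rw [norm_mul]
        refine mul_le_of_le_one_left (norm_nonneg _) ?_
        rw [axisCutoff, Real.norm_of_nonneg (Real.smoothTransition.nonneg _)]
        exact Real.smoothTransition.le_one _
      · rw [norm_mul]
        refine mul_le_mul_of_nonneg_right ?_ (norm_nonneg _)
        have hM0 : 0 ≤ M := (abs_nonneg _).trans (hM 0)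
        have hnr : 0 ≤ n * x 0 := mul_nonneg n.cast_nonneg (hΩ.radius_pos x hx).le
        by_cases h2 : n * x 0 ≤ 2
        · simp only [c, norm_mul (n * x 0), Real.norm_of_nonneg hnr]
          exact mul_le_mul h2 (hM _) (norm_nonneg _) (by norm_num)
        · have : Real.smoothTransition =ᶠ[nhds (n * x 0 - 1)] fun _ => 1 := by
            have h3 : 1 < n * x 0 - 1 := by linarith
            filter_upwards [Ioi_mem_nhds h3] with s hs
            exact Real.smoothTransition.one_of_one_le (le_of_lt hs)
          simp only [c, this.deriv_eq, deriv_const, mul_zero, norm_zero]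
          positivity
    · filter_upwards [ae_restrict_mem hΩ.measurableSet] with x hx
      have hr := hΩ.radius_pos x hx
      refine tendsto_const_nhds.congr' ?_
      filter_upwards [(tendsto_natCast_atTop_atTop (R := ℝ)).eventually_gt_atTop (2 / x 0)]
        with n hn
      rw [div_lt_iff₀ hr] at hn
      have h3 : 1 < n * x 0 - 1 := by linarith
      have : Real.smoothTransition =ᶠ[nhds (n * x 0 - 1)] fun _ => 1 := by
        filter_upwards [Ioi_mem_nhds h3] with s hs
        exact Real.smoothTransition.one_of_one_le (le_of_lt hs)
      simp only [c, this.deriv_eq, deriv_const, mul_zero, zero_mul, add_zero, axisCutoff,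
        Real.smoothTransition.one_of_one_le h3.le, one_mul]
  rw [e0]
  refine tendsto_nhds_unique hlim (tendsto_const_nhds.congr' ?_)
  filter_upwards [Filter.eventually_gt_atTop 0] with n hn
  exact (hz n hn).symm

theorem normL2_le_of_components {g : Pt → Pt} {k : ℤ} (h : ∀ i, MemLp (fun x => g x i) 2 (wMeas Ω k)) :
    eLpNorm g 2 (wMeas Ω k) ≤ ∑ i, eLpNorm (fun x => g x i) 2 (wMeas Ω k) := by
  have h1 : eLpNorm g 2 (wMeas Ω k) ≤
      eLpNorm (fun x => ∑ i, ‖g x i‖) 2 (wMeas Ω k) := by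
    refine eLpNorm_mono_real fun x => ?_
    rw [EuclideanSpace.norm_eq, Fin.sum_univ_two, Fin.sum_univ_two, Real.sqrt_le_left (by positivity)]
    nlinarith [mul_nonneg (norm_nonneg (g x 0)) (norm_nonneg (g x 1))]
  simp only [Fin.sum_univ_two] at h1 ⊢
  refine h1.trans ((eLpNorm_add_le (h 0).1.norm (h 1).1.norm (by norm_num)).trans_eq ?_)
  simp only [eLpNorm_norm]

/-- Integration by parts: `b(α, v) = -(∇α, r v)_{L²}` for `α ∈ H¹_1(Ω)`, `v ∈ V`. -/
theorem formB_eq_neg_integral (hΩ : IsMeridianDomain Ω) (hα : MemH1 Ω α) (hv : v ∈ velSpace Ω) :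
    formB Ω α v = -∫ x, inner ℝ (weakGrad Ω α x) (v x) ∂wMeas Ω 1 := by
  have hv' := energyField_of_mem hv
  rw [← add_eq_zero_iff_eq_neg]
  set J := formB Ω α v + ∫ x, inner ℝ (weakGrad Ω α x) (v x) ∂wMeas Ω 1 with hJ
  set A := normL2 Ω 1 α + normL2 Ω 1 (weakGrad Ω α) with hA
  have hA0 : 0 ≤ A := add_nonneg (normL2_nonneg _ _) (normL2_nonneg _ _)
  -- `J` is continuous in the graph norm and vanishes on the smooth approximants, so it is smaller
  -- than any multiple of `ε`.
  have key : ∀ ε : ℝ, 0 < ε → |J| ≤ A * ε := by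
    intro ε hε
    obtain ⟨φ, hφ, hd, hn⟩ := hv.2.2 (ENNReal.ofReal ε) (by simpa using hε)
    obtain ⟨hw, hφe⟩ := energyField_of_approx hΩ hv' hφ (hn.trans ENNReal.ofReal_lt_top)
    have h0 := formB_add_integral_eq_zero_of_smooth hΩ hα hφ hφe hd
    have hJ2 : J = ∫ x, inner ℝ (α x) (cylDiv Ω (v - φ) x) ∂wMeas Ω 1 +
        ∫ x, inner ℝ (weakGrad Ω α x) ((v - φ) x) ∂wMeas Ω 1 := by
      rw [← formB_eq hΩ hw, formB_sub_right hΩ hv' hφe hα.1]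
      have : ∫ x, inner ℝ (weakGrad Ω α x) ((v - φ) x) ∂wMeas Ω 1 =
          ∫ x, inner ℝ (weakGrad Ω α x) (v x) ∂wMeas Ω 1 -
          ∫ x, inner ℝ (weakGrad Ω α x) (φ x) ∂wMeas Ω 1 := by
        rw [← integral_sub (integrable_inner_of_memLp hα.2.2 hv'.memLp)
          (integrable_inner_of_memLp hα.2.2 hφe.memLp)]
        simp only [Pi.sub_apply, inner_sub_right]
      rw [this, hJ]
      linarith
    have b1 : normL2 Ω 1 (cylDiv Ω (v - φ)) ≤ ε := by
      refine ENNReal.toReal_le_of_le_ofReal hε.le (((eLpNorm_cylDiv_le hΩ hw).trans ?_).trans hn.le)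
      simp only [graphNorm, Fin.sum_univ_two]
      gcongr <;> exact le_add_self
    have b2 : normL2 Ω 1 (v - φ) ≤ ε := by
      refine ENNReal.toReal_le_of_le_ofReal hε.le
        (((normL2_le_of_components fun i => (hw.memH1 i).1).trans ?_).trans hn.le)
      simp only [graphNorm, Fin.sum_univ_two]
      refine le_add_right ?_
      gcongr <;> exact le_self_add
    rw [hJ2, hA, add_mul]
    refine (abs_add_le _ _).trans (add_le_add
      ((abs_integral_inner_le hα.1 (memLp_cylDiv hΩ hw)).trans ?_)
      ((abs_integral_inner_le hα.2.2 hw.memLp).trans ?_))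
    · exact mul_le_mul_of_nonneg_left b1 (normL2_nonneg _ _)
    · exact mul_le_mul_of_nonneg_left b2 (normL2_nonneg _ _)
  by_contra hne
  have hpos : 0 < |J| := abs_pos.2 hne
  have := key (|J| / (2 * (A + 1))) (by positivity)
  have h2 : A * (|J| / (2 * (A + 1))) ≤ |J| / 2 := by
    rw [mul_div_assoc', div_le_div_iff₀ (by positivity) (by norm_num)]
    nlinarith
  linarith

/-! ### The Friedrichs inequality -/

/-- Integrate `∂_r φ` outwards, in the direction of growing `r`, until `Ω` is left. Along this path
the weight only increases, so `r` at the starting point is dominated by `r` along the path and no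
Hardy inequality at the axis is needed. -/
theorem friedrichs_smooth (hΩ : IsMeridianDomain Ω) {R : ℝ} (hR : 0 < R)
    (hΩR : ∀ x ∈ Ω, x 0 < R) {φ : Pt → ℝ}
    (hφ : ContDiff ℝ ∞ φ) (hd : Disjoint (tsupport φ) (closure (outerBoundary Ω))) :
    eLpNorm φ 2 (wMeas Ω 1) ≤ ENNReal.ofReal R * eLpNorm (grad φ) 2 (wMeas Ω 1) := by
  set e : Pt := EuclideanSpace.single 0 1 with he
  set H : Pt → ℝ≥0∞ := Ω.indicator fun x => ENNReal.ofReal (x 0) * ‖grad φ x‖ₑ ^ 2 with hH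
  have hHm : Measurable H := by
    refine Measurable.indicator ?_ hΩ.measurableSet
    have h1 : Measurable fun x : Pt => x 0 := by fun_prop
    exact h1.ennreal_ofReal.mul ((continuous_grad hφ).measurable.enorm.pow_const 2)
  have pt : ∀ x ∈ Ω, ENNReal.ofReal (x 0) * ‖φ x‖ₑ ^ 2 ≤
      ENNReal.ofReal R * ∫⁻ t in Ioc 0 R, H (x + t • e) := by
    intro x hx
    have hr := hΩ.radius_pos x hx
    have hpos : ∀ t : ℝ, (x + t • e) 0 = x 0 + t := fun t => by simp [he]
    have hder : ∀ t ∈ uIcc 0 R, HasDerivAt (fun t : ℝ => Ω.indicator φ (x + t • e))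
        (Ω.indicator (fderiv ℝ φ) (x + t • e) e) t := by
      intro t ht
      rw [uIcc_of_le hR.le] at ht
      have h1 := hasFDerivAt_indicator hΩ hφ hd (y := x + t • e) (by rw [hpos]; linarith [ht.1])
      have h2 : HasDerivAt (fun t : ℝ => x + t • e) e t := by
        simpa using ((hasDerivAt_id t).smul_const e).const_add x
      exact h1.comp_hasDerivAt t h2
    have hcurve : Continuous fun t : ℝ => x + t • e := by fun_prop
    have hmeas : Measurable fun t : ℝ => Ω.indicator (fderiv ℝ φ) (x + t • e) e := by
      have : Measurable (Ω.indicator fun y => fderiv ℝ φ y e) :=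
        (continuous_fderiv_test hφ e).measurable.indicator hΩ.measurableSet
      convert this.comp hcurve.measurable using 2 with t
      simp only [Function.comp]
      by_cases h : x + t • e ∈ Ω <;> simp [h]
    obtain ⟨B, hB⟩ := hΩ.isBounded.isCompact_closure.exists_bound_of_continuousOn
      (continuous_fderiv_test hφ e).continuousOn
    have hB0 : 0 ≤ B := (norm_nonneg _).trans (hB x (subset_closure hx))
    have hint : IntervalIntegrable (fun t : ℝ => Ω.indicator (fderiv ℝ φ) (x + t • e) e) volume 0 R := by
      rw [intervalIntegrable_iff_integrableOn_Ioc_of_le hR.le]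
      refine Measure.integrableOn_of_bounded (M := B) (by simp) hmeas.aestronglyMeasurable ?_
      refine Filter.Eventually.of_forall fun t => ?_
      by_cases h : x + t • e ∈ Ω
      · simpa [h] using hB _ (subset_closure h)
      · simpa [h] using hB0
    have hftc := intervalIntegral.integral_eq_sub_of_hasDerivAt hder hint
    -- At the end of the path the radius exceeds `R`, so the zero extension vanishes there and the
    -- fundamental theorem returns `-φ x`.
    have hend : x + R • e ∉ Ω := fun h => by
      have := hΩR _ h
      rw [hpos] at this
      linarith
    simp only [zero_smul, add_zero, indicator_of_notMem hend, indicator_of_mem hx, zero_sub] at hftc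
    have hn : ‖φ x‖ₑ ≤ ∫⁻ t in Ioc 0 R, ‖Ω.indicator (fderiv ℝ φ) (x + t • e) e‖ₑ := by
      rw [← enorm_neg, ← hftc, intervalIntegral.integral_of_le hR.le]
      exact enorm_integral_le_lintegral_enorm _
    calc ENNReal.ofReal (x 0) * ‖φ x‖ₑ ^ 2
        ≤ ENNReal.ofReal (x 0) * (ENNReal.ofReal R *
          ∫⁻ t in Ioc 0 R, ‖Ω.indicator (fderiv ℝ φ) (x + t • e) e‖ₑ ^ 2) := by
          refine mul_le_mul_right ((pow_le_pow_left' hn 2).trans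
            ((sq_lintegral_le hmeas.enorm.aemeasurable).trans_eq ?_)) _
          simp
      _ = ENNReal.ofReal R * ∫⁻ t in Ioc 0 R,
          ENNReal.ofReal (x 0) * ‖Ω.indicator (fderiv ℝ φ) (x + t • e) e‖ₑ ^ 2 := by
          rw [lintegral_const_mul _ (hmeas.enorm.pow_const 2)]
          ring
      _ ≤ ENNReal.ofReal R * ∫⁻ t in Ioc 0 R, H (x + t • e) := by
          refine mul_le_mul_right (setLIntegral_mono (hHm.comp hcurve.measurable) fun t ht => ?_) _
          by_cases h : x + t • e ∈ Ω
          · have h1 : ENNReal.ofReal (x 0) ≤ ENNReal.ofReal ((x + t • e) 0) :=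
              ENNReal.ofReal_le_ofReal (by rw [hpos]; linarith [ht.1])
            have h2 : ‖fderiv ℝ φ (x + t • e) e‖ₑ ≤ ‖grad φ (x + t • e)‖ₑ :=
              enorm_le_iff_norm_le.2 (PiLp.norm_apply_le (grad φ (x + t • e)) 0)
            simp only [hH, Function.comp, indicator_of_mem h]
            exact mul_le_mul' h1 (pow_le_pow_left' h2 2)
          · simp [h]
  have hsq : eLpNorm φ 2 (wMeas Ω 1) ^ 2 ≤
      (ENNReal.ofReal R * eLpNorm (grad φ) 2 (wMeas Ω 1)) ^ 2 := by
    rw [mul_pow, eLpNorm_two_sq, eLpNorm_two_sq, lintegral_wMeas, lintegral_wMeas]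
    simp only [zpow_one]
    have hjm : Measurable fun z : Pt × ℝ => H (z.1 + z.2 • e) :=
      hHm.comp (by fun_prop : Continuous fun z : Pt × ℝ => z.1 + z.2 • e).measurable
    calc ∫⁻ x in Ω, ENNReal.ofReal (x 0) * ‖φ x‖ₑ ^ 2
        ≤ ∫⁻ x in Ω, ENNReal.ofReal R * ∫⁻ t in Ioc 0 R, H (x + t • e) :=
          setLIntegral_mono' hΩ.measurableSet pt
      _ ≤ ∫⁻ x, ENNReal.ofReal R * ∫⁻ t in Ioc 0 R, H (x + t • e) := setLIntegral_le_lintegral _ _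
      -- Tonelli, then translation invariance of Lebesgue measure: the inner integral no longer
      -- depends on `t`, and the outer one contributes the second factor `R`.
      _ = ENNReal.ofReal R * ∫⁻ t in Ioc 0 R, ∫⁻ x, H (x + t • e) := by
          rw [lintegral_const_mul _ hjm.lintegral_prod_right', lintegral_lintegral_swap]
          exact hjm.aemeasurable
      _ = ENNReal.ofReal R * ∫⁻ t in Ioc 0 R, ∫⁻ x, H x := by
          simp only [lintegral_add_right_eq_self]
      _ = ENNReal.ofReal R ^ 2 * ∫⁻ x in Ω, ENNReal.ofReal (x 0) * ‖grad φ x‖ₑ ^ 2 := by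
          rw [setLIntegral_const, hH, lintegral_indicator hΩ.measurableSet]
          simp only [Real.volume_Ioc, sub_zero]
          ring
  exact (ENNReal.pow_right_strictMono (by norm_num : (2 : ℕ) ≠ 0)).le_iff_le.1 hsq

theorem exists_friedrichs (hΩ : IsMeridianDomain Ω) :
    ∃ R : ℝ, 0 < R ∧ ∀ v ∈ velSpace Ω, ∀ i : Fin 2, eLpNorm (fun x => v x i) 2 (wMeas Ω 1) ≤
      ENNReal.ofReal R * eLpNorm (weakGrad Ω fun x => v x i) 2 (wMeas Ω 1) := by
  obtain ⟨R, hR, hb⟩ := hΩ.isBounded.exists_pos_norm_lt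
  refine ⟨R, hR, fun v hv i => ?_⟩
  have hv' := energyField_of_mem hv
  refine ENNReal.le_of_forall_pos_le_add fun ε hε _ => ?_
  -- The approximation error enters as `a + R b ≤ (1 + R) (a + b)`, which this choice keeps below
  -- `ε`.
  have hε' : (0 : ℝ≥0∞) < ε / (1 + ENNReal.ofReal R) :=
    ENNReal.div_pos (by simpa using hε.ne') (by simp)
  obtain ⟨φ, hφ, hd, hn⟩ := hv.2.2 _ hε'
  have hlt : graphNorm Ω (v - φ) < ⊤ :=
    hn.trans (ENNReal.div_lt_top (by simp) (by simp))
  obtain ⟨hw, hφe⟩ := energyField_of_approx hΩ hv' hφ hlt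
  have hφi := contDiff_component hφ i
  have f := friedrichs_smooth hΩ hR (fun x hx =>
    ((le_abs_self _).trans (PiLp.norm_apply_le x 0)).trans_lt (hb x hx)) hφi
    (hd.mono_left (closure_mono fun x hx => fun (h : φ x = 0) => hx (by simp [h])))
  have g1 : eLpNorm (fun x => (v - φ) x i) 2 (wMeas Ω 1) +
      eLpNorm (weakGrad Ω fun x => (v - φ) x i) 2 (wMeas Ω 1) ≤ graphNorm Ω (v - φ) := by
    rw [graphNorm]
    refine le_add_right ?_
    exact Finset.single_le_sum (f := fun i => eLpNorm (fun x => (v - φ) x i) 2 (wMeas Ω 1) +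
      eLpNorm (weakGrad Ω fun x => (v - φ) x i) 2 (wMeas Ω 1)) (fun _ _ => zero_le) (Finset.mem_univ i)
  have t1 : eLpNorm (fun x => v x i) 2 (wMeas Ω 1) ≤
      eLpNorm (fun x => (v - φ) x i) 2 (wMeas Ω 1) + eLpNorm (fun x => φ x i) 2 (wMeas Ω 1) := by
    refine le_trans (le_of_eq ?_) (eLpNorm_add_le (hw.memH1 i).1.1 (hφe.memH1 i).1.1 (by norm_num))
    congr 1
    funext x
    simp
  have t2 : eLpNorm (grad fun x => φ x i) 2 (wMeas Ω 1) ≤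
      eLpNorm (weakGrad Ω fun x => v x i) 2 (wMeas Ω 1) +
      eLpNorm (weakGrad Ω fun x => (v - φ) x i) 2 (wMeas Ω 1) := by
    refine le_trans (le_of_eq (eLpNorm_congr_ae ?_))
      (eLpNorm_sub_le (hv'.memH1 i).2.2.1 (hw.memH1 i).2.2.1 (by norm_num))
    filter_upwards [wMeas_ac Ω 1 (weakGrad_smooth hΩ.isOpen hφi),
      weakGrad_sub_wMeas 1 hΩ.isOpen (hv'.memH1 i).2.1 (hφe.memH1 i).2.1] with x h1 h2
    have h2' : weakGrad Ω (fun x => (v - φ) x i) x = _ := h2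
    rw [Pi.sub_apply, h2', Pi.sub_apply, h1]
    abel
  set a := eLpNorm (fun x => (v - φ) x i) 2 (wMeas Ω 1)
  set b := eLpNorm (weakGrad Ω fun x => (v - φ) x i) 2 (wMeas Ω 1)
  set c := eLpNorm (weakGrad Ω fun x => v x i) 2 (wMeas Ω 1)
  calc _ ≤ a + ENNReal.ofReal R * (c + b) := t1.trans (by gcongr; exact f.trans (by gcongr))
    _ = ENNReal.ofReal R * c + (a + ENNReal.ofReal R * b) := by ring
    _ ≤ ENNReal.ofReal R * c + (1 + ENNReal.ofReal R) * (a + b) := by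
        gcongr
        calc a + ENNReal.ofReal R * b ≤ (a + ENNReal.ofReal R * b) + (b + ENNReal.ofReal R * a) :=
              le_self_add
          _ = _ := by ring
    _ ≤ ENNReal.ofReal R * c + (1 + ENNReal.ofReal R) * (ε / (1 + ENNReal.ofReal R)) := by
        gcongr
        exact g1.trans hn.le
    _ ≤ _ := by
        gcongr
        exact ENNReal.mul_div_le

end Trace

/-! ### The Poincaré inequality on convex sets with the weight `r` -/

section Poincare

theorem fderiv_eq_inner_grad (ψ : Pt → ℝ) (z w : Pt) :
    fderiv ℝ ψ z w = inner ℝ (grad ψ z) w := by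
  have h : w = w 0 • EuclideanSpace.single 0 (1 : ℝ) + w 1 • EuclideanSpace.single 1 (1 : ℝ) := by
    ext j
    fin_cases j <;> simp
  conv_lhs => rw [h]
  simp [PiLp.inner_apply, Fin.sum_univ_two]

/-- The fundamental theorem along the segment from `x` to `y`, followed by Cauchy--Schwarz on the
unit interval. -/
theorem enorm_sub_sq_le {ψ : Pt → ℝ} (hψ : ContDiff ℝ ∞ ψ) {x y : Pt} {d : ℝ}
    (hd : ‖y - x‖ ≤ d) :
    ‖ψ x - ψ y‖ₑ ^ 2 ≤
      ENNReal.ofReal d ^ 2 * ∫⁻ t in Ioc (0 : ℝ) 1, ‖grad ψ (x + t • (y - x))‖ₑ ^ 2 := by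
  have hcurve : Continuous fun t : ℝ => x + t • (y - x) := by fun_prop
  have hder : ∀ t ∈ uIcc (0 : ℝ) 1, HasDerivAt (fun t : ℝ => ψ (x + t • (y - x)))
      (fderiv ℝ ψ (x + t • (y - x)) (y - x)) t := by
    intro t _
    have h2 : HasDerivAt (fun t : ℝ => x + t • (y - x)) (y - x) t := by
      simpa using ((hasDerivAt_id t).smul_const (y - x)).const_add x
    exact (hψ.differentiable (by simp) _).hasFDerivAt.comp_hasDerivAt t h2
  have hc : Continuous fun t : ℝ => fderiv ℝ ψ (x + t • (y - x)) (y - x) :=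
    (continuous_fderiv_test hψ (y - x)).comp hcurve
  have hg : Measurable fun t : ℝ => ‖grad ψ (x + t • (y - x))‖ₑ :=
    ((continuous_grad hψ).comp hcurve).measurable.enorm
  have hftc := intervalIntegral.integral_eq_sub_of_hasDerivAt hder (hc.intervalIntegrable 0 1)
  simp only [one_smul, zero_smul, add_zero, add_sub_cancel] at hftc
  have hn : ‖ψ x - ψ y‖ₑ ≤
      ∫⁻ t in Ioc (0 : ℝ) 1, ENNReal.ofReal d * ‖grad ψ (x + t • (y - x))‖ₑ := by
    rw [← enorm_neg, neg_sub, ← hftc, intervalIntegral.integral_of_le zero_le_one]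
    refine (enorm_integral_le_lintegral_enorm _).trans (lintegral_mono fun t => ?_)
    rw [fderiv_eq_inner_grad, mul_comm, ← ofReal_norm, ← ofReal_norm,
      ← ENNReal.ofReal_mul (norm_nonneg _)]
    refine ENNReal.ofReal_le_ofReal ((norm_inner_le_norm _ _).trans ?_)
    gcongr
  rw [lintegral_const_mul _ hg] at hn
  calc _ ≤ _ := pow_le_pow_left' hn 2
    _ ≤ _ := by
      rw [mul_pow]
      gcongr
      refine (sq_lintegral_le hg.aemeasurable).trans_eq ?_
      simp

/-- In the plane the Jacobian of the dilation is `t⁻² ≤ 4`. -/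
theorem lintegral_comp_add_smul_le {H : Pt → ℝ≥0∞} (hH : Measurable H) (c : Pt) {t : ℝ}
    (ht : 1 / 2 ≤ t) : ∫⁻ y, H (c + t • y) ≤ 4 * ∫⁻ y, H y := by
  have ht0 : t ≠ 0 := by linarith
  have h1 : ∫⁻ y, H (c + t • y) = ∫⁻ y, H (c + y) ∂(Measure.map (t • ·) volume) := by
    rw [lintegral_map (f := fun y => H (c + y)) (hH.comp (measurable_const_add c))
      (measurable_const_smul t)]
  rw [h1, Measure.map_addHaar_smul _ ht0, lintegral_smul_measure, lintegral_add_left_eq_self,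
    smul_eq_mul]
  gcongr
  rw [← ENNReal.ofReal_ofNat 4]
  refine ENNReal.ofReal_le_ofReal ?_
  rw [finrank_euclideanSpace_fin, abs_of_nonneg (by positivity)]
  calc (t ^ 2)⁻¹ ≤ ((1 / 2) ^ 2)⁻¹ := by gcongr
    _ = 4 := by norm_num

variable {A : Set Pt}

/-- The weight `r` as an extended nonnegative number. -/
def wt (x : Pt) : ℝ≥0∞ := ENNReal.ofReal (x 0)

theorem measurable_wt : Measurable wt := by
  have h : Measurable fun x : Pt => x 0 := by fun_prop
  exact h.ennreal_ofReal

theorem ofReal_le_two_mul {a b : ℝ} (h : a ≤ 2 * b) :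
    ENNReal.ofReal a ≤ 2 * ENNReal.ofReal b := by
  rw [← ENNReal.ofReal_ofNat 2, ← ENNReal.ofReal_mul (by norm_num)]
  exact ENNReal.ofReal_le_ofReal h

/-- At `z = x + t (y - x)` the radius is `(1 - t) r(x) + t r(y)`. For `t ≥ 1/2` this is at least
`r(y) / 2`, so `wt y` may be exchanged for `2 wt z` and `y` substituted by `z` with Jacobian at most
4. For `t ≤ 1/2` the roles of `x` and `y` are swapped. Splitting at `1/2` avoids the degenerate
Jacobian, and convexity keeps `z` in `A`. The constant is `8 = 2 · 4`. -/
theorem lintegral_pair_le (hA : Convex ℝ A) (hm : MeasurableSet A) (hr : ∀ x ∈ A, 0 ≤ x 0)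
    {G : Pt → ℝ≥0∞} (hG : Measurable G) {t : ℝ} (ht : t ∈ Ioc (0 : ℝ) 1) :
    ∫⁻ p, wt p.1 * wt p.2 * G (p.1 + t • (p.2 - p.1))
        ∂((volume.restrict A).prod (volume.restrict A)) ≤
      8 * (∫⁻ x in A, wt x) * ∫⁻ x in A, wt x * G x := by
  set H : Pt → ℝ≥0∞ := A.indicator fun x => wt x * G x with hH
  have hHm : Measurable H := (measurable_wt.mul hG).indicator hm
  have hHI : ∫⁻ x, H x = ∫⁻ x in A, wt x * G x := lintegral_indicator hm _
  have hmem : ∀ {x y : Pt}, x ∈ A → y ∈ A → x + t • (y - x) ∈ A := fun {x y} hx hy =>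
    hA.add_smul_sub_mem hx hy ⟨ht.1.le, ht.2⟩
  have hz : ∀ x y : Pt, (x + t • (y - x)) 0 = (1 - t) * x 0 + t * y 0 := fun x y => by
    simp
    ring
  have hF : Measurable fun p : Pt × Pt => wt p.1 * wt p.2 * G (p.1 + t • (p.2 - p.1)) := by
    refine ((measurable_wt.comp measurable_fst).mul (measurable_wt.comp measurable_snd)).mul
      (hG.comp ?_)
    exact (by fun_prop : Continuous fun p : Pt × Pt => p.1 + t • (p.2 - p.1)).measurable
  rcases le_total (1 / 2) t with h | h
  · rw [lintegral_prod _ hF.aemeasurable]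
    calc ∫⁻ x in A, ∫⁻ y in A, wt x * wt y * G (x + t • (y - x))
        ≤ ∫⁻ x in A, wt x * (2 * (4 * ∫⁻ y, H y)) := by
          refine setLIntegral_mono' hm fun x hx => ?_
          calc ∫⁻ y in A, wt x * wt y * G (x + t • (y - x))
              ≤ ∫⁻ y in A, wt x * (2 * H ((1 - t) • x + t • y)) := by
                refine setLIntegral_mono' hm fun y hy => ?_
                have e : (1 - t) • x + t • y = x + t • (y - x) := by module
                rw [e, hH, indicator_of_mem (hmem hx hy), mul_assoc, ← mul_assoc 2]
                gcongr
                refine ofReal_le_two_mul ?_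
                rw [hz]
                nlinarith [hr x hx, hr y hy, ht.2,
                  mul_nonneg (sub_nonneg.2 ht.2) (hr x hx), mul_nonneg (sub_nonneg.2 h) (hr y hy)]
            _ ≤ ∫⁻ y, wt x * (2 * H ((1 - t) • x + t • y)) := setLIntegral_le_lintegral _ _
            _ ≤ wt x * (2 * (4 * ∫⁻ y, H y)) := by
                have hc : Measurable fun y => H ((1 - t) • x + t • y) :=
                  hHm.comp (by fun_prop : Continuous fun y : Pt => (1 - t) • x + t • y).measurable
                rw [lintegral_const_mul _ (hc.const_mul 2), lintegral_const_mul _ hc]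
                gcongr
                exact lintegral_comp_add_smul_le hHm _ h
      _ = _ := by
          rw [lintegral_mul_const _ measurable_wt, hHI]
          ring
  · rw [lintegral_prod_symm _ hF.aemeasurable]
    calc ∫⁻ y in A, ∫⁻ x in A, wt x * wt y * G (x + t • (y - x))
        ≤ ∫⁻ y in A, wt y * (2 * (4 * ∫⁻ x, H x)) := by
          refine setLIntegral_mono' hm fun y hy => ?_
          calc ∫⁻ x in A, wt x * wt y * G (x + t • (y - x))
              ≤ ∫⁻ x in A, wt y * (2 * H (t • y + (1 - t) • x)) := by
                refine setLIntegral_mono' hm fun x hx => ?_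
                have e : t • y + (1 - t) • x = x + t • (y - x) := by module
                rw [e, hH, indicator_of_mem (hmem hx hy), mul_comm (wt x), mul_assoc, ← mul_assoc 2]
                gcongr
                refine ofReal_le_two_mul ?_
                rw [hz]
                nlinarith [hr x hx, hr y hy, ht.1,
                  mul_nonneg ht.1.le (hr y hy), mul_nonneg (sub_nonneg.2 h) (hr x hx)]
            _ ≤ ∫⁻ x, wt y * (2 * H (t • y + (1 - t) • x)) := setLIntegral_le_lintegral _ _
            _ ≤ wt y * (2 * (4 * ∫⁻ x, H x)) := by
                have hc : Measurable fun x => H (t • y + (1 - t) • x) :=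
                  hHm.comp (by fun_prop : Continuous fun x : Pt => t • y + (1 - t) • x).measurable
                rw [lintegral_const_mul _ (hc.const_mul 2), lintegral_const_mul _ hc]
                gcongr
                exact lintegral_comp_add_smul_le hHm _ (by linarith)
      _ = _ := by
          rw [lintegral_mul_const _ measurable_wt, hHI]
          ring

/-- The weighted double integral Poincaré inequality for smooth functions. -/
theorem poincare_smooth (hA : Convex ℝ A) (hm : MeasurableSet A) (hr : ∀ x ∈ A, 0 ≤ x 0)
    {d : ℝ} (hd : ∀ x ∈ A, ∀ y ∈ A, ‖y - x‖ ≤ d) {ψ : Pt → ℝ} (hψ : ContDiff ℝ ∞ ψ) :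
    ∫⁻ p, wt p.1 * wt p.2 * ‖ψ p.1 - ψ p.2‖ₑ ^ 2
        ∂((volume.restrict A).prod (volume.restrict A)) ≤
      ENNReal.ofReal d ^ 2 * (8 * (∫⁻ x in A, wt x) * ∫⁻ x in A, wt x * ‖grad ψ x‖ₑ ^ 2) := by
  have hG : Measurable fun z => ‖grad ψ z‖ₑ ^ 2 := (continuous_grad hψ).measurable.enorm.pow_const 2
  have hj : Measurable fun z : (Pt × Pt) × ℝ =>
      wt z.1.1 * wt z.1.2 * ‖grad ψ (z.1.1 + z.2 • (z.1.2 - z.1.1))‖ₑ ^ 2 := by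
    refine ((measurable_wt.comp (measurable_fst.comp measurable_fst)).mul
      (measurable_wt.comp (measurable_snd.comp measurable_fst))).mul (hG.comp ?_)
    exact (by fun_prop :
      Continuous fun z : (Pt × Pt) × ℝ => z.1.1 + z.2 • (z.1.2 - z.1.1)).measurable
  calc _ ≤ ∫⁻ p, ENNReal.ofReal d ^ 2 * (∫⁻ t in Ioc (0 : ℝ) 1,
        wt p.1 * wt p.2 * ‖grad ψ (p.1 + t • (p.2 - p.1))‖ₑ ^ 2)
        ∂((volume.restrict A).prod (volume.restrict A)) := by
        refine lintegral_mono_ae ?_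
        rw [Measure.prod_restrict]
        filter_upwards [ae_restrict_mem (hm.prod hm)] with p hp
        have hc : Measurable fun t : ℝ => ‖grad ψ (p.1 + t • (p.2 - p.1))‖ₑ ^ 2 :=
          hG.comp (by fun_prop : Continuous fun t : ℝ => p.1 + t • (p.2 - p.1)).measurable
        rw [lintegral_const_mul _ hc, mul_left_comm]
        gcongr
        exact enorm_sub_sq_le hψ (hd p.1 hp.1 p.2 hp.2)
    _ = ENNReal.ofReal d ^ 2 * ∫⁻ t in Ioc (0 : ℝ) 1, (∫⁻ p,
        wt p.1 * wt p.2 * ‖grad ψ (p.1 + t • (p.2 - p.1))‖ₑ ^ 2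
        ∂((volume.restrict A).prod (volume.restrict A))) := by
        rw [lintegral_const_mul _ hj.lintegral_prod_right', lintegral_lintegral_swap]
        exact hj.aemeasurable
    _ ≤ ENNReal.ofReal d ^ 2 * ∫⁻ t in Ioc (0 : ℝ) 1,
        8 * (∫⁻ x in A, wt x) * ∫⁻ x in A, wt x * ‖grad ψ x‖ₑ ^ 2 := by
        refine mul_le_mul_right ?_ _
        exact setLIntegral_mono' measurableSet_Ioc fun t ht => lintegral_pair_le hA hm hr hG ht
    _ = _ := by simp

end Poincare

/-! ### Mollification and the Poincaré inequality for weakly differentiable functions -/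

section Erosion

variable {U : Set Pt} {δ : ℝ}

/-- The points of `U` at distance at least `δ` from the complement. -/
def erosion (U : Set Pt) (δ : ℝ) : Set Pt := {x | Metric.ball x δ ⊆ U}

theorem erosion_subset (hδ : 0 < δ) : erosion U δ ⊆ U := fun _ hx => hx (Metric.mem_ball_self hδ)

theorem erosion_anti {δ' : ℝ} (h : δ ≤ δ') : erosion U δ' ⊆ erosion U δ :=
  fun _ hx => (Metric.ball_subset_ball h).trans hx

theorem isClosed_erosion : IsClosed (erosion U δ) := by
  refine isClosed_of_closure_subset fun x hx y hy => ?_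
  rw [Metric.mem_ball] at hy
  obtain ⟨z, hz, hxz⟩ := Metric.mem_closure_iff.1 hx (δ - dist y x) (by linarith)
  refine hz (Metric.mem_ball.2 ?_)
  linarith [dist_triangle y x z]

/-- Shifting both endpoints by one and the same small vector shifts their convex combination by that
vector. -/
theorem convex_erosion (hU : Convex ℝ U) : Convex ℝ (erosion U δ) := by
  intro x hx y hy a b ha hb hab z hz
  have hx' : x + (z - (a • x + b • y)) ∈ U := hx (by
    rw [Metric.mem_ball, dist_eq_norm] at *
    simpa using hz)
  have hy' : y + (z - (a • x + b • y)) ∈ U := hy (by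
    rw [Metric.mem_ball, dist_eq_norm] at *
    simpa using hz)
  have := hU hx' hy' ha hb hab
  convert this using 1
  have hb' : b = 1 - a := by linarith
  subst hb'
  module

theorem mem_erosion_of_dist {x y : Pt} (hx : x ∈ erosion U (2 * δ)) (h : dist y x ≤ δ) :
    y ∈ erosion U δ := by
  intro z hz
  refine hx (Metric.mem_ball.2 ?_)
  rw [Metric.mem_ball] at hz
  linarith [dist_triangle z y x]

theorem isCompact_erosion (hU : Bornology.IsBounded U) (hδ : 0 < δ) : IsCompact (erosion U δ) :=
  Metric.isCompact_of_isClosed_isBounded isClosed_erosion (hU.subset (erosion_subset hδ))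

end Erosion

section Mollifier

open scoped Convolution

variable {Ω U : Set Pt} {q : Pt → ℝ} {g : Pt → Pt} {δ : ℝ}

/-- Mollification of the restriction of `q` to the erosion of `U`. -/
def mollify (U : Set Pt) (δ : ℝ) (q : Pt → ℝ) (φ : ContDiffBump (0 : Pt)) : Pt → ℝ :=
  (φ.normed volume) ⋆[ContinuousLinearMap.lsmul ℝ ℝ, volume] ((erosion U δ).indicator q)

/-- Local integrability in `Ω` suffices because the erosion is compact. Truncating to it gives a
function on the whole plane that can be convolved. -/
theorem integrable_indicator_erosion {E : Type*} [NormedAddCommGroup E] {q : Pt → E}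
    (hq : LocallyIntegrableOn q Ω)
    (hU : Bornology.IsBounded U) (hUΩ : U ⊆ Ω) (hδ : 0 < δ) :
    Integrable ((erosion U δ).indicator q) :=
  (integrable_indicator_iff isClosed_erosion.measurableSet).2
    (hq.integrableOn_compact_subset ((erosion_subset hδ).trans hUΩ) (isCompact_erosion hU hδ))

theorem contDiff_mollify (hq : LocallyIntegrableOn q Ω) (hU : Bornology.IsBounded U)
    (hUΩ : U ⊆ Ω) (hδ : 0 < δ) (φ : ContDiffBump (0 : Pt)) :
    ContDiff ℝ ∞ (mollify U δ q φ) :=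
  φ.hasCompactSupport_normed.contDiff_convolution_left _ φ.contDiff_normed
    (integrable_indicator_erosion hq hU hUΩ hδ).locallyIntegrable

/-- The gradient of a mollified weakly differentiable function. -/
theorem grad_mollify (hw : IsWeakGrad Ω q g) (hU : Bornology.IsBounded U) (hUΩ : U ⊆ Ω)
    (hδ : 0 < δ) {φ : ContDiffBump (0 : Pt)} (hφ : φ.rOut ≤ δ) {x : Pt}
    (hx : x ∈ erosion U (2 * δ)) :
    grad (mollify U δ q φ) x =
      ∫ y, φ.normed volume (x - y) • (erosion U δ).indicator g y := by
  set f := φ.normed (volume : Measure Pt) with hf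
  have hfs : ContDiff ℝ ∞ f := φ.contDiff_normed
  have hfc : HasCompactSupport f := φ.hasCompactSupport_normed
  have hq := integrable_indicator_erosion hw.1 hU hUΩ hδ
  have hg := integrable_indicator_erosion hw.2.1 hU hUΩ hδ
  have hsupp : ∀ y, f (x - y) ≠ 0 → y ∈ erosion U δ := by
    intro y hy
    have h1 : x - y ∈ Function.support f := hy
    rw [hf, φ.support_normed_eq, Metric.mem_ball, dist_zero_right] at h1
    refine mem_erosion_of_dist hx ?_
    rw [dist_comm, dist_eq_norm]
    linarith
  -- For `x` at depth `2δ`, the reflected bump is supported in the compact erosion of depth `δ`. It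
  -- is therefore an admissible test function, and it does not see the truncation.
  set ζ : Pt → ℝ := fun y => f (x - y) with hζ
  have hζs : ContDiff ℝ ∞ ζ := hfs.comp (contDiff_const.sub contDiff_id)
  have hts : tsupport ζ ⊆ erosion U δ :=
    closure_minimal (fun y hy => hsupp y hy) isClosed_erosion
  have hζc : HasCompactSupport ζ :=
    (isCompact_erosion hU hδ).of_isClosed_subset (isClosed_tsupport _) hts
  have hζΩ : tsupport ζ ⊆ Ω := (hts.trans (erosion_subset hδ)).trans hUΩ
  have hζd : ∀ y w, fderiv ℝ ζ y w = -fderiv ℝ f (x - y) w := by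
    intro y w
    have h1 : HasFDerivAt (fun y : Pt => x - y) (-ContinuousLinearMap.id ℝ Pt) y :=
      (hasFDerivAt_id y).const_sub x
    have h2 := ((hfs.differentiable (by simp) (x - y)).hasFDerivAt.comp y h1).fderiv
    have h3 : fderiv ℝ ζ y = _ := h2
    rw [h3]
    simp
  have hd := hfc.hasFDerivAt_convolution_left (ContinuousLinearMap.lsmul ℝ ℝ) (hfs.of_le (by simp))
    hq.locallyIntegrable x
  have hgint : Integrable fun y => ζ y • (erosion U δ).indicator g y :=
    hg.locallyIntegrable.integrable_smul_left_of_hasCompactSupport hζs.continuous hζc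
  ext i
  set e : Pt := EuclideanSpace.single i 1 with he
  rw [grad_apply]
  have hd' : HasFDerivAt (mollify U δ q φ) _ x := hd
  rw [hd'.fderiv]
  have hex : ConvolutionExistsAt (fderiv ℝ f) ((erosion U δ).indicator q) x
      (ContinuousLinearMap.precompL Pt (ContinuousLinearMap.lsmul ℝ ℝ)) volume :=
    (hfc.fderiv ℝ).convolutionExists_left _ (hfs.continuous_fderiv (by simp))
      hq.locallyIntegrable x
  rw [convolution_def, ContinuousLinearMap.integral_apply hex]
  have s1 : ∫ t, (ContinuousLinearMap.precompL Pt (ContinuousLinearMap.lsmul ℝ ℝ)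
      (fderiv ℝ f t) ((erosion U δ).indicator q (x - t))) e =
      ∫ y, fderiv ℝ f (x - y) e * (erosion U δ).indicator q y := by
    rw [← integral_sub_left_eq_self _ volume x]
    refine integral_congr_ae (Filter.Eventually.of_forall fun t => ?_)
    simp
  have s2 : ∫ y, fderiv ℝ f (x - y) e * (erosion U δ).indicator q y =
      -∫ y in Ω, q y * fderiv ℝ ζ y e := by
    rw [setIntegral_eq_integral_of_forall_compl_eq_zero, ← integral_neg]
    · refine integral_congr_ae (Filter.Eventually.of_forall fun y => ?_)
      simp only [hζd]
      by_cases hy : y ∈ erosion U δ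
      · rw [indicator_of_mem hy]
        ring
      · have : fderiv ℝ ζ y e = 0 := image_eq_zero_of_notMem_tsupport
          (f := fun y => fderiv ℝ ζ y e) fun h => hy (hts (tsupport_fderiv_apply_subset_self ζ e h))
        rw [hζd, neg_eq_zero] at this
        simp [this]
    · intro y hy
      have : fderiv ℝ ζ y e = 0 := image_eq_zero_of_notMem_tsupport
          (f := fun y => fderiv ℝ ζ y e) fun h => hy (hζΩ (tsupport_fderiv_apply_subset_self ζ e h))
      simp [this]
  rw [s1, s2, hw.2.2 ζ hζs hζc hζΩ i, neg_neg]
  have s3 : (∫ y, ζ y • (erosion U δ).indicator g y) i =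
      ∫ y, (ζ y • (erosion U δ).indicator g y) i :=
    ((EuclideanSpace.proj (𝕜 := ℝ) i).integral_comp_comm hgint).symm
  rw [s3, setIntegral_eq_integral_of_forall_compl_eq_zero]
  · refine integral_congr_ae (Filter.Eventually.of_forall fun y => ?_)
    by_cases hy : y ∈ erosion U δ
    · simp [hy, mul_comm]
    · have : ζ y = 0 := by
        by_contra h
        exact hy (hsupp y h)
      simp [this]
  · intro y hy
    have : ζ y = 0 := by
      by_contra h
      exact hy (hUΩ (erosion_subset hδ (hsupp y h)))
    simp [this]

theorem lintegral_normed (φ : ContDiffBump (0 : Pt)) (x : Pt) :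
    ∫⁻ y, ENNReal.ofReal (φ.normed volume (x - y)) = 1 := by
  rw [← ofReal_integral_eq_lintegral_ofReal]
  · rw [integral_sub_left_eq_self (fun y => φ.normed volume y) volume x, φ.integral_normed,
      ENNReal.ofReal_one]
  · exact (φ.integrable_normed (μ := volume)).comp_sub_left x
  · exact Filter.Eventually.of_forall fun y => φ.nonneg_normed _

/-- Jensen's inequality for the probability measure whose density is the bump centred at `x`. -/
theorem enorm_integral_normed_sq_le (φ : ContDiffBump (0 : Pt)) {g : Pt → Pt}
    (hg : AEStronglyMeasurable g) (x : Pt) :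
    ‖∫ y, φ.normed volume (x - y) • g y‖ₑ ^ 2 ≤
      ∫⁻ y, ENNReal.ofReal (φ.normed volume (x - y)) * ‖g y‖ₑ ^ 2 := by
  have hc : Measurable fun y => ENNReal.ofReal (φ.normed (volume : Measure Pt) (x - y)) :=
    (φ.continuous_normed.measurable.comp (measurable_const_sub x)).ennreal_ofReal
  set μ := (volume : Measure Pt).withDensity
    fun y => ENNReal.ofReal (φ.normed volume (x - y)) with hμ
  have hwd : ∀ h : Pt → ℝ≥0∞, ∫⁻ y, h y ∂μ =
      ∫⁻ y, ENNReal.ofReal (φ.normed volume (x - y)) * h y := fun h => by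
    rw [hμ, lintegral_withDensity_eq_lintegral_mul_non_measurable _ hc]
    · rfl
    · exact Filter.Eventually.of_forall fun _ => ENNReal.ofReal_lt_top
  have h1 : ‖∫ y, φ.normed volume (x - y) • g y‖ₑ ≤ ∫⁻ y, ‖g y‖ₑ ∂μ := by
    rw [hwd]
    refine (enorm_integral_le_lintegral_enorm _).trans_eq (lintegral_congr fun y => ?_)
    rw [enorm_smul, Real.enorm_eq_ofReal (φ.nonneg_normed _)]
  have hgm : AEMeasurable (fun y => ‖g y‖ₑ) μ :=
    (hg.mono_ac (withDensity_absolutelyContinuous _ _)).enorm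
  refine (pow_le_pow_left' h1 2).trans ((sq_lintegral_le hgm).trans_eq ?_)
  have : μ univ = 1 := by
    rw [hμ, withDensity_apply _ MeasurableSet.univ, Measure.restrict_univ, lintegral_normed]
  rw [this, one_mul, hwd]

/-- The point `x + 2 (y - x)`, the reflection of `x` in `y`, still lies in `U` and has positive
radius `2 r(y) - r(x)`. So mollification costs only a factor 2 in the weight, even near the axis. -/
theorem radius_le_of_dist (hr : ∀ x ∈ U, 0 < x 0) {x y : Pt} (hx : x ∈ erosion U (2 * δ))
    (h : dist y x < δ) : x 0 ≤ 2 * y 0 := by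
  have : x + (2 : ℝ) • (y - x) ∈ U := hx (by
    rw [Metric.mem_ball, dist_eq_norm, add_sub_cancel_left, norm_smul, ← dist_eq_norm]
    norm_num
    exact h)
  have h2 := hr _ this
  simp at h2
  linarith

theorem lintegral_grad_mollify_le (hw : IsWeakGrad Ω q g)
    (hUo : IsOpen U) (hU : Bornology.IsBounded U)
    (hUΩ : U ⊆ Ω) (hr : ∀ x ∈ U, 0 < x 0)
    (hδ : 0 < δ) {φ : ContDiffBump (0 : Pt)} (hφ : φ.rOut ≤ δ) :
    ∫⁻ x in erosion U (2 * δ), wt x * ‖grad (mollify U δ q φ) x‖ₑ ^ 2 ≤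
      2 * ∫⁻ x in U, wt x * ‖g x‖ₑ ^ 2 := by
  set f := φ.normed (volume : Measure Pt) with hf
  set G := (erosion U δ).indicator g with hG
  have hgi := integrable_indicator_erosion hw.2.1 hU hUΩ hδ
  -- Exchanging the integrals needs joint measurability, hence the strongly measurable
  -- representative.
  obtain ⟨G', hG'm, hGG'⟩ := hgi.1
  have hjm : Measurable fun z : Pt × Pt =>
      ENNReal.ofReal (f (z.1 - z.2)) * (2 * (wt z.2 * ‖G' z.2‖ₑ ^ 2)) := by
    refine Measurable.mul ?_ (((measurable_wt.comp measurable_snd).mul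
      ((hG'm.measurable.comp measurable_snd).enorm.pow_const 2)).const_mul 2)
    exact (φ.continuous_normed.measurable.comp
      (measurable_fst.sub measurable_snd)).ennreal_ofReal
  calc ∫⁻ x in erosion U (2 * δ), wt x * ‖grad (mollify U δ q φ) x‖ₑ ^ 2
      ≤ ∫⁻ x in erosion U (2 * δ), ∫⁻ y,
          ENNReal.ofReal (f (x - y)) * (2 * (wt y * ‖G' y‖ₑ ^ 2)) := by
        refine setLIntegral_mono' isClosed_erosion.measurableSet fun x hx => ?_
        rw [grad_mollify hw hU hUΩ hδ hφ hx]
        calc wt x * ‖∫ y, f (x - y) • G y‖ₑ ^ 2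
            ≤ wt x * ∫⁻ y, ENNReal.ofReal (f (x - y)) * ‖G y‖ₑ ^ 2 :=
              mul_le_mul_right (enorm_integral_normed_sq_le φ hgi.1 x) _
          _ = wt x * ∫⁻ y, ENNReal.ofReal (f (x - y)) * ‖G' y‖ₑ ^ 2 := by
              congr 1
              refine lintegral_congr_ae ?_
              filter_upwards [hGG'] with y hy
              rw [hG, hy]
          _ = ∫⁻ y, wt x * (ENNReal.ofReal (f (x - y)) * ‖G' y‖ₑ ^ 2) := by
              exact (lintegral_const_mul' _ _ ENNReal.ofReal_ne_top).symm
          _ ≤ _ := by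
              refine lintegral_mono fun y => ?_
              by_cases h0 : f (x - y) = 0
              · simp [h0]
              · have h1 : x - y ∈ Function.support f := h0
                rw [hf, φ.support_normed_eq, Metric.mem_ball, dist_zero_right, ← dist_eq_norm,
                  dist_comm] at h1
                have h2 := radius_le_of_dist hr hx (h1.trans_le hφ)
                have h3 : wt x ≤ 2 * wt y := ofReal_le_two_mul h2
                calc _ ≤ (2 * wt y) * (ENNReal.ofReal (f (x - y)) * ‖G' y‖ₑ ^ 2) := by gcongr
                  _ = _ := by ring
    _ ≤ ∫⁻ x, ∫⁻ y, ENNReal.ofReal (f (x - y)) * (2 * (wt y * ‖G' y‖ₑ ^ 2)) :=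
        setLIntegral_le_lintegral _ _
    _ = ∫⁻ y, ∫⁻ x, ENNReal.ofReal (f (x - y)) * (2 * (wt y * ‖G' y‖ₑ ^ 2)) :=
        lintegral_lintegral_swap hjm.aemeasurable
    _ = ∫⁻ y, 2 * (wt y * ‖G' y‖ₑ ^ 2) := by
        refine lintegral_congr fun y => ?_
        have hc : Measurable fun x => ENNReal.ofReal (f (x - y)) :=
          (φ.continuous_normed.measurable.comp (measurable_sub_const y)).ennreal_ofReal
        rw [lintegral_mul_const _ hc]
        have : ∫⁻ x, ENNReal.ofReal (f (x - y)) = 1 := by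
          rw [lintegral_sub_right_eq_self (fun x => ENNReal.ofReal (f x)) y]
          have := lintegral_normed φ 0
          rw [lintegral_sub_left_eq_self (fun x => ENNReal.ofReal (f x)) 0] at this
          exact this
        rw [this, one_mul]
    _ = 2 * ∫⁻ y, wt y * ‖G y‖ₑ ^ 2 := by
        rw [lintegral_const_mul' _ _ (by norm_num)]
        congr 1
        refine lintegral_congr_ae ?_
        filter_upwards [hGG'] with y hy
        rw [hG, hy]
    _ ≤ 2 * ∫⁻ x in U, wt x * ‖g x‖ₑ ^ 2 := by
        refine mul_le_mul_right ?_ _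
        rw [← lintegral_indicator hUo.measurableSet]
        refine lintegral_mono fun y => ?_
        by_cases hy : y ∈ erosion U δ
        · rw [indicator_of_mem (erosion_subset hδ hy), hG, indicator_of_mem hy]
        · simp [hG, hy]

end Mollifier

/-! ### Weighted Poincaré inequality for weak gradients, and approximation by means -/

section ConvexPoincare

open Filter

variable {Ω U : Set Pt} {q : Pt → ℝ} {g : Pt → Pt} {δ d : ℝ}

theorem lintegral_le_of_ae_tendsto {α : Type*} [MeasurableSpace α] {μ : Measure α}
    {F : ℕ → α → ℝ≥0∞} {f : α → ℝ≥0∞} (hF : ∀ n, AEMeasurable (F n) μ)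
    (h : ∀ᵐ x ∂μ, Tendsto (fun n => F n x) atTop (nhds (f x))) {B : ℝ≥0∞}
    (hB : ∀ n, ∫⁻ x, F n x ∂μ ≤ B) : ∫⁻ x, f x ∂μ ≤ B := by
  calc ∫⁻ x, f x ∂μ = ∫⁻ x, liminf (fun n => F n x) atTop ∂μ := by
        refine lintegral_congr_ae ?_
        filter_upwards [h] with x hx using hx.liminf_eq.symm
    _ ≤ liminf (fun n => ∫⁻ x, F n x ∂μ) atTop := lintegral_liminf_le' hF
    _ ≤ liminf (fun _ : ℕ => B) atTop := liminf_le_liminf (Eventually.of_forall hB)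
    _ = B := liminf_const B

theorem measurable_pair {ψ : Pt → ℝ} (hψ : Measurable ψ) :
    Measurable fun p : Pt × Pt => wt p.1 * wt p.2 * ‖ψ p.1 - ψ p.2‖ₑ ^ 2 :=
  ((measurable_wt.comp measurable_fst).mul (measurable_wt.comp measurable_snd)).mul
    (((hψ.comp measurable_fst).sub (hψ.comp measurable_snd)).enorm.pow_const 2)

theorem aemeasurable_pair {μ : Measure Pt} [SFinite μ] {ψ : Pt → ℝ} (hψ : AEMeasurable ψ μ) :
    AEMeasurable (fun p : Pt × Pt => wt p.1 * wt p.2 * ‖ψ p.1 - ψ p.2‖ₑ ^ 2) (μ.prod μ) :=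
  ((measurable_wt.comp measurable_fst).mul (measurable_wt.comp measurable_snd)).aemeasurable.mul
    (((hψ.comp_quasiMeasurePreserving Measure.quasiMeasurePreserving_fst).sub
      (hψ.comp_quasiMeasurePreserving Measure.quasiMeasurePreserving_snd)).enorm.pow_const 2)

theorem poincare_erosion (hw : IsWeakGrad Ω q g) (hUo : IsOpen U)
    (hUc : Convex ℝ U) (hU : Bornology.IsBounded U) (hUΩ : U ⊆ Ω) (hr : ∀ x ∈ U, 0 < x 0)
    (hd : ∀ x ∈ U, ∀ y ∈ U, ‖y - x‖ ≤ d) (hδ : 0 < δ) :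
    ∫⁻ p, wt p.1 * wt p.2 * ‖q p.1 - q p.2‖ₑ ^ 2
        ∂((volume.restrict (erosion U (2 * δ))).prod (volume.restrict (erosion U (2 * δ)))) ≤
      ENNReal.ofReal d ^ 2 * (8 * (∫⁻ x in U, wt x) * (2 * ∫⁻ x in U, wt x * ‖g x‖ₑ ^ 2)) := by
  set A := erosion U (2 * δ) with hA
  have hAU : A ⊆ U := erosion_subset (by positivity)
  have hAm : MeasurableSet A := isClosed_erosion.measurableSet
  -- The supports shrink to a point while the ratio of the two radii stays 2. This is what the
  -- almost everywhere convergence of mollifications requires.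
  let φ : ℕ → ContDiffBump (0 : Pt) := fun n =>
    { rIn := δ / (n + 1) / 2, rOut := δ / (n + 1), rIn_pos := by positivity,
      rIn_lt_rOut := half_lt_self (by positivity) }
  have hφδ : ∀ n, (φ n).rOut ≤ δ := fun n => by
    refine div_le_self hδ.le ?_
    have : (0 : ℝ) ≤ n := n.cast_nonneg
    linarith
  have hφ0 : Tendsto (fun n => (φ n).rOut) atTop (nhds 0) :=
    tendsto_const_div_atTop_nhds_zero_nat δ |>.comp (tendsto_add_atTop_nat 1) |>.congr fun n => by
      simp [φ]
  have hsm : ∀ n, ContDiff ℝ ∞ (mollify U δ q (φ n)) := fun n =>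
    contDiff_mollify hw.1 hU hUΩ hδ (φ n)
  refine lintegral_le_of_ae_tendsto (F := fun n p => wt p.1 * wt p.2 *
    ‖mollify U δ q (φ n) p.1 - mollify U δ q (φ n) p.2‖ₑ ^ 2)
    (fun n => (measurable_pair (hsm n).continuous.measurable).aemeasurable) ?_ fun n => ?_
  · have hae : ∀ᵐ x ∂(volume.restrict A),
        Tendsto (fun n => mollify U δ q (φ n) x) atTop (nhds (q x)) := by
      have := ContDiffBump.ae_convolution_tendsto_right_of_locallyIntegrable (μ := volume)
        (φ := φ) (K := 2) hφ0 (Eventually.of_forall fun n => by simp [φ]; linarith)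
        (integrable_indicator_erosion hw.1 hU hUΩ hδ).locallyIntegrable
      filter_upwards [ae_restrict_of_ae this, ae_restrict_mem hAm] with x hx hxA
      have hx2 : x ∈ erosion U δ := erosion_anti (by linarith) hxA
      rw [indicator_of_mem hx2] at hx
      exact hx
    filter_upwards [Measure.quasiMeasurePreserving_fst.ae hae,
      Measure.quasiMeasurePreserving_snd.ae hae] with p h1 h2
    refine ENNReal.Tendsto.const_mul ?_ (Or.inr ?_)
    · exact ((ENNReal.continuous_pow 2).comp continuous_enorm).continuousAt.tendsto.comp (h1.sub h2)
    · exact ENNReal.mul_ne_top ENNReal.ofReal_ne_top ENNReal.ofReal_ne_top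
  · refine (poincare_smooth (convex_erosion hUc) hAm (fun x hx => (hr x (hAU hx)).le)
      (fun x hx y hy => hd x (hAU hx) y (hAU hy)) (hsm n)).trans ?_
    gcongr ?_ * (8 * ?_ * ?_)
    · exact le_rfl
    · exact lintegral_mono_set hAU
    · exact lintegral_grad_mollify_le hw hUo hU hUΩ hr hδ (hφδ n)

/-- The bound on the erosions does not involve `δ`. They exhaust the open set `U` as `δ → 0`, so
Fatou's lemma passes it on to `U`. -/
theorem poincare_weak (hw : IsWeakGrad Ω q g) (hUo : IsOpen U)
    (hUc : Convex ℝ U) (hU : Bornology.IsBounded U) (hUΩ : U ⊆ Ω) (hr : ∀ x ∈ U, 0 < x 0)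
    (hd : ∀ x ∈ U, ∀ y ∈ U, ‖y - x‖ ≤ d) :
    ∫⁻ p, wt p.1 * wt p.2 * ‖q p.1 - q p.2‖ₑ ^ 2
        ∂((volume.restrict U).prod (volume.restrict U)) ≤
      ENNReal.ofReal d ^ 2 * (8 * (∫⁻ x in U, wt x) * (2 * ∫⁻ x in U, wt x * ‖g x‖ₑ ^ 2)) := by
  let δ : ℕ → ℝ := fun n => 1 / ((n : ℝ) + 1)
  have hδ : ∀ n, 0 < δ n := fun n => by positivity
  let E : ℕ → Set Pt := fun n => erosion U (2 * δ n)
  have hEm : ∀ n, MeasurableSet (E n) := fun n => isClosed_erosion.measurableSet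
  have hEU : ∀ n, E n ⊆ U := fun n => erosion_subset (mul_pos two_pos (hδ n))
  have hq : AEMeasurable q (volume.restrict U) :=
    (hw.1.aestronglyMeasurable.mono_measure (Measure.restrict_mono hUΩ le_rfl)).aemeasurable
  have hmem : ∀ x ∈ U, ∀ᶠ n in atTop, x ∈ E n := by
    intro x hx
    obtain ⟨ε, hε, hb⟩ := Metric.isOpen_iff.1 hUo x hx
    have hl : Tendsto (fun n => 2 * δ n) atTop (nhds 0) := by
      simpa only [mul_zero] using (tendsto_one_div_add_atTop_nhds_zero_nat (𝕜 := ℝ)).const_mul 2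
    filter_upwards [hl.eventually_lt_const hε] with n hn
    exact (Metric.ball_subset_ball hn.le).trans hb
  refine lintegral_le_of_ae_tendsto (F := fun n => (E n ×ˢ E n).indicator fun p =>
    wt p.1 * wt p.2 * ‖q p.1 - q p.2‖ₑ ^ 2)
    (fun n => (aemeasurable_pair hq).indicator ((hEm n).prod (hEm n))) ?_ fun n => ?_
  · rw [Measure.prod_restrict]
    filter_upwards [ae_restrict_mem (hUo.measurableSet.prod hUo.measurableSet)] with p hp
    refine tendsto_const_nhds.congr' ?_
    filter_upwards [hmem p.1 hp.1, hmem p.2 hp.2] with n h1 h2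
    have h3 : p ∈ E n ×ˢ E n := ⟨h1, h2⟩
    rw [indicator_of_mem h3]
  · rw [lintegral_indicator ((hEm n).prod (hEm n)), Measure.prod_restrict,
      Measure.restrict_restrict ((hEm n).prod (hEm n)),
      inter_eq_self_of_subset_left (prod_mono (hEU n) (hEU n)), ← Measure.prod_restrict]
    exact poincare_erosion hw hUo hUc hU hUΩ hr hd (hδ n)

theorem lintegral_wMeas_one (U : Set Pt) (h : Pt → ℝ≥0∞) :
    ∫⁻ x, h x ∂wMeas U 1 = ∫⁻ x in U, wt x * h x := by
  rw [lintegral_wMeas]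
  simp only [zpow_one, wt]

theorem wMeas_one_univ (U : Set Pt) : wMeas U 1 univ = ∫⁻ x in U, wt x := by
  rw [← lintegral_one, lintegral_wMeas_one]
  simp

theorem wMeas_one_univ_ne_zero (hUo : IsOpen U) (hr : ∀ x ∈ U, 0 < x 0) (hne : U.Nonempty) :
    wMeas U 1 univ ≠ 0 := by
  rw [wMeas_one_univ, ← pos_iff_ne_zero, setLIntegral_pos_iff measurable_wt]
  have : Function.support wt ∩ U = U := by
    refine inter_eq_self_of_subset_right fun x hx => ?_
    simpa [wt] using hr x hx
  rw [this]
  exact hUo.measure_pos _ hne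

theorem wMeas_one_univ_ne_top (hU : Bornology.IsBounded U) : wMeas U 1 univ ≠ ⊤ := by
  obtain ⟨R, -, hb⟩ := hU.exists_pos_norm_le
  rw [wMeas_one_univ]
  refine ((setLIntegral_mono (measurable_const (a := ENNReal.ofReal R)) fun x hx => ?_).trans_lt
    ?_).ne
  · exact ENNReal.ofReal_le_ofReal (((le_abs_self _).trans (PiLp.norm_apply_le x 0)).trans (hb x hx))
  · rw [setLIntegral_const]
    exact ENNReal.mul_lt_top ENNReal.ofReal_lt_top hU.measure_lt_top

/-- The weighted Poincaré inequality on convex sets, with a constant depending only on the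
diameter. -/
theorem exists_const_poincare (hw : IsWeakGrad Ω q g) (hUo : IsOpen U)
    (hUc : Convex ℝ U) (hU : Bornology.IsBounded U) (hUΩ : U ⊆ Ω) (hr : ∀ x ∈ U, 0 < x 0)
    (hne : U.Nonempty) (hd : ∀ x ∈ U, ∀ y ∈ U, ‖y - x‖ ≤ d) :
    ∃ c : ℝ, ∫⁻ x, ‖q x - c‖ₑ ^ 2 ∂wMeas U 1 ≤
      16 * ENNReal.ofReal d ^ 2 * ∫⁻ x, ‖g x‖ₑ ^ 2 ∂wMeas U 1 := by
  have hm0 := wMeas_one_univ_ne_zero hUo hr hne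
  have hmt := wMeas_one_univ_ne_top hU
  have hq : AEMeasurable q (volume.restrict U) :=
    (hw.1.aestronglyMeasurable.mono_measure (Measure.restrict_mono hUΩ le_rfl)).aemeasurable
  have hqw : AEMeasurable q (wMeas U 1) := hq.mono_ac (wMeas_ac U 1)
  have : IsFiniteMeasure (wMeas U 1) := ⟨lt_top_iff_ne_top.2 hmt⟩
  have key := poincare_weak hw hUo hUc hU hUΩ hr hd
  rw [lintegral_prod _ (aemeasurable_pair hq)] at key
  have e : ∫⁻ x, (∫⁻ y, ‖q x - q y‖ₑ ^ 2 ∂wMeas U 1) ∂wMeas U 1 =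
      ∫⁻ x in U, ∫⁻ y in U, wt x * wt y * ‖q x - q y‖ₑ ^ 2 := by
    rw [lintegral_wMeas_one]
    refine lintegral_congr fun x => ?_
    rw [lintegral_wMeas_one, ← lintegral_const_mul' (wt x) _ ENNReal.ofReal_ne_top]
    simp only [mul_assoc]
  have hmeas : AEMeasurable (fun x => ∫⁻ y, ‖q x - q y‖ₑ ^ 2 ∂wMeas U 1) (wMeas U 1) :=
    AEMeasurable.lintegral_prod_right' (f := fun p : Pt × Pt => ‖q p.1 - q p.2‖ₑ ^ 2)
      (((hqw.comp_quasiMeasurePreserving Measure.quasiMeasurePreserving_fst).sub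
        (hqw.comp_quasiMeasurePreserving Measure.quasiMeasurePreserving_snd)).enorm.pow_const 2)
  -- Some `x` does no worse than the average over `x` of `∫ |q(x) - q(y)|²`, and `q x` serves as the
  -- constant. The factor is `16 = 8 · 2`, from the segments and the mollification.
  obtain ⟨x, hx⟩ := exists_le_laverage (fun h => hm0 (by simp [h])) hmeas
  refine ⟨q x, ?_⟩
  rw [laverage_eq, e] at hx
  have hsymm : ∫⁻ y, ‖q y - q x‖ₑ ^ 2 ∂wMeas U 1 = ∫⁻ y, ‖q x - q y‖ₑ ^ 2 ∂wMeas U 1 := by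
    refine lintegral_congr fun y => ?_
    rw [← enorm_neg, neg_sub]
  rw [hsymm]
  refine hx.trans (ENNReal.div_le_of_le_mul (key.trans_eq ?_))
  rw [lintegral_wMeas_one, wMeas_one_univ]
  ring

theorem ennreal_add_sq_le (a b : ℝ≥0∞) : (a + b) ^ 2 ≤ 2 * (a ^ 2 + b ^ 2) := by
  have := ENNReal.rpow_add_le_mul_rpow_add_rpow a b (p := 2) (by norm_num)
  norm_num at this
  exact this

/-- The mean differs from `c` by the mean of `q - c`, which Jensen's inequality bounds. The factor 4
comes from the triangle inequality; orthogonality would give 1. -/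
theorem lintegral_sub_average_le {α : Type*} [MeasurableSpace α] {μ : Measure α}
    [IsFiniteMeasure μ] [NeZero μ] {q : α → ℝ} (hq : Integrable q μ) (c : ℝ) :
    ∫⁻ x, ‖q x - ⨍ y, q y ∂μ‖ₑ ^ 2 ∂μ ≤ 4 * ∫⁻ x, ‖q x - c‖ₑ ^ 2 ∂μ := by
  have hm0 : μ univ ≠ 0 := by simpa using NeZero.ne μ
  have hmt : μ univ ≠ ⊤ := measure_ne_top μ univ
  set B := ∫⁻ x, ‖q x - c‖ₑ ^ 2 ∂μ with hB
  have hcm : AEMeasurable (fun x => ‖q x - c‖ₑ) μ := (hq.1.sub aestronglyMeasurable_const).enorm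
  have h1 : ‖⨍ y, q y ∂μ - c‖ₑ ≤ (μ univ)⁻¹ * ∫⁻ x, ‖q x - c‖ₑ ∂μ := by
    have e : ⨍ y, q y ∂μ - c = ⨍ y, (q y - c) ∂μ := by
      rw [average_eq, average_eq, integral_sub hq (integrable_const c), integral_const, smul_sub,
        smul_smul, inv_mul_cancel₀, one_smul]
      exact (ENNReal.toReal_pos hm0 hmt).ne'
    rw [e, average_eq, enorm_smul]
    gcongr
    · rw [Real.enorm_eq_ofReal (by positivity), ENNReal.ofReal_inv_of_pos
        (by rw [measureReal_def]; exact ENNReal.toReal_pos hm0 hmt), measureReal_def, ENNReal.ofReal_toReal hmt]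
    · exact enorm_integral_le_lintegral_enorm _
  have h2 : ‖⨍ y, q y ∂μ - c‖ₑ ^ 2 * μ univ ≤ B := by
    calc _ ≤ ((μ univ)⁻¹ * ∫⁻ x, ‖q x - c‖ₑ ∂μ) ^ 2 * μ univ := by gcongr
      _ = (μ univ)⁻¹ ^ 2 * μ univ * (∫⁻ x, ‖q x - c‖ₑ ∂μ) ^ 2 := by ring
      _ ≤ (μ univ)⁻¹ ^ 2 * μ univ * (μ univ * B) := by
          gcongr
          exact sq_lintegral_le hcm
      _ = ((μ univ)⁻¹ * μ univ) * ((μ univ)⁻¹ * μ univ) * B := by ring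
      _ = B := by rw [ENNReal.inv_mul_cancel hm0 hmt]; simp
  calc ∫⁻ x, ‖q x - ⨍ y, q y ∂μ‖ₑ ^ 2 ∂μ
      ≤ ∫⁻ x, 2 * (‖q x - c‖ₑ ^ 2 + ‖⨍ y, q y ∂μ - c‖ₑ ^ 2) ∂μ := by
        refine lintegral_mono fun x => ?_
        refine (pow_le_pow_left' ?_ 2).trans (ennreal_add_sq_le _ _)
        have : q x - ⨍ y, q y ∂μ = (q x - c) - (⨍ y, q y ∂μ - c) := by ring
        rw [this]
        exact enorm_sub_le
    _ = 2 * (B + ‖⨍ y, q y ∂μ - c‖ₑ ^ 2 * μ univ) := by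
        rw [lintegral_const_mul' _ _ (by norm_num), lintegral_add_right _ measurable_const,
          lintegral_const]
    _ ≤ 2 * (B + B) := by gcongr
    _ = 4 * B := by ring

/-- Approximation by the weighted mean on a convex set. -/
theorem lintegral_sub_mean_le {q q₁ : Pt → ℝ} {g : Pt → Pt} (hw : IsWeakGrad Ω q₁ g)
    (hUo : IsOpen U) (hUc : Convex ℝ U) (hU : Bornology.IsBounded U) (hUΩ : U ⊆ Ω)
    (hr : ∀ x ∈ U, 0 < x 0) (hne : U.Nonempty) (hd : ∀ x ∈ U, ∀ y ∈ U, ‖y - x‖ ≤ d)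
    (hq : MemLp q 2 (wMeas U 1)) :
    ∫⁻ x, ‖q x - ⨍ y, q y ∂wMeas U 1‖ₑ ^ 2 ∂wMeas U 1 ≤
      8 * ∫⁻ x, ‖q x - q₁ x‖ₑ ^ 2 ∂wMeas U 1 +
        128 * ENNReal.ofReal d ^ 2 * ∫⁻ x, ‖g x‖ₑ ^ 2 ∂wMeas U 1 := by
  have : IsFiniteMeasure (wMeas U 1) := ⟨lt_top_iff_ne_top.2 (wMeas_one_univ_ne_top hU)⟩
  have : NeZero (wMeas U 1) := ⟨fun h => wMeas_one_univ_ne_zero hUo hr hne (by simp [h])⟩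
  obtain ⟨c, hc⟩ := exists_const_poincare hw hUo hUc hU hUΩ hr hne hd
  have hq₁ : AEStronglyMeasurable q₁ (wMeas U 1) :=
    (hw.1.aestronglyMeasurable.mono_measure (Measure.restrict_mono hUΩ le_rfl)).mono_ac
      (wMeas_ac U 1)
  refine (lintegral_sub_average_le (hq.integrable (by norm_num)) c).trans ?_
  -- Here `c` is the Poincaré constant of `q₁`, not of `q`. The factors are `8 = 4 · 2` and `128 = 8
  -- · 16`.
  calc 4 * ∫⁻ x, ‖q x - c‖ₑ ^ 2 ∂wMeas U 1
      ≤ 4 * ∫⁻ x, 2 * (‖q x - q₁ x‖ₑ ^ 2 + ‖q₁ x - c‖ₑ ^ 2) ∂wMeas U 1 := by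
        gcongr with x
        refine (pow_le_pow_left' ?_ 2).trans (ennreal_add_sq_le _ _)
        have : q x - c = (q x - q₁ x) + (q₁ x - c) := by ring
        rw [this]
        exact enorm_add_le _ _
    _ = 8 * ∫⁻ x, ‖q x - q₁ x‖ₑ ^ 2 ∂wMeas U 1 + 8 * ∫⁻ x, ‖q₁ x - c‖ₑ ^ 2 ∂wMeas U 1 := by
        rw [lintegral_const_mul' _ _ (by norm_num),
          lintegral_add_left' (f := fun x => ‖q x - q₁ x‖ₑ ^ 2) ((hq.1.sub hq₁).enorm.pow_const 2)]
        ring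
    _ ≤ _ := by
        gcongr ?_ + ?_
        · exact le_rfl
        · calc _ ≤ 8 * (16 * ENNReal.ofReal d ^ 2 * ∫⁻ x, ‖g x‖ₑ ^ 2 ∂wMeas U 1) := by gcongr
            _ = _ := by ring

end ConvexPoincare

/-! ### The triangles of the mesh and the piecewise weighted mean -/

section Mesh

variable {Ω : Set Pt} {K : Geometry.SimplicialComplex ℝ Pt}

/-- A Lipschitz domain is the interior of its closure. -/
theorem interior_closure_subset (hΩ : IsMeridianDomain Ω) : interior (closure Ω) ⊆ Ω := by
  intro x hx
  by_contra hn
  have hxc : x ∈ closure Ω := interior_subset hx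
  have hxf : x ∈ frontier Ω := ⟨hxc, fun h => hn (interior_subset h)⟩
  obtain ⟨e, γ, L, δ, hγ, hδ, h⟩ := hΩ.lipschitz x hxf
  have hc0 : Continuous fun y => γ (e y 0) :=
    hγ.continuous.comp ((by fun_prop : Continuous fun y : Pt => y 0).comp e.continuous)
  have hc1 : Continuous fun y => e y 1 :=
    (by fun_prop : Continuous fun y : Pt => y 1).comp e.continuous
  have hle : e x 1 ≤ γ (e x 0) := by
    by_contra hlt
    exact hn ((h x (Metric.mem_ball_self hδ)).2 (not_le.1 hlt))
  obtain ⟨ε, hε, hb⟩ := Metric.isOpen_iff.1 isOpen_interior x hx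
  set η := min δ ε / 2 with hη
  have hη0 : 0 < η := by positivity
  -- As `x ∉ Ω`, it lies on or below the graph. Moving further down gives a point strictly below it,
  -- which has a neighbourhood free of `Ω` and yet lies in `closure Ω`.
  set y : Pt := e.symm (e x - η • EuclideanSpace.single 1 1) with hy
  have hey : e y = e x - η • EuclideanSpace.single 1 1 := e.apply_symm_apply _
  have hdist : dist y x = η := by
    rw [← e.dist_map y x, hey, dist_eq_norm]
    simp [norm_smul, hη0.le]
  have hmin : η < min δ ε := half_lt_self (by positivity)
  have hyδ : y ∈ Metric.ball x δ := by
    rw [Metric.mem_ball, hdist]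
    exact hmin.trans_le (min_le_left _ _)
  have hyc : y ∈ closure Ω := interior_subset (hb (by
    rw [Metric.mem_ball, hdist]
    exact hmin.trans_le (min_le_right _ _)))
  have hlt : e y 1 < γ (e y 0) := by
    rw [hey]
    simp
    linarith
  have hopen : IsOpen ({z | e z 1 < γ (e z 0)} ∩ Metric.ball x δ) :=
    (isOpen_lt hc1 hc0).inter Metric.isOpen_ball
  obtain ⟨z, ⟨hz1, hz2⟩, hz3⟩ := mem_closure_iff.1 hyc _ hopen ⟨hlt, hyδ⟩
  exact lt_asymm hz1 ((h z hz2).1 hz3)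

/-- The open triangle with vertex set `T`. -/
def openTri (T : Finset Pt) : Set Pt := interior (convexHull ℝ (T : Set Pt))

theorem isOpen_openTri (T : Finset Pt) : IsOpen (openTri T) := isOpen_interior

theorem convex_openTri (T : Finset Pt) : Convex ℝ (openTri T) := (convex_convexHull ℝ _).interior

theorem isBounded_convexHull_finset (T : Finset Pt) :
    Bornology.IsBounded (convexHull ℝ (T : Set Pt)) :=
  isBounded_convexHull.2 T.finite_toSet.isBounded

theorem isBounded_openTri (T : Finset Pt) : Bornology.IsBounded (openTri T) :=
  (isBounded_convexHull_finset T).subset interior_subset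

theorem nonempty_interior_convexHull_iff {T : Finset Pt}
    (hT : AffineIndependent ℝ ((↑) : ↥(T : Set Pt) → Pt)) :
    (openTri T).Nonempty ↔ T.card = 3 := by
  have h := hT.affineSpan_eq_top_iff_card_eq_finrank_add_one
  rw [openTri, interior_convexHull_nonempty_iff_affineSpan_eq_top]
  rw [Subtype.range_coe, finrank_euclideanSpace_fin] at h
  rw [h]
  simp

theorem openTri_subset (hΩ : IsMeridianDomain Ω) (hK : IsTriangulation Ω K) {T : Finset Pt}
    (hT : T ∈ triangles K) : openTri T ⊆ Ω := by
  refine (interior_mono ?_).trans (interior_closure_subset hΩ)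
  rw [← hK.space_eq]
  exact K.convexHull_subset_space hT.1

theorem openTri_nonempty {T : Finset Pt} (hT : T ∈ triangles K) : (openTri T).Nonempty :=
  (nonempty_interior_convexHull_iff (K.indep hT.1)).2 hT.2

/-- An overlap would be an open subset of the hull of the common vertices, which then has interior
and so three vertices. Both triangles would coincide with it. -/
theorem openTri_disjoint {S T : Finset Pt} (hS : S ∈ triangles K) (hT : T ∈ triangles K)
    (hne : S ≠ T) : Disjoint (openTri S) (openTri T) := by
  classical
  rw [disjoint_iff_inter_eq_empty, ← not_nonempty_iff_eq_empty]
  intro h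
  have hsub : openTri S ∩ openTri T ⊆ openTri (S ∩ T) := by
    refine interior_maximal ?_ ((isOpen_openTri S).inter (isOpen_openTri T))
    rw [Finset.coe_inter]
    exact (inter_subset_inter interior_subset interior_subset).trans
      (K.inter_subset_convexHull hS.1 hT.1)
  have hind : AffineIndependent ℝ ((↑) : ↥((S ∩ T : Finset Pt) : Set Pt) → Pt) :=
    (K.indep hS.1).mono (by simp)
  have hcard := (nonempty_interior_convexHull_iff hind).1 (h.mono hsub)
  have h1 : S ∩ T = S := Finset.eq_of_subset_of_card_le Finset.inter_subset_left
    (by rw [hcard, hS.2])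
  have h2 : S ∩ T = T := Finset.eq_of_subset_of_card_le Finset.inter_subset_right
    (by rw [hcard, hT.2])
  exact hne (h1.symm.trans h2)

theorem triangles_finite (hK : IsTriangulation Ω K) : (triangles K).Finite :=
  hK.finite.subset fun _ h => h.1

theorem dist_le_meshSize (hK : IsTriangulation Ω K) {T : Finset Pt} (hT : T ∈ triangles K) :
    ∀ x ∈ openTri T, ∀ y ∈ openTri T, ‖y - x‖ ≤ meshSize K := by
  intro x hx y hy
  rw [← dist_eq_norm]
  refine (Metric.dist_le_diam_of_mem (isBounded_convexHull_finset T) (interior_subset hy)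
    (interior_subset hx)).trans ?_
  exact le_csSup ((triangles_finite hK).image _).bddAbove (mem_image_of_mem _ hT)

theorem subset_iUnion_convexHull (hK : IsTriangulation Ω K) :
    Ω ⊆ ⋃ T : triangles K, convexHull ℝ (T.1 : Set Pt) := by
  intro x hx
  have : x ∈ K.space := hK.space_eq ▸ subset_closure hx
  obtain ⟨s, hs, hxs⟩ := Geometry.SimplicialComplex.mem_space_iff.1 this
  obtain ⟨T, hT, hsT, hc⟩ := hK.pure s hs
  exact mem_iUnion.2 ⟨⟨T, hT, hc⟩, convexHull_mono (by exact_mod_cast hsT) hxs⟩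

theorem exists_triangle (hΩ : IsMeridianDomain Ω) (hK : IsTriangulation Ω K) :
    ∃ T, T ∈ triangles K := by
  obtain ⟨x, hx⟩ := hΩ.isConnected.nonempty
  obtain ⟨T, -⟩ := mem_iUnion.1 (subset_iUnion_convexHull hK hx)
  exact ⟨T.1, T.2⟩

theorem meshSize_pos (hΩ : IsMeridianDomain Ω) (hK : IsTriangulation Ω K) : 0 < meshSize K := by
  obtain ⟨T, hT⟩ := exists_triangle hΩ hK
  obtain ⟨x, hx⟩ := openTri_nonempty hT
  obtain ⟨ε, hε, hb⟩ := Metric.isOpen_iff.1 (isOpen_openTri T) x hx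
  have hy : x + (ε / 2) • EuclideanSpace.single 0 (1 : ℝ) ∈ openTri T := hb (by
    rw [Metric.mem_ball, dist_eq_norm, add_sub_cancel_left, norm_smul]
    simp [abs_of_pos hε]
    linarith)
  have := dist_le_meshSize hK hT x hx _ hy
  rw [add_sub_cancel_left, norm_smul] at this
  simp [abs_of_pos hε] at this
  linarith

/-- The triangles cover `Ω`, and the frontier of a convex set is a null set. -/
theorem ae_eq_iUnion_openTri (hΩ : IsMeridianDomain Ω) (hK : IsTriangulation Ω K) :
    Ω =ᵐ[volume] (⋃ T : triangles K, openTri T.1 : Set Pt) := by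
  have : Finite (triangles K) := (triangles_finite hK).to_subtype
  refine Filter.EventuallyLE.antisymm ?_
    (LE.le.eventuallyLE (iUnion_subset fun T => openTri_subset hΩ hK T.2))
  have hnull : ∀ᵐ x, ∀ T : triangles K, x ∉ frontier (convexHull ℝ (T.1 : Set Pt)) := by
    rw [ae_all_iff]
    intro T
    exact measure_eq_zero_iff_ae_notMem.1 ((convex_convexHull ℝ (T.1 : Set Pt)).addHaar_frontier _)
  filter_upwards [hnull] with x hx hxΩ
  obtain ⟨T, hT⟩ := mem_iUnion.1 (subset_iUnion_convexHull hK hxΩ)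
  refine mem_iUnion.2 ⟨T, ?_⟩
  by_contra hn
  exact hx T ⟨subset_closure hT, hn⟩

theorem wMeas_eq_sum (hΩ : IsMeridianDomain Ω) (hK : IsTriangulation Ω K) [Fintype (triangles K)]
    (k : ℤ) : wMeas Ω k = ∑ T : triangles K, wMeas (openTri T.1) k := by
  rw [wMeas, Measure.restrict_congr_set (ae_eq_iUnion_openTri hΩ hK), Measure.restrict_iUnion,
    withDensity_sum, Measure.sum_fintype]
  · rfl
  · intro S T hne
    exact openTri_disjoint S.2 T.2 fun h => hne (Subtype.ext h)
  · exact fun T => (isOpen_openTri T.1).measurableSet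

/-- The piecewise constant function of weighted means. -/
def meshMean (K : Geometry.SimplicialComplex ℝ Pt) [Fintype (triangles K)] (q : Pt → ℝ) (x : Pt) :
    ℝ :=
  ∑ T : triangles K, (openTri T.1).indicator (fun _ => ⨍ y, q y ∂wMeas (openTri T.1) 1) x

theorem meshMean_eq [Fintype (triangles K)] (q : Pt → ℝ) (T : triangles K) {x : Pt}
    (hx : x ∈ openTri T.1) : meshMean K q x = ⨍ y, q y ∂wMeas (openTri T.1) 1 := by
  rw [meshMean, Finset.sum_eq_single T, indicator_of_mem hx]
  · intro S _ hne
    refine indicator_of_notMem (fun hxS => ?_) _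
    exact (openTri_disjoint S.2 T.2 fun h => hne (Subtype.ext h)).le_bot ⟨hxS, hx⟩
  · simp

theorem ae_wMeas_mem {U : Set Pt} (hU : MeasurableSet U) (k : ℤ) : ∀ᵐ x ∂wMeas U k, x ∈ U :=
  (wMeas_ac U k).ae_le (ae_restrict_mem hU)

theorem wMeas_le_of_triangle (hΩ : IsMeridianDomain Ω) (hK : IsTriangulation Ω K)
    {T : Finset Pt} (hT : T ∈ triangles K) (k : ℤ) : wMeas (openTri T) k ≤ wMeas Ω k :=
  by
  refine Measure.le_iff.2 fun A hA => ?_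
  rw [wMeas, wMeas, withDensity_apply _ hA, withDensity_apply _ hA]
  exact lintegral_mono' (Measure.restrict_mono le_rfl
    (Measure.restrict_mono (openTri_subset hΩ hK hT) le_rfl)) le_rfl

theorem meshMean_memLp (hΩ : IsMeridianDomain Ω) [Fintype (triangles K)]
    (q : Pt → ℝ) : MemLp (meshMean K q) 2 (wMeas Ω 1) := by
  have hfin : IsFiniteMeasure (wMeas Ω 1) :=
    ⟨lt_top_iff_ne_top.2 (wMeas_one_univ_ne_top hΩ.isBounded)⟩
  refine memLp_finsetSum _ fun T _ => ?_
  exact (memLp_const _).indicator (isOpen_openTri T.1).measurableSet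

/-- Means with respect to `r dr dz` keep the weighted integral over each triangle, so the constraint
`∫ r q = 0` survives. -/
theorem meshMean_mem (hΩ : IsMeridianDomain Ω) (hK : IsTriangulation Ω K) [Fintype (triangles K)]
    {q : Pt → ℝ} (hq : q ∈ presSpace Ω) : meshMean K q ∈ presSpaceH Ω K := by
  have hfin : IsFiniteMeasure (wMeas Ω 1) :=
    ⟨lt_top_iff_ne_top.2 (wMeas_one_univ_ne_top hΩ.isBounded)⟩
  have hm := meshMean_memLp (K := K) hΩ q
  refine ⟨⟨hm, ?_⟩, fun T hT => ⟨_, fun x hx => meshMean_eq q ⟨T, hT⟩ hx⟩⟩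
  have hle := fun T : triangles K => wMeas_le_of_triangle hΩ hK T.2 1
  have hint : ∀ T : triangles K, Integrable q (wMeas (openTri T.1) 1) := fun T =>
    (hq.1.integrable (by norm_num)).mono_measure (hle T)
  have hint' : ∀ T : triangles K, Integrable (meshMean K q) (wMeas (openTri T.1) 1) := fun T =>
    (hm.integrable (by norm_num)).mono_measure (hle T)
  rw [← hq.2, wMeas_eq_sum hΩ hK, integral_finsetSum_measure fun T _ => hint T,
    integral_finsetSum_measure fun T _ => hint' T]
  refine Finset.sum_congr rfl fun T _ => ?_
  have hfinT : IsFiniteMeasure (wMeas (openTri T.1) 1) :=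
    ⟨lt_top_iff_ne_top.2 (wMeas_one_univ_ne_top (isBounded_openTri T.1))⟩
  have : meshMean K q =ᵐ[wMeas (openTri T.1) 1]
      fun _ => ⨍ y, q y ∂wMeas (openTri T.1) 1 := by
    filter_upwards [ae_wMeas_mem (isOpen_openTri T.1).measurableSet 1] with x hx
      using meshMean_eq q T hx
  rw [integral_congr_ae this, integral_average]

/-- Approximation by weighted means in `L²_1(Ω)`, with constants independent of the shape of the
triangles. -/
theorem lintegral_sub_meshMean_le (hΩ : IsMeridianDomain Ω) (hK : IsTriangulation Ω K)
    [Fintype (triangles K)] {q q₁ : Pt → ℝ} {g : Pt → Pt} (hq : MemLp q 2 (wMeas Ω 1))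
    (hw : IsWeakGrad Ω q₁ g) :
    eLpNorm (q - meshMean K q) 2 (wMeas Ω 1) ^ 2 ≤
      8 * eLpNorm (q - q₁) 2 (wMeas Ω 1) ^ 2 +
        128 * ENNReal.ofReal (meshSize K) ^ 2 * eLpNorm g 2 (wMeas Ω 1) ^ 2 := by
  simp only [eLpNorm_two_sq, Pi.sub_apply]
  rw [wMeas_eq_sum hΩ hK, lintegral_finsetSum_measure, lintegral_finsetSum_measure,
    lintegral_finsetSum_measure, Finset.mul_sum, Finset.mul_sum, ← Finset.sum_add_distrib]
  refine Finset.sum_le_sum fun T _ => ?_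
  have hsub := openTri_subset hΩ hK T.2
  refine le_trans (le_of_eq (lintegral_congr_ae ?_)) (lintegral_sub_mean_le (q := q) hw
    (isOpen_openTri T.1) (convex_openTri T.1) (isBounded_openTri T.1) hsub
    (fun x hx => hΩ.radius_pos x (hsub hx)) (openTri_nonempty T.2) (dist_le_meshSize hK T.2)
    (hq.mono_measure (wMeas_le_of_triangle hΩ hK T.2 1)))
  filter_upwards [ae_wMeas_mem (isOpen_openTri T.1).measurableSet 1] with x hx
  rw [meshMean_eq q T hx]

end Mesh

/-! ### Approximation in interpolation spaces -/

section Interpolation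

variable {Ω : Set Pt} {K : Geometry.SimplicialComplex ℝ Pt}

/-- For every `t ≥ h` the approximation error is bounded by each competitor in the `K`-functional at
`t`. Competitors outside the spaces make the right side infinite. -/
theorem sq_le_sqL2_add_sqH1 (hΩ : IsMeridianDomain Ω) (hK : IsTriangulation Ω K)
    [Fintype (triangles K)] {q : Pt → ℝ} (hq : MemLp q 2 (wMeas Ω 1)) (q₁ : Pt → ℝ) {t : ℝ}
    (ht : meshSize K ≤ t) :
    eLpNorm (q - meshMean K q) 2 (wMeas Ω 1) ^ 2 ≤
      128 * (sqL2 Ω (q - q₁) + ENNReal.ofReal (t ^ 2) * sqH1 Ω q₁) := by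
  have hh := meshSize_pos hΩ hK
  by_cases h0 : MemLp (q - q₁) 2 (wMeas Ω 1)
  swap
  · simp [sqL2, h0]
  by_cases h1 : MemH1 Ω q₁
  swap
  · have ht0 : ENNReal.ofReal (t ^ 2) ≠ 0 := by
      have : 0 < t := hh.trans_le ht
      simpa using this.ne'
    simp [sqH1, h1, ENNReal.mul_top ht0]
  refine (lintegral_sub_meshMean_le hΩ hK hq (isWeakGrad_weakGrad h1.2.1)).trans ?_
  rw [sqL2, if_pos h0, sqH1, if_pos h1, mul_add, ← ENNReal.ofReal_pow hh.le, mul_assoc]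
  gcongr
  · norm_num
  · exact le_add_self

/-- The error does not depend on `t`. Integrating the previous bound against `t^(-2s-1)` over `t >
h` therefore gives `D² h^(-2s) / (2s) ≤ 128 ‖q‖²`. The case `s = 1` uses `q` itself as competitor at
`t = h`. -/
theorem eLpNorm_sub_meshMean_le (hΩ : IsMeridianDomain Ω) (hK : IsTriangulation Ω K)
    [Fintype (triangles K)] {s : ℝ} (hs : 0 < s) (hs1 : s ≤ 1)
    {q : Pt → ℝ} (hq : MemLp q 2 (wMeas Ω 1)) :
    eLpNorm (q - meshMean K q) 2 (wMeas Ω 1) ≤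
      ENNReal.ofReal (16 * meshSize K ^ s) * sobolevNorm Ω s q := by
  have hh := meshSize_pos hΩ hK
  set h := meshSize K
  set D := eLpNorm (q - meshMean K q) 2 (wMeas Ω 1) with hD
  have hpow : (h ^ s) ^ 2 = h ^ (2 * s) := by
    rw [← Real.rpow_natCast, ← Real.rpow_mul hh.le, mul_comm]
    norm_num
  have main : D ^ 2 ≤ ENNReal.ofReal (16 * h ^ s) ^ 2 *
      (if s = 1 then sqH1 Ω q else interpSq (sqL2 Ω) (sqH1 Ω) s q) := by
    rw [← ENNReal.ofReal_pow (by positivity), mul_pow, hpow]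
    split_ifs with h1
    · refine (sq_le_sqL2_add_sqH1 hΩ hK hq q le_rfl).trans ?_
      have : sqL2 Ω (q - q) = 0 := by
        rw [sub_self, sqL2, if_pos MemLp.zero]
        simp
      rw [this, zero_add, ← mul_assoc, h1, mul_one, Real.rpow_two,
        ENNReal.ofReal_mul (by norm_num)]
      gcongr
      rw [← ENNReal.ofReal_ofNat]
      exact ENNReal.ofReal_le_ofReal (by norm_num)
    · have hint : ∫⁻ t in Ioi h, ENNReal.ofReal (t ^ (-2 * s - 1)) =
          ENNReal.ofReal (h ^ (-(2 * s)) / (2 * s)) := by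
        rw [← ofReal_integral_eq_lintegral_ofReal
          (integrableOn_Ioi_rpow_of_lt (by linarith) hh), integral_Ioi_rpow_of_lt (by linarith) hh]
        · congr 1
          have e1 : -2 * s - 1 + 1 = -(2 * s) := by ring
          rw [e1, neg_div_neg_eq]
        · filter_upwards [ae_restrict_mem measurableSet_Ioi] with t ht
          exact Real.rpow_nonneg (hh.trans ht).le _
      have hlow : ENNReal.ofReal (h ^ (-(2 * s)) / (2 * s)) * D ^ 2 ≤
          128 * interpSq (sqL2 Ω) (sqH1 Ω) s q := by
        rw [← hint, ← lintegral_mul_const' _ _ (by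
          exact ENNReal.pow_ne_top ((hq.sub (meshMean_memLp hΩ q)).2.ne)), interpSq,
          ← lintegral_const_mul' _ _ (by norm_num)]
        calc _ ≤ ∫⁻ t in Ioi h, 128 * (ENNReal.ofReal (t ^ (-2 * s - 1)) *
              ⨅ q₁ : Pt → ℝ, (sqL2 Ω (q - q₁) + ENNReal.ofReal (t ^ 2) * sqH1 Ω q₁)) := by
              refine setLIntegral_mono' measurableSet_Ioi fun t ht => ?_
              rw [mul_left_comm]
              gcongr
              rw [ENNReal.mul_iInf_of_ne (by norm_num) (by norm_num)]
              exact le_iInf fun q₁ => sq_le_sqL2_add_sqH1 hΩ hK hq q₁ (le_of_lt ht)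
          _ ≤ _ := lintegral_mono_set (Ioi_subset_Ioi hh.le)
      have hmul : ENNReal.ofReal (2 * s * h ^ (2 * s)) * ENNReal.ofReal (h ^ (-(2 * s)) / (2 * s)) = 1 := by
        rw [← ENNReal.ofReal_mul (by positivity), ← ENNReal.ofReal_one]
        congr 1
        rw [Real.rpow_neg hh.le]
        have := (Real.rpow_pos_of_pos hh (2 * s)).ne'
        field_simp
      calc D ^ 2 = ENNReal.ofReal (2 * s * h ^ (2 * s)) *
            (ENNReal.ofReal (h ^ (-(2 * s)) / (2 * s)) * D ^ 2) := by
            rw [← mul_assoc, hmul, one_mul]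
        _ ≤ ENNReal.ofReal (2 * s * h ^ (2 * s)) * (128 * interpSq (sqL2 Ω) (sqH1 Ω) s q) := by
            gcongr
        _ ≤ _ := by
            rw [← mul_assoc]
            gcongr
            rw [← ENNReal.ofReal_ofNat, ← ENNReal.ofReal_mul (by positivity)]
            -- `2 s · 128 ≤ 256 = 16²` because `s ≤ 1`.
            refine ENNReal.ofReal_le_ofReal ?_
            have := Real.rpow_pos_of_pos hh (2 * s)
            nlinarith
  rw [sobolevNorm]
  generalize (if s = 1 then sqH1 Ω q else interpSq (sqL2 Ω) (sqH1 Ω) s q) = X at main ⊢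
  have hX : (X ^ (1 / 2 : ℝ)) ^ 2 = X := by
    rw [← ENNReal.rpow_natCast, ← ENNReal.rpow_mul]
    norm_num
  rw [← hX, ← mul_pow] at main
  exact (ENNReal.pow_right_strictMono (by norm_num : (2 : ℕ) ≠ 0)).le_iff_le.1 main

end Interpolation

/-! ### The pressure for unit viscosity, consistency functionals and the error equation -/

section Stokes

variable {Ω : Set Pt} {K : Geometry.SimplicialComplex ℝ Pt} {s ν : ℝ}
  {f u v w : Pt → Pt} {p α : Pt → ℝ}

theorem grad_const (c : ℝ) : grad (fun _ => c) = 0 := by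
  funext x
  ext i
  simp [grad]

theorem memH1_const (hΩ : IsMeridianDomain Ω) (c : ℝ) : MemH1 Ω fun _ => c := by
  have hfin : IsFiniteMeasure (wMeas Ω 1) :=
    ⟨lt_top_iff_ne_top.2 (wMeas_one_univ_ne_top hΩ.isBounded)⟩
  refine ⟨memLp_const c, ⟨_, isWeakGrad_of_contDiff contDiff_const⟩, ?_⟩
  have h : weakGrad Ω (fun _ => c) =ᵐ[wMeas Ω 1] grad fun _ => c :=
    wMeas_ac Ω 1 (weakGrad_smooth hΩ.isOpen (contDiff_const (c := c)))
  rw [grad_const] at h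
  exact (MemLp.zero (p := 2) (μ := wMeas Ω 1)).ae_eq h.symm

theorem formB_const (hΩ : IsMeridianDomain Ω) (hv : v ∈ velSpace Ω) (c : ℝ) :
    formB Ω (fun _ => c) v = 0 := by
  rw [formB_eq_neg_integral hΩ (memH1_const hΩ c) hv, neg_eq_zero]
  refine integral_eq_zero_of_ae ?_
  filter_upwards [wMeas_ac Ω 1 (weakGrad_smooth hΩ.isOpen (contDiff_const (c := c)))] with x hx
  rw [hx, grad_const]
  simp

/-- A field orthogonal to the pressure space is orthogonal to all of `L²_1(Ω)`. -/
theorem formB_eq_zero_of_memLp (hΩ : IsMeridianDomain Ω) (hv : v ∈ velSpace Ω)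
    (h : ∀ q ∈ presSpace Ω, formB Ω q v = 0) {q : Pt → ℝ} (hq : MemLp q 2 (wMeas Ω 1)) :
    formB Ω q v = 0 := by
  have hfin : IsFiniteMeasure (wMeas Ω 1) :=
    ⟨lt_top_iff_ne_top.2 (wMeas_one_univ_ne_top hΩ.isBounded)⟩
  have hne : NeZero (wMeas Ω 1) :=
    ⟨fun h => wMeas_one_univ_ne_zero hΩ.isOpen hΩ.radius_pos hΩ.isConnected.nonempty (by simp [h])⟩
  have hc : MemLp (fun _ : Pt => ⨍ y, q y ∂wMeas Ω 1) 2 (wMeas Ω 1) := memLp_const _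
  have h0 := h (q - fun _ => ⨍ y, q y ∂wMeas Ω 1) ⟨hq.sub hc, by
    have := integral_sub_average (wMeas Ω 1) q
    exact this⟩
  rw [formB_sub_left hΩ (energyField_of_mem hv) hq hc, formB_const hΩ hv] at h0
  linarith

theorem memLp_projLaplacian (hf : MemLp f 2 (wMeas Ω 1)) (hα : MemH1 Ω α) :
    MemLp (projLaplacian Ω ν f α) 2 (wMeas Ω 1) :=
  ((hf.sub hα.2.2).const_smul ν⁻¹).neg

theorem data_eq (hν : 0 < ν) (x : Pt) :
    f x = weakGrad Ω α x - ν • projLaplacian Ω ν f α x := by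
  simp only [projLaplacian, helmholtz, smul_neg, smul_smul, mul_inv_cancel₀ hν.ne', one_smul]
  abel

/-- The Stokes velocity is also the velocity of the problem with unit viscosity and data
`-ℙ(Δ_axi u)`, whose pressure is bounded by elliptic regularity. -/
theorem exists_regular_pressure (hΩ : IsMeridianDomain Ω) {Creg : ℝ}
    (hreg : HasEllipticRegularity Ω s Creg) (hν : 0 < ν) (hf : MemLp f 2 (wMeas Ω 1))
    (hα : MemH1 Ω α) (hu : IsStokesSolution Ω ν f u p) :
    ∃ q ∈ presSpace Ω,
      sobolevNorm Ω s q ≤ ENNReal.ofReal Creg * eLpNorm (projLaplacian Ω ν f α) 2 (wMeas Ω 1) ∧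
      ∀ w ∈ velSpace Ω, formA Ω u w + formB Ω q w =
        -∫ x, inner ℝ (projLaplacian Ω ν f α x) (w x) ∂wMeas Ω 1 := by
  set g := projLaplacian Ω ν f α with hgdef
  have hg : MemLp g 2 (wMeas Ω 1) := memLp_projLaplacian hf hα
  -- Regularity for the original data would bring in `ν⁻¹ ‖f‖` with its gradient part. The data `-g`
  -- contain neither.
  obtain ⟨u', q, hu', hn⟩ := hreg 1 (-g) one_pos hg.neg
  refine ⟨q, hu'.2.1, ?_, ?_⟩
  · rw [eLpNorm_neg] at hn
    exact le_add_self.trans hn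
  have eu : ∀ w ∈ velSpace Ω, ν * formA Ω u w + formB Ω p w + formB Ω α w =
      -(ν * ∫ x, inner ℝ (g x) (w x) ∂wMeas Ω 1) := by
    intro w hw
    have hwL := (energyField_of_mem hw).memLp
    rw [hu.2.2.1 w hw, pairL2_radius_smul hΩ, formB_eq_neg_integral hΩ hα hw]
    have : ∫ x, inner ℝ (f x) (w x) ∂wMeas Ω 1 =
        ∫ x, inner ℝ (weakGrad Ω α x) (w x) ∂wMeas Ω 1 -
          ν * ∫ x, inner ℝ (g x) (w x) ∂wMeas Ω 1 := by
      rw [← integral_const_mul, ← integral_sub (integrable_inner_of_memLp hα.2.2 hwL)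
        ((integrable_inner_of_memLp hg hwL).const_mul ν)]
      refine integral_congr_ae (Filter.Eventually.of_forall fun x => ?_)
      simp only
      conv_lhs => rw [data_eq (Ω := Ω) (f := f) (α := α) hν x]
      rw [inner_sub_left, real_inner_smul_left]
    rw [this]
    ring
  have eu' : ∀ w ∈ velSpace Ω, formA Ω u' w + formB Ω q w =
      -∫ x, inner ℝ (g x) (w x) ∂wMeas Ω 1 := by
    intro w hw
    have := hu'.2.2.1 w hw
    rw [one_mul, pairL2_radius_smul hΩ] at this
    rw [this, ← integral_neg]
    simp only [Pi.neg_apply, inner_neg_left]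
  have hE := energyField_of_mem hu.1
  have hE' := energyField_of_mem hu'.1
  have hd : u - u' ∈ velSpace Ω := velSpace_sub hΩ hu.1 hu'.1
  have hdE := energyField_of_mem hd
  have hdiv : ∀ r ∈ presSpace Ω, formB Ω r (u - u') = 0 := fun r hr => by
    rw [formB_sub_right hΩ hE hE' hr.1, hu.2.2.2 r hr, hu'.2.2.2 r hr, sub_zero]
  -- Uniqueness of the velocity: against a divergence-free field all pressures vanish. For `α`,
  -- which need not have mean zero, this uses that constants are also annihilated.
  have z : formA Ω (u - u') (u - u') = 0 := by
    have h1 := eu _ hd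
    have h2 := eu' _ hd
    rw [hdiv p hu.2.1, formB_eq_zero_of_memLp hΩ hd hdiv hα.1, add_zero, add_zero, ← mul_neg] at h1
    have h3 := mul_left_cancel₀ hν.ne' h1
    rw [hdiv q hu'.2.1, add_zero] at h2
    rw [formA_sub_left hΩ hE hE' hdE, h3, h2, sub_self]
  intro w hw
  have hwE := energyField_of_mem hw
  -- Zero energy makes `u - u'` invisible to `a` by Cauchy--Schwarz, so definiteness of the norm is
  -- not needed.
  have hz : formA Ω (u - u') w = 0 := by
    have h := abs_formA_le hdE hwE
    rw [normV, z, Real.sqrt_zero, zero_mul] at h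
    exact abs_nonpos_iff.1 h
  rw [formA_sub_left hΩ hE hE' hwE] at hz
  rw [← eu' w hw]
  linarith

theorem IsBernardiRaugel.sub (hv : IsBernardiRaugel Ω K v) (hw : IsBernardiRaugel Ω K w) :
    IsBernardiRaugel Ω K (v - w) := by
  obtain ⟨hv0, β, hβ, hvβ⟩ := hv
  obtain ⟨hw0, γ, hγ, hwγ⟩ := hw
  refine ⟨fun x hx => by simp [hv0 x hx, hw0 x hx], β - γ, fun E hE M hM N hN => ?_,
    fun T hT lam h0 h1 => ?_⟩
  · rw [Pi.sub_apply, inner_sub_left, hβ E hE M hM N hN, hγ E hE M hM N hN, sub_zero]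
  · simp only [Pi.sub_apply, hvβ T hT lam h0 h1, hwγ T hT lam h0 h1, smul_sub,
      Finset.sum_sub_distrib]
    abel

/-- Of the Bernardi--Raugel space only conformity and closure under differences are used; no inf-sup
condition enters. -/
theorem velSpaceH0_sub (hΩ : IsMeridianDomain Ω) (hv : v ∈ velSpaceH0 Ω K)
    (hw : w ∈ velSpaceH0 Ω K) : v - w ∈ velSpaceH0 Ω K := by
  refine ⟨⟨velSpace_sub hΩ hv.1.1 hw.1.1, hv.1.2.sub hw.1.2⟩, fun q hq => ?_⟩
  rw [formB_sub_right hΩ (energyField_of_mem hv.1.1) (energyField_of_mem hw.1.1) hq.1.1,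
    hv.2 q hq, hw.2 q hq, sub_zero]

/-! ### Dual norms -/

variable {ℓ : (Pt → Pt) → ℝ} {M : ℝ}

theorem bddAbove_dualQuotients (h : ∀ w ∈ velSpaceH0 Ω K, |ℓ w| ≤ M * normV Ω w) :
    BddAbove (dualQuotients Ω K ℓ) := by
  -- The 0 accounts for the quotients with vanishing denominator.
  refine ⟨max M 0, ?_⟩
  rintro _ ⟨w, hw, rfl⟩
  rcases (normV_nonneg (Ω := Ω) w).eq_or_lt with h0 | h0
  · simp [← h0]
  · exact le_max_of_le_left ((div_le_iff₀ h0).2 ((le_abs_self _).trans (h w hw)))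

/-- For a field of zero norm the quotient carries no information. There the a priori bound itself
forces `ℓ w = 0`. -/
theorem le_sSup_dualQuotients (h : ∀ w ∈ velSpaceH0 Ω K, |ℓ w| ≤ M * normV Ω w)
    (hw : w ∈ velSpaceH0 Ω K) : ℓ w ≤ sSup (dualQuotients Ω K ℓ) * normV Ω w := by
  rcases (normV_nonneg (Ω := Ω) w).eq_or_lt with h0 | h0
  · have := h w hw
    rw [← h0, mul_zero] at this ⊢
    exact (le_abs_self _).trans this
  · exact (div_le_iff₀ h0).1 (le_csSup (bddAbove_dualQuotients h) (mem_image_of_mem _ hw))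

theorem sSup_dualQuotients_nonneg (hΩ : IsMeridianDomain Ω)
    (h : ∀ w ∈ velSpaceH0 Ω K, |ℓ w| ≤ M * normV Ω w) (hw : w ∈ velSpaceH0 Ω K) :
    0 ≤ sSup (dualQuotients Ω K ℓ) := by
  refine le_csSup (bddAbove_dualQuotients h) ⟨w - w, velSpaceH0_sub hΩ hw hw, ?_⟩
  have hE := energyField_of_mem hw.1.1
  have : normV Ω (w - w) = 0 := by
    rw [normV, formA_sub_left hΩ hE hE (hE.sub hΩ hE), sub_self, Real.sqrt_zero]
  simp only [this, div_zero]

theorem normL2_le_normV_of_friedrichs {R : ℝ} (hR : 0 ≤ R) (hE : EnergyField Ω w)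
    (h : ∀ i : Fin 2, eLpNorm (fun x => w x i) 2 (wMeas Ω 1) ≤
      ENNReal.ofReal R * eLpNorm (weakGrad Ω fun x => w x i) 2 (wMeas Ω 1)) :
    normL2 Ω 1 w ≤ 2 * R * normV Ω w := by
  have hi : ∀ i : Fin 2, (eLpNorm (fun x => w x i) 2 (wMeas Ω 1)).toReal ≤ R * normV Ω w := by
    intro i
    have h1 := ENNReal.toReal_mono
      (ENNReal.mul_ne_top ENNReal.ofReal_ne_top (hE.memH1 i).2.2.2.ne) (h i)
    rw [ENNReal.toReal_mul, ENNReal.toReal_ofReal hR] at h1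
    exact h1.trans (mul_le_mul_of_nonneg_left (normL2_grad_le_normV hE i) hR)
  have h2 := ENNReal.toReal_mono (ENNReal.sum_ne_top.2 fun i _ => (hE.memH1 i).1.2.ne)
    (normL2_le_of_components fun i => (hE.memH1 i).1)
  rw [ENNReal.toReal_sum fun i _ => (hE.memH1 i).1.2.ne, Fin.sum_univ_two] at h2
  have h3 := hi 0
  have h4 := hi 1
  rw [normL2]
  linarith

variable {R : (Pt → Pt) →ₗ[ℝ] (Pt → Pt)} {CR : ℝ} {g : Pt → Pt}

theorem pairL2_sub_right (hΩ : IsMeridianDomain Ω) (hg : MemLp g 2 (wMeas Ω 1)) {y z : Pt → Pt}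
    (hy : MemLp y 2 (wMeas Ω (-1))) (hz : MemLp z 2 (wMeas Ω (-1))) :
    pairL2 Ω g (fun x => y x - z x) = pairL2 Ω g y - pairL2 Ω g z := by
  rw [pairL2, pairL2, pairL2, ← integral_sub (integrableOn_inner_of_memLp hΩ hg hy)
    (integrableOn_inner_of_memLp hΩ hg hz)]
  simp only [inner_sub_right]

theorem abs_gradientDefect_le (hΩ : IsMeridianDomain Ω) (hR : IsContinuousReconstruction Ω K R CR)
    (hα : MemH1 Ω α) (hw : w ∈ velSpaceH0 Ω K) :
    |gradientDefect Ω R α w| ≤ normL2 Ω 1 (weakGrad Ω α) * CR * normV Ω w := by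
  obtain ⟨h1, h2⟩ := hR w hw.1
  refine (abs_setIntegral_inner_le hΩ hα.2.2 h1).trans ?_
  rw [mul_assoc]
  exact mul_le_mul_of_nonneg_left h2 (normL2_nonneg _ _)

theorem laplacianDefect_eq (hΩ : IsMeridianDomain Ω) (hR : IsContinuousReconstruction Ω K R CR)
    (hg : MemLp g 2 (wMeas Ω 1)) (hw : w ∈ velSpaceH0 Ω K) :
    laplacianDefect Ω R g w = ∫ x, inner ℝ (g x) (w x) ∂wMeas Ω 1 -
      pairL2 Ω g (R fun x => x 0 • w x) := by
  rw [laplacianDefect, pairL2_sub_right hΩ hg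
    (memLp_radius_smul hΩ (energyField_of_mem hw.1.1).memLp) (hR w hw.1).1, pairL2_radius_smul hΩ]

/-- The reconstructed part is bounded by hypothesis and the part `(g, r w)` by the Friedrichs
inequality. The resulting constant serves only for finiteness and does not enter the error estimate.
-/
theorem abs_laplacianDefect_le (hΩ : IsMeridianDomain Ω)
    (hR : IsContinuousReconstruction Ω K R CR) (hg : MemLp g 2 (wMeas Ω 1)) {CF : ℝ}
    (hF : ∀ w ∈ velSpace Ω, normL2 Ω 1 w ≤ CF * normV Ω w) (hw : w ∈ velSpaceH0 Ω K) :
    |laplacianDefect Ω R g w| ≤ normL2 Ω 1 g * (CF + CR) * normV Ω w := by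
  obtain ⟨h1, h2⟩ := hR w hw.1
  have h3 := hF w hw.1.1
  have h4 : |∫ x, inner ℝ (g x) (w x) ∂wMeas Ω 1| ≤ normL2 Ω 1 g * normL2 Ω 1 w :=
    abs_integral_inner_le hg (energyField_of_mem hw.1.1).memLp
  have h5 : |pairL2 Ω g (R fun x => x 0 • w x)| ≤ _ := abs_setIntegral_inner_le hΩ hg h1
  have h0 := normL2_nonneg (Ω := Ω) 1 g
  rw [laplacianDefect_eq hΩ hR hg hw]
  refine (abs_sub _ _).trans ((add_le_add h4 h5).trans ?_)
  nlinarith [mul_le_mul_of_nonneg_left h2 h0, mul_le_mul_of_nonneg_left h3 h0]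

/-- The discrete pressure error bound `|b(q, w_h)| ≲ h^s ‖q‖_{H^s_1} ‖w_h‖_V` on discretely
divergence-free fields. -/
theorem abs_formB_discrete_le (hΩ : IsMeridianDomain Ω) (hK : IsTriangulation Ω K)
    (hs : 0 < s) (hs1 : s ≤ 1) {q : Pt → ℝ} (hq : q ∈ presSpace Ω) {B : ℝ} (hB : 0 ≤ B)
    (hqB : sobolevNorm Ω s q ≤ ENNReal.ofReal B) (hw : w ∈ velSpaceH0 Ω K) :
    |formB Ω q w| ≤ 48 * meshSize K ^ s * B * normV Ω w := by
  have := (triangles_finite hK).fintype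
  have hh := meshSize_pos hΩ hK
  have hm := meshMean_mem hΩ hK hq
  have hE := energyField_of_mem hw.1.1
  -- The piecewise mean lies in `Q_h`, against which `w` is discretely divergence free.
  have h1 : formB Ω q w = formB Ω (q - meshMean K q) w := by
    rw [formB_sub_left hΩ hE hq.1 hm.1.1, hw.2 _ hm, sub_zero]
  have h2 : normL2 Ω 1 (q - meshMean K q) ≤ 16 * meshSize K ^ s * B := by
    refine ENNReal.toReal_le_of_le_ofReal (by positivity) ?_
    refine (eLpNorm_sub_meshMean_le hΩ hK hs hs1 hq.1).trans ?_
    rw [ENNReal.ofReal_mul (by positivity : 0 ≤ 16 * meshSize K ^ s)]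
    gcongr
  rw [h1]
  refine (abs_formB_le hΩ hE (hq.1.sub hm.1.1)).trans ?_
  have := mul_le_mul_of_nonneg_right h2 (normV_nonneg (Ω := Ω) w)
  linarith

/-- The error equation: the velocity error against a discretely divergence-free field. -/
theorem formA_discrete_eq (hΩ : IsMeridianDomain Ω) (hR : IsContinuousReconstruction Ω K R CR)
    (hν : 0 < ν) (hf : MemLp f 2 (wMeas Ω 1)) (hα : MemH1 Ω α) {uh : Pt → Pt} {ph : Pt → ℝ}
    (huh : IsDiscreteSolution Ω K R ν f uh ph) (hw : w ∈ velSpaceH0 Ω K) :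
    formA Ω uh w = ν⁻¹ * gradientDefect Ω R α w + (laplacianDefect Ω R (projLaplacian Ω ν f α) w -
      ∫ x, inner ℝ (projLaplacian Ω ν f α x) (w x) ∂wMeas Ω 1) := by
  have hg : MemLp (projLaplacian Ω ν f α) 2 (wMeas Ω 1) := memLp_projLaplacian hf hα
  obtain ⟨h1, -⟩ := hR w hw.1
  have e := huh.2.2.1 w hw.1
  rw [hw.2 ph huh.2.1, add_zero] at e
  have e2 : pairL2 Ω f (R fun x => x 0 • w x) = gradientDefect Ω R α w -
      ν * pairL2 Ω (projLaplacian Ω ν f α) (R fun x => x 0 • w x) := by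
    rw [gradientDefect, pairL2, pairL2, pairL2, ← integral_const_mul,
      ← integral_sub (integrableOn_inner_of_memLp hΩ hα.2.2 h1)
        ((integrableOn_inner_of_memLp hΩ hg h1).const_mul ν)]
    refine integral_congr_ae (Filter.Eventually.of_forall fun x => ?_)
    simp only
    conv_lhs => rw [data_eq (Ω := Ω) (f := f) (α := α) hν x]
    rw [inner_sub_left, real_inner_smul_left]
  rw [laplacianDefect_eq hΩ hR hg hw]
  rw [e2] at e
  field_simp
  linarith

end Stokes

end AxiStokes

end

/-! ### The a priori error estimate -/

open AxiStokes in
theorem theorem3p2 (Ω : Set AxiStokes.Pt) (hΩ : AxiStokes.IsMeridianDomain Ω)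
    (s : ℝ) (hs : 0 < s) (hs1 : s ≤ 1)
    (Creg : ℝ) (hreg : AxiStokes.HasEllipticRegularity Ω s Creg) :
    ∃ C : ℝ, 0 < C ∧
      ∀ (K : Geometry.SimplicialComplex ℝ AxiStokes.Pt), AxiStokes.IsTriangulation Ω K →
      ∀ (R : (AxiStokes.Pt → AxiStokes.Pt) →ₗ[ℝ] (AxiStokes.Pt → AxiStokes.Pt)) (CR : ℝ),
        AxiStokes.IsContinuousReconstruction Ω K R CR →
      ∀ (ν : ℝ), 0 < ν →
      ∀ (f : AxiStokes.Pt → AxiStokes.Pt), MemLp f 2 (AxiStokes.wMeas Ω 1) →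
      ∀ (α : AxiStokes.Pt → ℝ), AxiStokes.IsHelmholtzPotential Ω f α →
      ∀ (u : AxiStokes.Pt → AxiStokes.Pt) (p : AxiStokes.Pt → ℝ),
        AxiStokes.IsStokesSolution Ω ν f u p →
      ∀ (uh : AxiStokes.Pt → AxiStokes.Pt) (ph : AxiStokes.Pt → ℝ),
        AxiStokes.IsDiscreteSolution Ω K R ν f uh ph →
        BddAbove (AxiStokes.dualQuotients Ω K
          (AxiStokes.laplacianDefect Ω R (AxiStokes.projLaplacian Ω ν f α))) ∧
        BddAbove (AxiStokes.dualQuotients Ω K (AxiStokes.gradientDefect Ω R α)) ∧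
        AxiStokes.normV Ω (u - uh) ≤
          C * (sInf ((fun vh => AxiStokes.normV Ω (u - vh)) '' AxiStokes.velSpaceH0 Ω K) +
            AxiStokes.meshSize K ^ s *
              AxiStokes.normL2 Ω 1 (AxiStokes.projLaplacian Ω ν f α) +
            AxiStokes.consistencyError Ω K R ν f α) := by
  obtain ⟨CF, hCF, hF⟩ := exists_friedrichs hΩ
  set c := max Creg 0 with hc
  have hc0 : 0 ≤ c := le_max_right _ _
  -- The 2 comes from the triangle inequality, and `48 = 3 · 16` from the continuity of `b` times
  -- the approximation constant. Nothing depends on the mesh or the reconstruction.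
  refine ⟨2 + 48 * c, by positivity, fun K hK R CR hR ν hν f hf α hα u p hu uh ph huh => ?_⟩
  have hg : MemLp (projLaplacian Ω ν f α) 2 (wMeas Ω 1) := memLp_projLaplacian hf hα.1
  obtain ⟨q, hq, hqn, hqe⟩ := exists_regular_pressure hΩ hreg hν hf hα.1 hu
  have hFr : ∀ w ∈ velSpace Ω, normL2 Ω 1 w ≤ 2 * CF * normV Ω w := fun w hw =>
    normL2_le_normV_of_friedrichs hCF.le (energyField_of_mem hw) (hF w hw)
  have hL := fun w (hw : w ∈ velSpaceH0 Ω K) => abs_laplacianDefect_le hΩ hR hg hFr hw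
  have hG := fun w (hw : w ∈ velSpaceH0 Ω K) => abs_gradientDefect_le hΩ hR hα.1 hw
  refine ⟨bddAbove_dualQuotients hL, bddAbove_dualQuotients hG, ?_⟩
  have huh0 : uh ∈ velSpaceH0 Ω K := ⟨huh.1, huh.2.2.2⟩
  have hS1 := sSup_dualQuotients_nonneg hΩ hL huh0
  have hS2 := sSup_dualQuotients_nonneg hΩ hG huh0
  have hN := normL2_nonneg (Ω := Ω) 1 (projLaplacian Ω ν f α)
  have hqB : sobolevNorm Ω s q ≤
      ENNReal.ofReal (c * normL2 Ω 1 (projLaplacian Ω ν f α)) := by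
    rw [ENNReal.ofReal_mul hc0, normL2, ENNReal.ofReal_toReal hg.2.ne]
    refine hqn.trans ?_
    gcongr
    exact le_max_left _ _
  set N := normL2 Ω 1 (projLaplacian Ω ν f α) with hNdef
  set S₁ := sSup (dualQuotients Ω K (laplacianDefect Ω R (projLaplacian Ω ν f α))) with hS₁
  set S₂ := sSup (dualQuotients Ω K (gradientDefect Ω R α)) with hS₂
  have hcons : consistencyError Ω K R ν f α = S₁ + ν⁻¹ * S₂ := rfl
  have hhs : 0 ≤ meshSize K ^ s := Real.rpow_nonneg (meshSize_pos hΩ hK).le s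
  have hν' : 0 ≤ ν⁻¹ := inv_nonneg.2 hν.le
  have hE := energyField_of_mem hu.1
  have hEh := energyField_of_mem huh.1.1
  have step : ∀ vh ∈ velSpaceH0 Ω K, normV Ω (u - uh) ≤
      2 * normV Ω (u - vh) + (48 * meshSize K ^ s * (c * N) + (S₁ + ν⁻¹ * S₂)) := by
    intro vh hvh
    have hEv := energyField_of_mem hvh.1.1
    have hw : uh - vh ∈ velSpaceH0 Ω K := velSpaceH0_sub hΩ huh0 hvh
    have hEw := energyField_of_mem hw.1.1
    have hEuv := hE.sub hΩ hEv
    set W := normV Ω (uh - vh) with hW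
    have hW0 : 0 ≤ W := normV_nonneg _
    have e1 := hqe _ hw.1.1
    have e2 := formA_discrete_eq hΩ hR hν hf hα.1 huh hw
    -- The second bracket is the consistency error: by `e1` and `e2`, where the terms `(g, w)`
    -- cancel, it equals `b(q, w)` plus the two defects.
    have e3 : W ^ 2 = formA Ω (u - vh) (uh - vh) + (formA Ω uh (uh - vh) - formA Ω u (uh - vh)) := by
      rw [hW, normV_sq hEw, formA_sub_left hΩ hEh hEv hEw, formA_sub_left hΩ hE hEv hEw]
      ring
    have b1 := (le_abs_self _).trans (abs_formA_le hEuv hEw)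
    have b2 := (le_abs_self _).trans (abs_formB_discrete_le hΩ hK hs hs1 hq (by positivity) hqB hw)
    have b3 := le_sSup_dualQuotients hL hw
    have b4 := mul_le_mul_of_nonneg_left (le_sSup_dualQuotients hG hw) hν'
    have b5 : W * W ≤
        (normV Ω (u - vh) + (48 * meshSize K ^ s * (c * N) + (S₁ + ν⁻¹ * S₂))) * W := by
      nlinarith
    have b6 : W ≤ normV Ω (u - vh) + (48 * meshSize K ^ s * (c * N) + (S₁ + ν⁻¹ * S₂)) := by
      rcases hW0.eq_or_lt with h0 | h0
      · rw [← h0]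
        have := normV_nonneg (Ω := Ω) (u - vh)
        positivity
      · exact le_of_mul_le_mul_right b5 h0
    have b7 := normV_sub_le hΩ hEuv hEw
    have e4 : u - vh - (uh - vh) = u - uh := by abel
    rw [e4] at b7
    linarith
  set I := sInf ((fun vh => normV Ω (u - vh)) '' velSpaceH0 Ω K) with hI
  have hI0 : 0 ≤ I := by
    refine Real.sInf_nonneg ?_
    rintro _ ⟨v, -, rfl⟩
    exact normV_nonneg _
  -- Solved for `‖u - v_h‖_V`, the bound holds for every `v_h` and passes to the infimum. The set is
  -- nonempty because it contains the value at `u_h`.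
  have hIle : (normV Ω (u - uh) - (48 * meshSize K ^ s * (c * N) + (S₁ + ν⁻¹ * S₂))) / 2 ≤ I := by
    refine le_csInf ⟨_, mem_image_of_mem _ huh0⟩ ?_
    rintro _ ⟨v, hv, rfl⟩
    have := step v hv
    simp only
    linarith
  rw [hcons]
  have hT : 0 ≤ S₁ + ν⁻¹ * S₂ := by positivity
  -- The common factor `2 + 48 c` exceeds the coefficient of each of the three terms, and these
  -- products supply the slack.
  have p1 := mul_nonneg hc0 hI0
  have p2 := mul_nonneg hc0 hT
  have p3 := mul_nonneg hhs hN
  nlinarith
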